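/- **Setting.** Let $z$ be the stereographic coordinate on $\mathbb S^2$ and let $L^2(\mathbb S^2)$ be the complex $L^2$ space of the area measure $4(1+|z|^2)^{-2}\,dx\,dy$. For $w\in\mathbb R$, $s\in\mathbb Z$ and $\Lambda=\begin{pmatrix}a&b\\c&d\end{pmatrix}\in SL(2,\mathbb C)$, a function $\varphi\in L^2(\mathbb S^2)$ of conformal weight $w$ and spin weight $s$ is transformed into $$ z\mapsto \varpi_\Lambda(z)^{-w}\,e^{-is\phi_\Lambda(z)}\,\varphi\!\left(\tfrac{az+b}{cz+d}\right),\qquad \varpi_\Lambda=\frac{1+|z|^2}{|az+b|^2+|cz+d|^2},\quad e^{i\phi_\Lambda}=\frac{\bar c\bar z+\bar d}{cz+d}. $$ This pullback along $\Lambda$ is a right action; write $\Lambda\varphi$ for the corresponding left action (the pullback along $\Lambda^{-1}$). The little group $L_\varphi\subset SL(2,\mathbb C)$ is the group of all $\Lambda$ with $\Lambda\varphi=\varphi$ in $L^2(\mathbb S^2)$, and the orbit $\mathscr O_\varphi=\{\Lambda\varphi\}$ carries the topology of $L^2(\mathbb S^2)$. Let $\Gamma=\{\mathrm{diag}(e^{i\psi/2},e^{-i\psi/2})\}$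 (the double cover of the rotations about one axis) and $\mathbb Z_2=\{\pm1\}$. An invariant measure on an orbit is a non-zero Borel measure, finite on compact sets, invariant under $SL(2,\mathbb C)$. Put $R_3(\phi)=\mathrm{diag}(e^{-i\phi/2},e^{i\phi/2})$, $R_2(\theta)=\begin{pmatrix}\cos\frac\theta2&-\sin\frac\theta2\\ \sin\frac\theta2&\cos\frac\theta2\end{pmatrix}$, $B(t)=\mathrm{diag}(e^{-t/2},e^{t/2})$, $N(u,v)=\begin{pmatrix}1&0\\u+iv&1\end{pmatrix}$. **Theorem.** Let $w\le-1$ be real and $s\in\mathbb Z$. For functions $\varphi\in L^2(\mathbb S^2)$ of weight $(w,s)$: 1. (Invariant functions.) $L_\varphi=SL(2,\mathbb C)$ iff $\varphi=0$; $SU(2)\subseteq L_\varphi$ iff $\varphi=0$ or ($s=0$ and $\varphi$ is constant); $\Gamma\subseteq L_\varphi$ iff $\varphi=e^{is\arg z}\varphi_0(|z|)$ for some function $\varphi_0$; $\mathbb Z_2\subseteq L_\varphi$ always. (Equalities of functions are almost everywhere.) 2. (Classification.) Consider the following four mutually exclusive and exhaustive conditions: (i) $\varphi=0$; (ii) $\varphi\ne0$,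 $s=0$ and some $\Lambda\varphi$ is constant; (iii) neither (i) nor (ii), and some $\Lambda\varphi$ has the form $e^{is\arg z}\varphi_0(|z|)$; (iv) no $\Lambda\varphi$ has that form. For every $\varphi$ the identity component of $L_\varphi$ is $SL(2,\mathbb C)$ iff (i) holds, conjugate to $SU(2)$ iff (ii) holds, conjugate to $\Gamma$ iff (iii) holds, and trivial iff (iv) holds. Consequently, if $L_\varphi$ is connected or equal to $\mathbb Z_2$, then $L_\varphi$ is $SL(2,\mathbb C)$ in case (i), conjugate to $SU(2)$ in case (ii), conjugate to $\Gamma$ in case (iii), and equal to $\mathbb Z_2$ in case (iv). 3. (Occurrence.) $SU(2)$ is a little group iff $s=0$; $\Gamma$ is a little group for all $s$; and the set of $\varphi$ with $L_\varphi=\mathbb Z_2$ is residual (comeagre) in $L^2(\mathbb S^2)$, so that $\mathbb Z_2$ is the little group of a generic $\varphi$. 4. (Orbits and invariant measures.) For every $\varphi$ the natural bijection $\mathscr O_\varphi\to SL(2,\mathbb C)/L_\varphi$ is a homeomorphism. Moreover: - if $L_\varphi=SL(2,\mathbb C)$, then $\mathscr O_\varphi=\{0\}$; - if $L_\varphi=SU(2)$,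 then there is a homeomorphism $\mathscr O_\varphi\to\mathbb R^3$, $\Lambda\varphi\mapsto\vec k$, determined by $\Lambda\Lambda^\dagger=\begin{pmatrix}k_0+k_3&k_1+ik_2\\k_1-ik_2&k_0-k_3\end{pmatrix}$ with $k_0=\sqrt{1+\vec k^2}$, and $d^3\vec k/\sqrt{1+\vec k^2}$ is an invariant measure; - if $L_\varphi=\Gamma$, then $\mathscr O_\varphi$ is homeomorphic to $\mathbb R^3\times\mathbb S^2$; the map $(t,\tilde u,\tilde v,\phi,\theta)\mapsto R_3(\phi)R_2(\theta)N(\tilde u,\tilde v)B(t)\varphi$ with $t,\tilde u,\tilde v\in\mathbb R$, $0\le\phi<2\pi$, $0\le\theta\le\pi$ is onto $\mathscr O_\varphi$ and injective for $0<\theta<\pi$; and $dt\,d\tilde u\,d\tilde v\,d\phi\,d(\cos\theta)$ is an invariant measure in these coordinates; - if $L_\varphi=\mathbb Z_2$, then $\mathscr O_\varphi$ is homeomorphic to $\mathbb R^3\times\mathbb{RP}^3$; the map $(t,u,v,\phi,\psi,\theta)\mapsto R_3(\phi)R_2(\theta)R_3(\psi)B(t)N(u,v)\varphi$ with $t,u,v\in\mathbb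 R$, $0\le\phi,\psi<2\pi$, $0\le\theta\le\pi$ is onto $\mathscr O_\varphi$ and injective for $0<\theta<\pi$; and $e^{2t}\,dt\,du\,dv\,d\phi\,d\psi\,d(\cos\theta)$ is an invariant measure in these coordinates. Here $d(\cos\theta)$ denotes the positive measure $\sin\theta\,d\theta$. 5. (Gravitational memory.) If $s=-2$, $\varphi\neq0$, and $L_\varphi$ is connected or equal to $\mathbb Z_2$, then $L_\varphi$ is conjugate to $\Gamma$ or equal to $\mathbb Z_2$. -/

import Mathlib

open MeasureTheory
open scoped ENNReal ComplexConjugate MatrixGroups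

namespace WeightedSphere

noncomputable section

/-- The group `SL(2,ℂ)`, the double cover of the connected Lorentz group. -/
abbrev SL2C : Type := Matrix.SpecialLinearGroup (Fin 2) ℂ

/-- The area measure of the unit sphere in the stereographic coordinate `z`, that is
`4 (1 + |z|²)⁻² dx dy`. The coordinate misses only the point `z = ∞`, which has measure zero. -/
def sphereMeasure : Measure ℂ :=
  volume.withDensity fun z => ENNReal.ofReal (4 / (1 + ‖z‖ ^ 2) ^ 2)

/-- `z ↦ (a z + b) / (c z + d)`; the value at the pole is immaterial (a null set). -/
def mobius (Λ : SL2C) (z : ℂ) : ℂ := (Λ 0 0 * z + Λ 0 1) / (Λ 1 0 * z + Λ 1 1)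

/-- The conformal factor `ϖ_Λ(z) = (1 + |z|²) / (|a z + b|² + |c z + d|²)`. -/
def confFactor (Λ : SL2C) (z : ℂ) : ℝ :=
  (1 + ‖z‖ ^ 2) / (‖Λ 0 0 * z + Λ 0 1‖ ^ 2 + ‖Λ 1 0 * z + Λ 1 1‖ ^ 2)

/-- The phase `e^{i φ_Λ(z)} = conj (c z + d) / (c z + d)`. -/
def spinPhase (Λ : SL2C) (z : ℂ) : ℂ :=
  conj (Λ 1 0 * z + Λ 1 1) / (Λ 1 0 * z + Λ 1 1)

/-- The transformation law of a function of conformal weight `w` and spin weight `s`: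
`(Λ f)(z) = ϖ_Λ(z)^{-w} e^{-i s φ_Λ(z)} f(Λ z)`. -/
def pullback (w : ℝ) (s : ℤ) (Λ : SL2C) (f : ℂ → ℂ) (z : ℂ) : ℂ :=
  ((confFactor Λ z ^ (-w) : ℝ) : ℂ) * spinPhase Λ z ^ (-s) * f (mobius Λ z)

theorem det_eq (Λ : SL2C) : Λ 0 0 * Λ 1 1 - Λ 0 1 * Λ 1 0 = 1 := by
  have := Λ.det_coe
  rwa [Matrix.det_fin_two] at this

theorem ae_sphere {p : ℂ → Prop} (h : ∀ᵐ z, p z) : ∀ᵐ z ∂sphereMeasure, p z :=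
  (withDensity_absolutelyContinuous _ _).ae_le h

theorem ae_denom_ne (Λ : SL2C) : ∀ᵐ z : ℂ, Λ 1 0 * z + Λ 1 1 ≠ 0 := by
  have hd := det_eq Λ
  refine (Set.Subsingleton.countable (s := {z : ℂ | ¬ (Λ 1 0 * z + Λ 1 1 ≠ 0)}) ?_).measure_zero _
  intro x hx y hy
  simp only [ne_eq, not_not, Set.mem_ofPred_eq] at hx hy
  by_cases hc : Λ 1 0 = 0
  · simp only [hc, zero_mul, zero_add] at hx
    simp [hc, hx] at hd
  · apply mul_left_cancel₀ hc
    linear_combination hx - hy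

theorem denom_pos (Λ : SL2C) (z : ℂ) :
    0 < ‖Λ 0 0 * z + Λ 0 1‖ ^ 2 + ‖Λ 1 0 * z + Λ 1 1‖ ^ 2 := by
  by_contra h
  have h1 : ‖Λ 0 0 * z + Λ 0 1‖ ^ 2 = 0 := by nlinarith [sq_nonneg ‖Λ 0 0 * z + Λ 0 1‖, sq_nonneg ‖Λ 1 0 * z + Λ 1 1‖]
  have h2 : ‖Λ 1 0 * z + Λ 1 1‖ ^ 2 = 0 := by nlinarith [sq_nonneg ‖Λ 0 0 * z + Λ 0 1‖, sq_nonneg ‖Λ 1 0 * z + Λ 1 1‖]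
  have h1' : Λ 0 0 * z + Λ 0 1 = 0 := by simpa using h1
  have h2' : Λ 1 0 * z + Λ 1 1 = 0 := by simpa using h2
  have := det_eq Λ
  have : (1 : ℂ) = 0 := by
    rw [← this]; linear_combination (Λ 0 0) * h2' - (Λ 1 0) * h1'
  exact one_ne_zero this

theorem confFactor_pos (Λ : SL2C) (z : ℂ) : 0 < confFactor Λ z :=
  div_pos (by positivity) (denom_pos Λ z)

theorem norm_sq_mobius (Λ : SL2C) {z : ℂ} (h : Λ 1 0 * z + Λ 1 1 ≠ 0) :
    1 + ‖mobius Λ z‖ ^ 2 =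
      (‖Λ 0 0 * z + Λ 0 1‖ ^ 2 + ‖Λ 1 0 * z + Λ 1 1‖ ^ 2) / ‖Λ 1 0 * z + Λ 1 1‖ ^ 2 := by
  have : ‖Λ 1 0 * z + Λ 1 1‖ ≠ 0 := by simpa using h
  rw [mobius, norm_div, div_pow, add_div, div_self (pow_ne_zero 2 this), add_comm]

theorem mul_apply' (Λ M : SL2C) (i j : Fin 2) :
    (Λ * M) i j = Λ i 0 * M 0 j + Λ i 1 * M 1 j := by
  rw [Matrix.SpecialLinearGroup.coe_mul, Matrix.mul_apply, Fin.sum_univ_two]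

theorem denom_mul (Λ M : SL2C) {z : ℂ} (h : M 1 0 * z + M 1 1 ≠ 0) (i : Fin 2) :
    (Λ i 0 * mobius M z + Λ i 1) * (M 1 0 * z + M 1 1) = (Λ * M) i 0 * z + (Λ * M) i 1 := by
  rw [mobius, mul_apply', mul_apply', add_mul, mul_assoc, div_mul_cancel₀ _ h]; ring

theorem mobius_mul (Λ M : SL2C) {z : ℂ} (h : M 1 0 * z + M 1 1 ≠ 0) :
    mobius Λ (mobius M z) = mobius (Λ * M) z := by
  have h0 := denom_mul Λ M h 0
  have h1 := denom_mul Λ M h 1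
  rw [mobius.eq_def (Λ * M), ← h0, ← h1, mul_div_mul_right _ _ h, mobius.eq_def Λ]

theorem spinPhase_mul (Λ M : SL2C) {z : ℂ} (h : M 1 0 * z + M 1 1 ≠ 0) :
    spinPhase Λ (mobius M z) * spinPhase M z = spinPhase (Λ * M) z := by
  have h1 := denom_mul Λ M h 1
  rw [spinPhase, spinPhase, spinPhase, ← h1, map_mul, div_mul_div_comm]

theorem confFactor_mul (Λ M : SL2C) {z : ℂ} (h : M 1 0 * z + M 1 1 ≠ 0) :
    confFactor Λ (mobius M z) * confFactor M z = confFactor (Λ * M) z := by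
  have h0 := denom_mul Λ M h 0
  have h1 := denom_mul Λ M h 1
  have hn : ‖M 1 0 * z + M 1 1‖ ≠ 0 := by simpa using h
  have p1 := denom_pos M z
  have p2 := denom_pos Λ (mobius M z)
  rw [confFactor, confFactor, confFactor, ← h0, ← h1, norm_mul, norm_mul, norm_sq_mobius M h]
  generalize ‖M 1 0 * z + M 1 1‖ = n at *
  generalize ‖M 0 0 * z + M 0 1‖ = m at *
  generalize ‖Λ 0 0 * mobius M z + Λ 0 1‖ = p at *
  generalize ‖Λ 1 0 * mobius M z + Λ 1 1‖ = q at *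
  rw [mul_pow, mul_pow, ← add_mul, div_mul_div_comm, div_mul_eq_mul_div, div_div,
    div_eq_div_iff (by positivity) (by positivity)]
  ring

theorem pullback_mul (w : ℝ) (s : ℤ) (Λ M : SL2C) (f : ℂ → ℂ) {z : ℂ}
    (h : M 1 0 * z + M 1 1 ≠ 0) :
    pullback w s M (pullback w s Λ f) z = pullback w s (Λ * M) f z := by
  rw [pullback, pullback, pullback, mobius_mul Λ M h, ← confFactor_mul Λ M h,
    ← spinPhase_mul Λ M h, mul_zpow,
    Real.mul_rpow (confFactor_pos _ _).le (confFactor_pos _ _).le]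
  push_cast; ring

theorem pullback_one (w : ℝ) (s : ℤ) (f : ℂ → ℂ) : pullback w s 1 f = f := by
  funext z
  have : (1 + ‖z‖ ^ 2) ≠ 0 := by positivity
  simp [pullback, confFactor, spinPhase, mobius, add_comm (‖z‖ ^ 2), div_self this]

theorem measurable_mobius (Λ : SL2C) : Measurable (mobius Λ) := by
  unfold mobius; fun_prop

theorem measurable_confFactor (Λ : SL2C) : Measurable (confFactor Λ) := by
  unfold confFactor; fun_prop

theorem measurable_spinPhase (Λ : SL2C) : Measurable (spinPhase Λ) := by
  unfold spinPhase
  exact (Complex.continuous_conj.measurable.comp (by fun_prop)).div (by fun_prop)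

theorem hasDerivAt_mobius (Λ : SL2C) {z : ℂ} (h : Λ 1 0 * z + Λ 1 1 ≠ 0) :
    HasDerivAt (mobius Λ) (1 / (Λ 1 0 * z + Λ 1 1) ^ 2) z := by
  have h1 : HasDerivAt (fun z => Λ 0 0 * z + Λ 0 1) (Λ 0 0) z := by
    simpa using ((hasDerivAt_id z).const_mul (Λ 0 0)).add_const (Λ 0 1)
  have h2 : HasDerivAt (fun z => Λ 1 0 * z + Λ 1 1) (Λ 1 0) z := by
    simpa using ((hasDerivAt_id z).const_mul (Λ 1 0)).add_const (Λ 1 1)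
  have h3 := h1.fun_div h2 h
  have e : Λ 0 0 * (Λ 1 0 * z + Λ 1 1) - (Λ 0 0 * z + Λ 0 1) * Λ 1 0 = 1 := by
    linear_combination det_eq Λ
  rwa [e] at h3

theorem lintegral_mobius_le (Λ : SL2C) (g : ℂ → ℝ≥0∞) (hg : Measurable g) :
    ∫⁻ z, ENNReal.ofReal (confFactor Λ z ^ 2) * g (mobius Λ z) ∂sphereMeasure ≤
      ∫⁻ z, g z ∂sphereMeasure := by
  set S : Set ℂ := {z | Λ 1 0 * z + Λ 1 1 ≠ 0} with hS
  have hSm : MeasurableSet S := by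
    have : Measurable fun z : ℂ => Λ 1 0 * z + Λ 1 1 := by fun_prop
    exact this (measurableSet_singleton 0).compl
  have hSae : (S : Set ℂ) =ᵐ[volume] Set.univ := by
    filter_upwards [ae_denom_ne Λ] with z hz
    simp only [eq_iff_iff]
    exact ⟨fun _ => trivial, fun _ => hz⟩
  have hinj : Set.InjOn (mobius Λ) S := by
    intro x hx y hy hxy
    have e := congrArg (mobius Λ⁻¹) hxy
    rw [mobius_mul _ _ hx, mobius_mul _ _ hy] at e
    simpa [mobius] using e
  have hder : ∀ z ∈ S, HasFDerivWithinAt (mobius Λ)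
      ((ContinuousLinearMap.toSpanSingleton ℂ (1 / (Λ 1 0 * z + Λ 1 1) ^ 2)).restrictScalars ℝ) S z :=
    fun z hz => ((hasDerivAt_mobius Λ hz).hasFDerivAt.restrictScalars ℝ).hasFDerivWithinAt
  have key := lintegral_image_eq_lintegral_abs_det_fderiv_mul volume hSm hder hinj
    (fun z => ENNReal.ofReal (4 / (1 + ‖z‖ ^ 2) ^ 2) * g z)
  have hdet : ∀ a : ℂ, ((ContinuousLinearMap.toSpanSingleton ℂ a).restrictScalars ℝ).det
      = ‖a‖ ^ 2 := by
    intro a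
    simp [ContinuousLinearMap.det, LinearMap.det_restrictScalars, Complex.sq_norm,
      Algebra.norm_complex_apply]
  unfold sphereMeasure
  have hdm : Measurable fun z : ℂ => ENNReal.ofReal (4 / (1 + ‖z‖ ^ 2) ^ 2) := by fun_prop
  have hm1 : Measurable fun z : ℂ => ENNReal.ofReal (confFactor Λ z ^ 2) * g (mobius Λ z) :=
    ((measurable_confFactor Λ).pow_const 2).ennreal_ofReal.mul (hg.comp (measurable_mobius Λ))
  rw [lintegral_withDensity_eq_lintegral_mul _ hdm hm1,
    lintegral_withDensity_eq_lintegral_mul _ hdm hg]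
  calc _ = ∫⁻ z in S, ENNReal.ofReal (4 / (1 + ‖z‖ ^ 2) ^ 2) *
            (ENNReal.ofReal (confFactor Λ z ^ 2) * g (mobius Λ z)) := by
          rw [setLIntegral_congr hSae, setLIntegral_univ]; rfl
    _ = ∫⁻ z in mobius Λ '' S, ENNReal.ofReal (4 / (1 + ‖z‖ ^ 2) ^ 2) * g z := by
          rw [key]
          refine setLIntegral_congr_fun hSm fun z hz => ?_
          have hn : ‖Λ 1 0 * z + Λ 1 1‖ ≠ 0 := norm_ne_zero_iff.2 hz
          have hp := denom_pos Λ z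
          simp only [hdet]
          rw [← mul_assoc, ← mul_assoc, ← ENNReal.ofReal_mul (by positivity),
            ← ENNReal.ofReal_mul (by positivity)]
          congr 2
          rw [norm_sq_mobius Λ hz, abs_of_nonneg (by positivity), norm_div, norm_pow, confFactor]
          simp only [norm_one]
          generalize ‖Λ 1 0 * z + Λ 1 1‖ = n at *
          field_simp
    _ ≤ _ := setLIntegral_le_lintegral _ _

theorem quasiMeasurePreserving_mobius (Λ : SL2C) :
    Measure.QuasiMeasurePreserving (mobius Λ) sphereMeasure sphereMeasure := by
  refine ⟨measurable_mobius Λ, Measure.AbsolutelyContinuous.mk fun N hN h0 => ?_⟩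
  rw [Measure.map_apply (measurable_mobius Λ) hN]
  have h := lintegral_mobius_le Λ (N.indicator 1) (measurable_one.indicator hN)
  rw [lintegral_indicator_one hN, h0, nonpos_iff_eq_zero] at h
  replace h := (lintegral_eq_zero_iff (((measurable_confFactor Λ).pow_const 2).ennreal_ofReal.mul
      ((measurable_one.indicator hN).comp (measurable_mobius Λ)))).1 h
  rw [measure_eq_zero_iff_ae_notMem]
  filter_upwards [h] with z hz hzN
  simp only [Pi.mul_apply, Function.comp_apply] at hz
  have hc := confFactor_pos Λ z
  have hzN' : mobius Λ z ∈ N := hzN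
  have hp : 0 < confFactor Λ z ^ 2 := by positivity
  simp only [Pi.zero_apply, mul_eq_zero, ENNReal.ofReal_eq_zero, Set.indicator_of_mem hzN',
    Pi.one_apply, one_ne_zero, or_false] at hz
  exact absurd hz (not_le.2 hp)

theorem exists_denom_le (Λ : SL2C) : ∃ C : ℝ, 0 < C ∧ ∀ x y : ℂ,
    ‖Λ 0 0 * x + Λ 0 1 * y‖ ^ 2 + ‖Λ 1 0 * x + Λ 1 1 * y‖ ^ 2 ≤ C * (‖x‖ ^ 2 + ‖y‖ ^ 2) := by
  have key : ∀ a b x y : ℂ, ‖a * x + b * y‖ ^ 2 ≤ 2 * (‖a‖ ^ 2 + ‖b‖ ^ 2) * (‖x‖ ^ 2 + ‖y‖ ^ 2) := by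
    intro a b x y
    have h1 : ‖a * x + b * y‖ ≤ ‖a‖ * ‖x‖ + ‖b‖ * ‖y‖ := by
      simpa only [norm_mul] using norm_add_le (a * x) (b * y)
    have h2 : ‖a * x + b * y‖ ^ 2 ≤ (‖a‖ * ‖x‖ + ‖b‖ * ‖y‖) ^ 2 := by gcongr
    nlinarith [sq_nonneg (‖a‖ * ‖y‖ - ‖b‖ * ‖x‖), sq_nonneg (‖a‖ * ‖x‖), sq_nonneg (‖b‖ * ‖y‖),
      sq_nonneg (‖a‖ * ‖y‖), sq_nonneg (‖b‖ * ‖x‖)]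
  refine ⟨2 * (‖Λ 0 0‖ ^ 2 + ‖Λ 0 1‖ ^ 2) + 2 * (‖Λ 1 0‖ ^ 2 + ‖Λ 1 1‖ ^ 2) + 1, by positivity, ?_⟩
  intro x y
  have := key (Λ 0 0) (Λ 0 1) x y
  have := key (Λ 1 0) (Λ 1 1) x y
  nlinarith [sq_nonneg ‖x‖, sq_nonneg ‖y‖]

theorem exists_confFactor_mem_Icc (Λ : SL2C) :
    ∃ m M : ℝ, 0 < m ∧ ∀ z, confFactor Λ z ∈ Set.Icc m M := by
  obtain ⟨C, hC, h⟩ := exists_denom_le Λ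
  obtain ⟨D, hD, h'⟩ := exists_denom_le Λ⁻¹
  refine ⟨1 / C, D, by positivity, fun z => ⟨?_, ?_⟩⟩
  · rw [confFactor, div_le_div_iff₀ hC (denom_pos Λ z)]
    have := h z 1
    simp only [mul_one, norm_one, one_pow] at this
    linarith
  · rw [confFactor, div_le_iff₀ (denom_pos Λ z)]
    have := h' (Λ 0 0 * z + Λ 0 1) (Λ 1 0 * z + Λ 1 1)
    have e := det_eq Λ
    have e1 : (Λ⁻¹) 0 0 * (Λ 0 0 * z + Λ 0 1) + (Λ⁻¹) 0 1 * (Λ 1 0 * z + Λ 1 1) = z := by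
      rw [Matrix.SpecialLinearGroup.SL2_inv_expl]
      simp
      linear_combination z * e
    have e2 : (Λ⁻¹) 1 0 * (Λ 0 0 * z + Λ 0 1) + (Λ⁻¹) 1 1 * (Λ 1 0 * z + Λ 1 1) = 1 := by
      rw [Matrix.SpecialLinearGroup.SL2_inv_expl]
      simp
      linear_combination e
    rw [e1, e2, norm_one] at this
    linarith

theorem norm_spinPhase (Λ : SL2C) {z : ℂ} (h : Λ 1 0 * z + Λ 1 1 ≠ 0) : ‖spinPhase Λ z‖ = 1 := by
  have hn : ‖Λ 1 0 * z + Λ 1 1‖ ≠ 0 := by simpa using h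
  rw [spinPhase, norm_div, RCLike.norm_conj, div_self hn]

theorem pullback_congr (w : ℝ) (s : ℤ) (Λ : SL2C) {f g : ℂ → ℂ} (h : f =ᵐ[sphereMeasure] g) :
    pullback w s Λ f =ᵐ[sphereMeasure] pullback w s Λ g := by
  filter_upwards [(quasiMeasurePreserving_mobius Λ).ae h] with z hz
  rw [pullback, pullback, hz]

theorem memLp_pullback (w : ℝ) (s : ℤ) (Λ : SL2C) {f : ℂ → ℂ} (hf : MemLp f 2 sphereMeasure) :
    MemLp (pullback w s Λ f) 2 sphereMeasure := by
  obtain ⟨f', hf'm, hff'⟩ := hf.1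
  have hf' : MemLp f' 2 sphereMeasure := (memLp_congr_ae hff').1 hf
  refine (memLp_congr_ae (pullback_congr w s Λ hff')).2 ?_
  have hm' : Measurable f' := hf'm.measurable
  have hmeas : Measurable (pullback w s Λ f') := by
    refine Measurable.mul (Measurable.mul ?_ ?_) (hm'.comp (measurable_mobius Λ))
    · exact Complex.measurable_ofReal.comp ((measurable_confFactor Λ).pow_const _)
    · exact (measurable_spinPhase Λ).pow_const (-s)
  refine ⟨hmeas.aestronglyMeasurable, ?_⟩
  obtain ⟨m, M, hm, hI⟩ := exists_confFactor_mem_Icc Λ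
  obtain ⟨C, hC⟩ := (isCompact_Icc (a := m) (b := M)).exists_bound_of_continuousOn
    (f := fun x : ℝ => x ^ (-w - 1))
    (fun x hx => (Real.continuousAt_rpow_const x _
      (Or.inl (hm.trans_le hx.1).ne')).continuousWithinAt)
  rw [eLpNorm_lt_top_iff_lintegral_rpow_enorm_lt_top (by norm_num) (by norm_num)]
  have h2 := (eLpNorm_lt_top_iff_lintegral_rpow_enorm_lt_top (by norm_num) (by norm_num)).1 hf'.2
  simp only [ENNReal.toReal_ofNat, ENNReal.rpow_ofNat] at h2 ⊢
  have hle : ∫⁻ z, ‖pullback w s Λ f' z‖ₑ ^ 2 ∂sphereMeasure ≤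
      ∫⁻ z, ENNReal.ofReal (C ^ 2) * (ENNReal.ofReal (confFactor Λ z ^ 2) * ‖f' (mobius Λ z)‖ₑ ^ 2)
        ∂sphereMeasure := by
    refine lintegral_mono_ae ?_
    filter_upwards [ae_sphere (ae_denom_ne Λ)] with z hz
    have hp := confFactor_pos Λ z
    have hCz := hC _ (hI z)
    rw [Real.norm_of_nonneg (by positivity)] at hCz
    have hC0 : 0 ≤ C := le_trans (by positivity) hCz
    have hnorm : ‖pullback w s Λ f' z‖ ≤ C * confFactor Λ z * ‖f' (mobius Λ z)‖ := by
      rw [pullback, norm_mul, norm_mul, norm_zpow, norm_spinPhase Λ hz, one_zpow, mul_one,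
        Complex.norm_of_nonneg (by positivity)]
      have : confFactor Λ z ^ (-w) = confFactor Λ z ^ (-w - 1) * confFactor Λ z := by
        rw [← Real.rpow_add_one hp.ne']; congr 1; ring
      rw [this]; gcongr
    rw [← ofReal_norm, ← ofReal_norm, ← ENNReal.ofReal_pow (norm_nonneg _),
      ← ENNReal.ofReal_pow (norm_nonneg _), ← ENNReal.ofReal_mul (by positivity),
      ← ENNReal.ofReal_mul (by positivity)]
    refine ENNReal.ofReal_le_ofReal ?_
    calc _ ≤ (C * confFactor Λ z * ‖f' (mobius Λ z)‖) ^ 2 := by gcongr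
      _ = _ := by ring
  refine hle.trans_lt ?_
  rw [lintegral_const_mul' _ _ ENNReal.ofReal_ne_top]
  refine ENNReal.mul_lt_top ENNReal.ofReal_lt_top (lt_of_le_of_lt ?_ h2)
  exact lintegral_mobius_le Λ (fun z => ‖f' z‖ₑ ^ 2) (by fun_prop)

/-- The space of square-integrable functions on the sphere of conformal-spin weight `(w, s)`.
As a topological space it is `L²(S²)`; the weights enter through the action of `SL(2,ℂ)`. -/
def WFun (_w : ℝ) (_s : ℤ) : Type := Lp ℂ 2 sphereMeasure

instance (w : ℝ) (s : ℤ) : NormedAddCommGroup (WFun w s) :=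
  inferInstanceAs (NormedAddCommGroup (Lp ℂ 2 sphereMeasure))

instance (w : ℝ) (s : ℤ) : MeasurableSpace (WFun w s) := borel _

instance (w : ℝ) (s : ℤ) : BorelSpace (WFun w s) := ⟨rfl⟩

/-- A representative of the class `φ` as a function of `z`. -/
def WFun.fn {w : ℝ} {s : ℤ} (φ : WFun w s) : ℂ → ℂ :=
  ((show Lp ℂ 2 sphereMeasure from φ : Lp ℂ 2 sphereMeasure) : ℂ → ℂ)

/-- The transformation law `pullback` on classes of functions. -/
def WFun.trans {w : ℝ} {s : ℤ} (Λ : SL2C) (φ : WFun w s) : WFun w s :=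
  (memLp_pullback w s Λ (Lp.memLp (show Lp ℂ 2 sphereMeasure from φ))).toLp

theorem WFun.fn_trans {w : ℝ} {s : ℤ} (Λ : SL2C) (φ : WFun w s) :
    (WFun.trans Λ φ).fn =ᵐ[sphereMeasure] pullback w s Λ φ.fn :=
  MemLp.coeFn_toLp _

theorem WFun.ext_ae {w : ℝ} {s : ℤ} {φ ψ : WFun w s} (h : φ.fn =ᵐ[sphereMeasure] ψ.fn) : φ = ψ :=
  Lp.ext h

/-- The left action of `SL(2,ℂ)` on functions of weight `(w, s)`. Pulling back along `Λ` reverses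
the order of products, so the left action by `Λ` is the pullback along `Λ⁻¹`. Orbits, stabilizers
and invariant measures are the same for the two. -/
instance (w : ℝ) (s : ℤ) : MulAction SL2C (WFun w s) where
  smul Λ φ := WFun.trans Λ⁻¹ φ
  one_smul φ := by
    refine WFun.ext_ae ((WFun.fn_trans _ φ).trans ?_)
    rw [inv_one, pullback_one]
  mul_smul Λ M φ := by
    refine WFun.ext_ae ((WFun.fn_trans _ φ).trans ?_)
    refine Filter.EventuallyEq.trans ?_ (WFun.fn_trans Λ⁻¹ (WFun.trans M⁻¹ φ)).symm
    refine Filter.EventuallyEq.trans ?_ (pullback_congr w s Λ⁻¹ (WFun.fn_trans M⁻¹ φ)).symm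
    filter_upwards [ae_sphere (ae_denom_ne Λ⁻¹)] with z hz
    rw [pullback_mul w s M⁻¹ Λ⁻¹ _ hz, mul_inv_rev]

/-- The little group of `φ`: all `Λ` that leave `φ` invariant. -/
abbrev littleGroup {w : ℝ} {s : ℤ} (φ : WFun w s) : Subgroup SL2C := MulAction.stabilizer SL2C φ

/-- The identity component of the little group, as a subgroup of `SL(2,ℂ)`. -/
def littleGroupIdComponent {w : ℝ} {s : ℤ} (φ : WFun w s) : Subgroup SL2C :=
  (Subgroup.connectedComponentOfOne (littleGroup φ)).map (littleGroup φ).subtype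

/-- The orbit of `φ`, with the topology (and the Borel sets) that it inherits from `L²(S²)`. -/
abbrev Orbit {w : ℝ} {s : ℤ} (φ : WFun w s) : Type := MulAction.orbit SL2C φ

/-- The point `Λ φ` of the orbit of `φ`. -/
def orbitPoint {w : ℝ} {s : ℤ} (φ : WFun w s) (Λ : SL2C) : Orbit φ :=
  ⟨Λ • φ, MulAction.mem_orbit φ Λ⟩

/-- Conjugacy of subgroups of `SL(2,ℂ)`. -/
def IsConjSubgroup (H K : Subgroup SL2C) : Prop :=
  ∃ Λ : SL2C, H = K.map (MulAut.conj Λ).toMonoidHom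

/-- `φ` is (almost everywhere) constant. -/
def IsConst {w : ℝ} {s : ℤ} (φ : WFun w s) : Prop :=
  ∃ c : ℂ, φ.fn =ᵐ[sphereMeasure] fun _ => c

/-- `φ(z) = e^{i s arg z} φ₀(|z|)` almost everywhere, for some function `φ₀`. -/
def IsAxisymmetric {w : ℝ} {s : ℤ} (φ : WFun w s) : Prop :=
  ∃ φ₀ : ℝ → ℂ, φ.fn =ᵐ[sphereMeasure]
    fun z => Complex.exp (Complex.I * s * Complex.arg z) * φ₀ ‖z‖

/-- Some Lorentz transform of `φ` is constant, and the spin weight is zero. -/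
def IsConstUpToLorentz {w : ℝ} {s : ℤ} (φ : WFun w s) : Prop :=
  s = 0 ∧ ∃ Λ : SL2C, IsConst (Λ • φ)

/-- Some Lorentz transform of `φ` has the form `e^{i s arg z} φ₀(|z|)`. -/
def IsAxisymmetricUpToLorentz {w : ℝ} {s : ℤ} (φ : WFun w s) : Prop :=
  ∃ Λ : SL2C, IsAxisymmetric (Λ • φ)

/-- Rotation about the third axis, `e^{-i φ σ₃ / 2}`. -/
def rotZ (φ : ℝ) : SL2C :=
  ⟨!![Complex.exp (-(Complex.I * φ / 2)), 0; 0, Complex.exp (Complex.I * φ / 2)], by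
    rw [Matrix.det_fin_two_of, ← Complex.exp_add]; simp⟩

/-- Rotation about the second axis, `e^{-i θ σ₂ / 2}`. -/
def rotY (θ : ℝ) : SL2C :=
  ⟨!![(Real.cos (θ / 2) : ℂ), -(Real.sin (θ / 2) : ℂ);
      (Real.sin (θ / 2) : ℂ), (Real.cos (θ / 2) : ℂ)], by
    rw [Matrix.det_fin_two_of]
    have := Real.cos_sq_add_sin_sq (θ / 2)
    have h : ((Real.cos (θ / 2) ^ 2 + Real.sin (θ / 2) ^ 2 : ℝ) : ℂ) = 1 := by rw [this]; simp
    push_cast at h ⊢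
    linear_combination h⟩

/-- Boost along the third axis, `e^{-t σ₃ / 2}`. -/
def boostZ (t : ℝ) : SL2C :=
  ⟨!![(Real.exp (-(t / 2)) : ℂ), 0; 0, (Real.exp (t / 2) : ℂ)], by
    rw [Matrix.det_fin_two_of, ← Complex.ofReal_mul, ← Real.exp_add]; simp⟩

/-- Null rotation `e^{-i u (L₀₁ + L₃₁)} e^{-i v (L₀₂ - L₂₃)}`, with `L₀ⱼ = i σⱼ / 2`,
`L₂₃ = σ₁ / 2` and `L₃₁ = σ₂ / 2`. -/
def nullRot (u v : ℝ) : SL2C :=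
  ⟨!![1, 0; (u + v * Complex.I : ℂ), 1], by rw [Matrix.det_fin_two_of]; simp⟩

/-- The subgroup `{1, -1}`. -/
def Z2 : Subgroup SL2C where
  carrier := {1, -1}
  one_mem' := Or.inl rfl
  mul_mem' := by
    rintro a b (rfl | rfl) (rfl | rfl) <;> simp
  inv_mem' := by
    rintro a (rfl | rfl)
    · simp
    · right
      exact inv_eq_of_mul_eq_one_left (by simp)

/-- The group `Γ` of all `diag(e^{iψ/2}, e^{-iψ/2})`, the double cover of the rotations about one
axis. -/
def Gam : Subgroup SL2C where
  carrier := Set.range rotZ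
  one_mem' := ⟨0, by ext i j; fin_cases i <;> fin_cases j <;> simp [rotZ]⟩
  mul_mem' := by
    rintro _ _ ⟨x, rfl⟩ ⟨y, rfl⟩
    refine ⟨x + y, ?_⟩
    ext i j
    rw [mul_apply']
    fin_cases i <;> fin_cases j <;> simp [rotZ, ← Complex.exp_add] <;> ring_nf
  inv_mem' := by
    rintro _ ⟨x, rfl⟩
    refine ⟨-x, ?_⟩
    rw [Matrix.SpecialLinearGroup.SL2_inv_expl]
    ext i j
    fin_cases i <;> fin_cases j <;> simp [rotZ, neg_div]

/-- The group `SU(2)` as a subgroup of `SL(2,ℂ)`. -/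
def SU2 : Subgroup SL2C where
  carrier := {Λ | (Λ : Matrix (Fin 2) (Fin 2) ℂ) ∈ Matrix.unitaryGroup (Fin 2) ℂ}
  one_mem' := by simp [one_mem]
  mul_mem' := by
    intro a b ha hb
    have h := (Matrix.unitaryGroup (Fin 2) ℂ).mul_mem ha hb
    change ((a * b : SL2C) : Matrix (Fin 2) (Fin 2) ℂ) ∈ Matrix.unitaryGroup (Fin 2) ℂ
    rwa [Matrix.SpecialLinearGroup.coe_mul]
  inv_mem' := by
    intro a ha
    have h1 : (a : Matrix (Fin 2) (Fin 2) ℂ) * star (a : Matrix (Fin 2) (Fin 2) ℂ) = 1 :=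
      (Matrix.mem_unitaryGroup_iff).1 ha
    have h2 : ((a⁻¹ : SL2C) : Matrix (Fin 2) (Fin 2) ℂ) * (a : Matrix (Fin 2) (Fin 2) ℂ) = 1 := by
      rw [← Matrix.SpecialLinearGroup.coe_mul, inv_mul_cancel, Matrix.SpecialLinearGroup.coe_one]
    have h3 : ((a⁻¹ : SL2C) : Matrix (Fin 2) (Fin 2) ℂ) = star (a : Matrix (Fin 2) (Fin 2) ℂ) :=
      left_inv_eq_right_inv h2 h1
    change ((a⁻¹ : SL2C) : Matrix (Fin 2) (Fin 2) ℂ) ∈ Matrix.unitaryGroup (Fin 2) ℂ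
    rw [h3]
    exact Unitary.star_mem ha

/-- A Lorentz-invariant measure: non-zero, finite on compact sets, and invariant under the action
of `SL(2,ℂ)`. -/
structure IsLorentzInvariantMeasure {X : Type*} [TopologicalSpace X] [MeasurableSpace X]
    [SMul SL2C X] (μ : Measure X) : Prop where
  ne_zero : μ ≠ 0
  finite_on_compacts : ∀ K : Set X, IsCompact K → μ K < ∞
  invariant : SMulInvariantMeasure SL2C X μ

/-- The Euclidean space `ℝ³`. -/
abbrev R3 : Type := EuclideanSpace ℝ (Fin 3)

/-- The unit sphere `S²` in `ℝ³`. -/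
abbrev S2 : Type := Metric.sphere (0 : EuclideanSpace ℝ (Fin 3)) 1

/-- The unit sphere `S³` in `ℝ⁴`. -/
abbrev S3 : Type := Metric.sphere (0 : EuclideanSpace ℝ (Fin 4)) 1

/-- Identification of antipodal points of `S³`. -/
def antipodal : Setoid S3 where
  r x y := x = y ∨ x = -y
  iseqv := by
    refine ⟨fun _ => Or.inl rfl, ?_, ?_⟩
    · rintro x y (rfl | rfl)
      · exact Or.inl rfl
      · exact Or.inr (neg_neg y).symm
    · rintro x y z (rfl | rfl) (rfl | rfl)
      · exact Or.inl rfl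
      · exact Or.inr rfl
      · exact Or.inr rfl
      · exact Or.inl (neg_neg z)

/-- The real projective space `ℝP³`: the sphere `S³` with antipodal points identified. -/
abbrev RP3 : Type := Quotient antipodal

/-- The hermitian matrix of the future-directed unit timelike vector `(k₀, k)`,
`k₀ = √(1 + |k|²)`. -/
def hyperboloidMatrix (k : R3) : Matrix (Fin 2) (Fin 2) ℂ :=
  !![(Real.sqrt (1 + ‖k‖ ^ 2) : ℂ) + k 2, k 0 + Complex.I * k 1;
     k 0 - Complex.I * k 1, (Real.sqrt (1 + ‖k‖ ^ 2) : ℂ) - k 2]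

/-- The measure `d³k / √(1 + |k|²)`. -/
def hyperboloidMeasure : Measure R3 :=
  volume.withDensity fun k => ENNReal.ofReal (1 / Real.sqrt (1 + ‖k‖ ^ 2))

/-- The Lorentz transformation with coordinates `(t, ũ, ṽ, φ, θ)` on `SL(2,ℂ) / Γ`. -/
def gamCoord : ℝ × ℝ × ℝ × ℝ × ℝ → SL2C
  | (t, u, v, φ, θ) => rotZ φ * rotY θ * nullRot u v * boostZ t

/-- The range of the coordinates `(t, ũ, ṽ, φ, θ)`: `0 ≤ φ < 2π`, `0 ≤ θ ≤ π`. -/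
def gamRange : Set (ℝ × ℝ × ℝ × ℝ × ℝ) :=
  {y | y.2.2.2.1 ∈ Set.Ico 0 (2 * Real.pi) ∧ y.2.2.2.2 ∈ Set.Icc 0 Real.pi}

/-- The part of the range off the poles `θ = 0, π`. -/
def gamRegularRange : Set (ℝ × ℝ × ℝ × ℝ × ℝ) :=
  {y | y.2.2.2.1 ∈ Set.Ico 0 (2 * Real.pi) ∧ y.2.2.2.2 ∈ Set.Ioo 0 Real.pi}

/-- The measure `dt dũ dṽ dφ d(cos θ)`, where `d(cos θ)` stands for `sin θ dθ`. -/
def gamCoordMeasure : Measure (ℝ × ℝ × ℝ × ℝ × ℝ) :=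
  (volume.restrict gamRange).withDensity fun y => ENNReal.ofReal (Real.sin y.2.2.2.2)

/-- The Lorentz transformation with coordinates `(t, u, v, φ, ψ, θ)`. -/
def lorentzCoord : ℝ × ℝ × ℝ × ℝ × ℝ × ℝ → SL2C
  | (t, u, v, φ, ψ, θ) => rotZ φ * rotY θ * rotZ ψ * boostZ t * nullRot u v

/-- The range of the coordinates on `SL(2,ℂ) / {±1}`: `0 ≤ φ, ψ < 2π`, `0 ≤ θ ≤ π`. -/
def lorentzRange : Set (ℝ × ℝ × ℝ × ℝ × ℝ × ℝ) :=
  {x | x.2.2.2.1 ∈ Set.Ico 0 (2 * Real.pi) ∧ x.2.2.2.2.1 ∈ Set.Ico 0 (2 * Real.pi) ∧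
    x.2.2.2.2.2 ∈ Set.Icc 0 Real.pi}

/-- The part of the range with `0 < θ < π`. -/
def lorentzRegularRange : Set (ℝ × ℝ × ℝ × ℝ × ℝ × ℝ) :=
  {x | x.2.2.2.1 ∈ Set.Ico 0 (2 * Real.pi) ∧ x.2.2.2.2.1 ∈ Set.Ico 0 (2 * Real.pi) ∧
    x.2.2.2.2.2 ∈ Set.Ioo 0 Real.pi}

/-- The measure `e^{2t} dt du dv dφ dψ d(cos θ)`, where `d(cos θ)` stands for `sin θ dθ`. -/
def lorentzCoordMeasure : Measure (ℝ × ℝ × ℝ × ℝ × ℝ × ℝ) :=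
  (volume.restrict lorentzRange).withDensity
    fun x => ENNReal.ofReal (Real.exp (2 * x.1) * Real.sin x.2.2.2.2.2)

end

end WeightedSphere

open WeightedSphere

open Filter Topology

namespace WeightedSphere

/-! ### The topology of `SL(2,ℂ)` -/

/-! The theorem rests on properness of the action: if `φ ≠ 0` and `Λₙ φ` converges in `L²`, then a
subsequence of `Λₙ` converges (`exists_subseq_tendsto`). Suppose that the Frobenius norm of `Λₙ`
tends to infinity. After normalization the matrices have a nonzero limit point, so along a
subsequence the conformal factor of `Λₙ` tends to zero almost everywhere. The transformation then
squeezes the part of `φ` where this factor is at most one, which is nearly all of it, into a set of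
small area. Its `L²` mass there does not decrease, because the squared modulus picks up the area
Jacobian and an excess `ϖ^(-2w-2)`, which is at least one for `w ≤ -1` and `ϖ ≥ 1`. A fixed `L²`
limit has little mass on small sets, so `φ = 0`.

For `φ ≠ 0` the orbit map is therefore closed with compact preimages of compact sets. It follows
that the orbit is the topological quotient by the little group and that the little group is compact.
A compact subgroup of `SL(2,ℂ)` preserves an averaged hermitian form, so it is conjugate into
`SU(2)`. A closed connected subgroup of `SU(2)` is trivial, conjugate to `Γ`, or everything:
connectedness supplies an element of irrational angle, whose powers are dense in a circle, and
anything larger than the circle yields all Euler angles. This gives `idComponent_trichotomy`. It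
becomes a classification of functions once the functions fixed by `Γ` and by `SU(2)` are found, with
Fubini used to exchange "for every group element, almost everywhere" for a pointwise statement.

For occurrence, constants have little group `SU(2)`, and a phase times the indicator of a disc has
little group `Γ`. Genericity is a Baire argument. The complement of `{±1}` is covered by countably
many compact sets `K`, each moving some disc off itself. The functions fixed by an element of `K`
form a closed set without interior, because a perturbation inside the disc would be determined by
the compactly varying group element.

The models of the orbits come from a homeomorphism of `SL(2,ℂ)` with `ℝ³ × SU(2)`, after which only
quotients of `SU(2)` remain: a point, the sphere by the Hopf map, and projective space.

The measures are Lebesgue measures in disguise. On the hyperboloid `d³k / k₀` is `dq dτ` in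
horospherical coordinates, and its invariance is checked on the factors of the Bruhat decomposition.
On the group, a matrix is given by its second column `v` in `ℂ²` and a complex number `ζ`. Left
multiplication acts unimodularly on `v` and translates `ζ`, so `dv dζ` is invariant, and polar
coordinates in `ℂ²` turn it into the stated density. For `Γ` the angle `ψ` is integrated out. -/

theorem continuous_entry (i j : Fin 2) : Continuous fun Λ : SL2C => Λ i j := by
  fun_prop

theorem continuous_sl_iff {X : Type*} [TopologicalSpace X] {f : X → SL2C} :
    Continuous f ↔ ∀ i j, Continuous fun x => f x i j := by
  refine Iff.trans (Matrix.SpecialLinearGroup.isClosedEmbedding_val (n := Fin 2)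
    (R := ℂ)).isEmbedding.isInducing.continuous_iff ?_
  exact ⟨fun h i j => h.matrix_elem i j, fun h => continuous_matrix h⟩

theorem tendsto_sl_iff {X : Type*} {l : Filter X} {f : X → SL2C} {Λ : SL2C} :
    Tendsto f l (𝓝 Λ) ↔ ∀ i j, Tendsto (fun x => f x i j) l (𝓝 (Λ i j)) := by
  refine Iff.trans (Matrix.SpecialLinearGroup.isClosedEmbedding_val (n := Fin 2)
    (R := ℂ)).isEmbedding.isInducing.tendsto_nhds_iff ?_
  refine ⟨fun h i j => ?_, fun h => ?_⟩
  · exact ((continuous_id.matrix_elem i j).tendsto _).comp h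
  · exact tendsto_pi_nhds.2 fun i => tendsto_pi_nhds.2 fun j => h i j

theorem sl_ext {Λ M : SL2C} (h00 : Λ 0 0 = M 0 0) (h01 : Λ 0 1 = M 0 1) (h10 : Λ 1 0 = M 1 0)
    (h11 : Λ 1 1 = M 1 1) : Λ = M := by
  ext i j
  fin_cases i <;> fin_cases j <;> assumption

instance : TopologicalSpace.MetrizableSpace (Matrix (Fin 2) (Fin 2) ℂ) :=
  inferInstanceAs (TopologicalSpace.MetrizableSpace (Fin 2 → Fin 2 → ℂ))

instance : SecondCountableTopology (Matrix (Fin 2) (Fin 2) ℂ) :=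
  inferInstanceAs (SecondCountableTopology (Fin 2 → Fin 2 → ℂ))

instance : LocallyCompactSpace (Matrix (Fin 2) (Fin 2) ℂ) :=
  inferInstanceAs (LocallyCompactSpace (Fin 2 → Fin 2 → ℂ))

instance : TopologicalSpace.MetrizableSpace SL2C :=
  Matrix.SpecialLinearGroup.isClosedEmbedding_val.isEmbedding.metrizableSpace

instance : SecondCountableTopology SL2C :=
  Matrix.SpecialLinearGroup.isClosedEmbedding_val.isEmbedding.secondCountableTopology

instance : LocallyCompactSpace SL2C :=
  Matrix.SpecialLinearGroup.isClosedEmbedding_val.locallyCompactSpace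

/-- The squared Frobenius norm. -/
noncomputable def frob (Λ : SL2C) : ℝ :=
  ‖Λ 0 0‖ ^ 2 + ‖Λ 0 1‖ ^ 2 + ‖Λ 1 0‖ ^ 2 + ‖Λ 1 1‖ ^ 2

theorem continuous_frob : Continuous frob := by
  unfold frob; fun_prop

theorem norm_sq_entry_le_frob (Λ : SL2C) (i j : Fin 2) : ‖Λ i j‖ ^ 2 ≤ frob Λ := by
  unfold frob
  revert i j
  simp only [Fin.forall_fin_two]
  refine ⟨⟨?_, ?_⟩, ?_, ?_⟩ <;>
    linarith [sq_nonneg ‖Λ 0 0‖, sq_nonneg ‖Λ 0 1‖, sq_nonneg ‖Λ 1 0‖, sq_nonneg ‖Λ 1 1‖]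

/-- The matrices of determinant one form a closed subset of `ℂ⁴`, so boundedness is enough. -/
theorem isCompact_frob_le (C : ℝ) : IsCompact {Λ : SL2C | frob Λ ≤ C} := by
  have h1 : IsCompact (Set.univ.pi fun _ : Fin 2 => Set.univ.pi fun _ : Fin 2 =>
      Metric.closedBall (0 : ℂ) √C) :=
    isCompact_univ_pi fun _ => isCompact_univ_pi fun _ => isCompact_closedBall _ _
  have h2 := Matrix.SpecialLinearGroup.isClosedEmbedding_val.isCompact_preimage h1
  refine h2.of_isClosed_subset (isClosed_le continuous_frob continuous_const) fun Λ hΛ => ?_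
  intro i _ j _
  rw [mem_closedBall_zero_iff]
  exact Real.le_sqrt_of_sq_le ((norm_sq_entry_le_frob Λ i j).trans hΛ)

theorem inv_apply_zero_zero (Λ : SL2C) : (Λ⁻¹) 0 0 = Λ 1 1 := by
  rw [Matrix.SpecialLinearGroup.SL2_inv_expl]; rfl

theorem inv_apply_zero_one (Λ : SL2C) : (Λ⁻¹) 0 1 = -Λ 0 1 := by
  rw [Matrix.SpecialLinearGroup.SL2_inv_expl]; rfl

theorem inv_apply_one_zero (Λ : SL2C) : (Λ⁻¹) 1 0 = -Λ 1 0 := by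
  rw [Matrix.SpecialLinearGroup.SL2_inv_expl]; rfl

theorem inv_apply_one_one (Λ : SL2C) : (Λ⁻¹) 1 1 = Λ 0 0 := by
  rw [Matrix.SpecialLinearGroup.SL2_inv_expl]; rfl

theorem frob_inv (Λ : SL2C) : frob Λ⁻¹ = frob Λ := by
  simp only [frob, inv_apply_zero_zero, inv_apply_zero_one, inv_apply_one_zero, inv_apply_one_one,
    norm_neg]
  ring

theorem norm_sq_mul_add_mul_le (a b x y : ℂ) :
    ‖a * x + b * y‖ ^ 2 ≤ (‖a‖ ^ 2 + ‖b‖ ^ 2) * (‖x‖ ^ 2 + ‖y‖ ^ 2) := by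
  have h1 : ‖a * x + b * y‖ ≤ ‖a‖ * ‖x‖ + ‖b‖ * ‖y‖ := by
    simpa only [norm_mul] using norm_add_le (a * x) (b * y)
  have h2 : ‖a * x + b * y‖ ^ 2 ≤ (‖a‖ * ‖x‖ + ‖b‖ * ‖y‖) ^ 2 := by gcongr
  nlinarith [sq_nonneg (‖a‖ * ‖y‖ - ‖b‖ * ‖x‖)]

theorem norm_sq_apply_le (Λ : SL2C) (x y : ℂ) :
    ‖Λ 0 0 * x + Λ 0 1 * y‖ ^ 2 + ‖Λ 1 0 * x + Λ 1 1 * y‖ ^ 2 ≤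
      frob Λ * (‖x‖ ^ 2 + ‖y‖ ^ 2) := by
  have h1 := norm_sq_mul_add_mul_le (Λ 0 0) (Λ 0 1) x y
  have h2 := norm_sq_mul_add_mul_le (Λ 1 0) (Λ 1 1) x y
  unfold frob
  nlinarith

/-- Apply the operator bound for `Λ⁻¹`, which has the same Frobenius norm, to the vector `Λ (z, 1)`.
Together with the lower bound this makes all estimates locally uniform in `Λ`. -/
theorem confFactor_le_frob (Λ : SL2C) (z : ℂ) : confFactor Λ z ≤ frob Λ := by
  rw [confFactor, div_le_iff₀ (denom_pos Λ z)]
  have h := norm_sq_apply_le Λ⁻¹ (Λ 0 0 * z + Λ 0 1) (Λ 1 0 * z + Λ 1 1)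
  have e := det_eq Λ
  rw [frob_inv, inv_apply_zero_zero, inv_apply_zero_one, inv_apply_one_zero,
    inv_apply_one_one] at h
  have e1 : Λ 1 1 * (Λ 0 0 * z + Λ 0 1) + -Λ 0 1 * (Λ 1 0 * z + Λ 1 1) = z := by
    linear_combination z * e
  have e2 : -Λ 1 0 * (Λ 0 0 * z + Λ 0 1) + Λ 0 0 * (Λ 1 0 * z + Λ 1 1) = 1 := by
    linear_combination e
  rw [e1, e2, norm_one] at h
  linarith

theorem frob_pos (Λ : SL2C) : 0 < frob Λ :=
  (confFactor_pos Λ 0).trans_le (confFactor_le_frob Λ 0)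

theorem inv_frob_le_confFactor (Λ : SL2C) (z : ℂ) : (frob Λ)⁻¹ ≤ confFactor Λ z := by
  rw [confFactor, inv_eq_one_div, div_le_div_iff₀ (frob_pos Λ) (denom_pos Λ z)]
  have := norm_sq_apply_le Λ z 1
  simp only [mul_one, norm_one, one_pow] at this
  linarith

theorem confFactor_rpow_le (Λ : SL2C) (z : ℂ) (r : ℝ) : confFactor Λ z ^ r ≤ frob Λ ^ |r| := by
  have hp := confFactor_pos Λ z
  rcases le_or_gt 0 r with h | h
  · rw [abs_of_nonneg h]
    exact Real.rpow_le_rpow hp.le (confFactor_le_frob Λ z) h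
  · rw [abs_of_neg h, Real.rpow_neg (frob_pos Λ).le, ← Real.inv_rpow (frob_pos Λ).le]
    exact Real.rpow_le_rpow_of_nonpos (inv_pos.2 (frob_pos Λ)) (inv_frob_le_confFactor Λ z) h.le

theorem confFactor_one (z : ℂ) : confFactor 1 z = 1 := by
  have : (1 + ‖z‖ ^ 2) ≠ 0 := by positivity
  simp [confFactor, add_comm (‖z‖ ^ 2), div_self this]

theorem confFactor_inv_mobius (Λ : SL2C) {z : ℂ} (h : Λ 1 0 * z + Λ 1 1 ≠ 0) :
    confFactor Λ⁻¹ (mobius Λ z) = (confFactor Λ z)⁻¹ := by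
  have := confFactor_mul Λ⁻¹ Λ h
  rw [inv_mul_cancel, confFactor_one] at this
  exact eq_inv_of_mul_eq_one_left this

theorem mobius_one (z : ℂ) : mobius 1 z = z := by simp [mobius]

theorem mobius_mobius_inv (Λ : SL2C) {z : ℂ} (h : (Λ⁻¹) 1 0 * z + (Λ⁻¹) 1 1 ≠ 0) :
    mobius Λ (mobius Λ⁻¹ z) = z := by
  rw [mobius_mul _ _ h, mul_inv_cancel, mobius_one]

/-! ### The area measure -/

theorem ae_of_ae_sphere {p : ℂ → Prop} (h : ∀ᵐ z ∂sphereMeasure, p z) : ∀ᵐ z, p z := by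
  refine (withDensity_absolutelyContinuous' (by fun_prop) (Eventually.of_forall fun z => ?_)).ae_le h
  have : 0 < 4 / (1 + ‖z‖ ^ 2) ^ 2 := by positivity
  simpa using this

theorem ae_sphere_iff {p : ℂ → Prop} : (∀ᵐ z ∂sphereMeasure, p z) ↔ ∀ᵐ z, p z :=
  ⟨ae_of_ae_sphere, ae_sphere⟩

instance : IsFiniteMeasure sphereMeasure := by
  refine isFiniteMeasure_withDensity_ofReal ?_
  have h := integrable_rpow_neg_one_add_norm_sq (E := ℂ) (μ := volume) (r := 4)
    (by rw [Complex.finrank_real_complex]; norm_num)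
  have h2 := h.const_mul 4
  refine (h2.congr (Eventually.of_forall fun z => ?_)).2
  have : (0 : ℝ) ≤ 1 + ‖z‖ ^ 2 := by positivity
  simp only
  rw [show (-4 : ℝ) / 2 = -(2 : ℕ) by norm_num, Real.rpow_neg this, Real.rpow_natCast]
  rfl

/-- The reverse inequality is the known one for `Λ⁻¹`, because the two Jacobians cancel. -/
theorem lintegral_mobius (Λ : SL2C) (g : ℂ → ℝ≥0∞) (hg : Measurable g) :
    ∫⁻ z, ENNReal.ofReal (confFactor Λ z ^ 2) * g (mobius Λ z) ∂sphereMeasure =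
      ∫⁻ z, g z ∂sphereMeasure := by
  refine le_antisymm (lintegral_mobius_le Λ g hg) ?_
  have h := lintegral_mobius_le Λ⁻¹
    (fun z => ENNReal.ofReal (confFactor Λ z ^ 2) * g (mobius Λ z))
    (((measurable_confFactor Λ).pow_const 2).ennreal_ofReal.mul (hg.comp (measurable_mobius Λ)))
  refine le_of_eq_of_le (lintegral_congr_ae ?_) h
  filter_upwards [ae_sphere (ae_denom_ne Λ⁻¹)] with z hz
  have hc := confFactor_inv_mobius Λ⁻¹ hz
  rw [inv_inv] at hc
  have hp := confFactor_pos Λ⁻¹ z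
  rw [mobius_mobius_inv Λ hz, hc, ← mul_assoc, ← ENNReal.ofReal_mul (by positivity), ← mul_pow,
    mul_inv_cancel₀ hp.ne']
  simp

end WeightedSphere

namespace WeightedSphere

/-! ### Continuity of the action -/

section Action

variable {w : ℝ} {s : ℤ}

theorem fn_smul (Λ : SL2C) (φ : WFun w s) :
    (Λ • φ).fn =ᵐ[sphereMeasure] pullback w s Λ⁻¹ φ.fn :=
  WFun.fn_trans Λ⁻¹ φ

theorem fn_sub (φ ψ : WFun w s) : (φ - ψ).fn =ᵐ[sphereMeasure] φ.fn - ψ.fn :=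
  Lp.coeFn_sub (show Lp ℂ 2 sphereMeasure from φ) (show Lp ℂ 2 sphereMeasure from ψ)

theorem fn_add (φ ψ : WFun w s) : (φ + ψ).fn =ᵐ[sphereMeasure] φ.fn + ψ.fn :=
  Lp.coeFn_add (show Lp ℂ 2 sphereMeasure from φ) (show Lp ℂ 2 sphereMeasure from ψ)

theorem fn_zero : (0 : WFun w s).fn =ᵐ[sphereMeasure] 0 :=
  Lp.coeFn_zero ℂ 2 sphereMeasure

theorem measurable_fn (φ : WFun w s) : Measurable φ.fn :=
  (Lp.stronglyMeasurable (show Lp ℂ 2 sphereMeasure from φ)).measurable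

theorem memLp_fn (φ : WFun w s) : MemLp φ.fn 2 sphereMeasure :=
  Lp.memLp (show Lp ℂ 2 sphereMeasure from φ)

/-- The class of a square-integrable function. -/
noncomputable def ofFun (w : ℝ) (s : ℤ) (f : ℂ → ℂ) (hf : MemLp f 2 sphereMeasure) : WFun w s :=
  hf.toLp f

theorem fn_ofFun {f : ℂ → ℂ} (hf : MemLp f 2 sphereMeasure) :
    (ofFun w s f hf).fn =ᵐ[sphereMeasure] f :=
  hf.coeFn_toLp

theorem eq_zero_iff_ae {φ : WFun w s} : φ = 0 ↔ φ.fn =ᵐ[sphereMeasure] 0 :=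
  ⟨fun h => h ▸ fn_zero, fun h => WFun.ext_ae (h.trans fn_zero.symm)⟩

theorem eq_iff_ae {φ ψ : WFun w s} : φ = ψ ↔ φ.fn =ᵐ[sphereMeasure] ψ.fn :=
  ⟨fun h => h ▸ ae_eq_refl _, WFun.ext_ae⟩

theorem smul_eq_iff_ae {Λ : SL2C} {φ ψ : WFun w s} :
    Λ • φ = ψ ↔ pullback w s Λ⁻¹ φ.fn =ᵐ[sphereMeasure] ψ.fn :=
  eq_iff_ae.trans ⟨fun h => (fn_smul Λ φ).symm.trans h, fun h => (fn_smul Λ φ).trans h⟩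

theorem enorm_sq (φ : WFun w s) : ‖φ‖ₑ ^ 2 = ∫⁻ z, ‖φ.fn z‖ₑ ^ 2 ∂sphereMeasure := by
  have h : ‖φ‖ₑ = eLpNorm φ.fn 2 sphereMeasure := Lp.enorm_def (show Lp ℂ 2 sphereMeasure from φ)
  rw [h, eLpNorm_eq_lintegral_rpow_enorm_toReal (by norm_num) (by norm_num)]
  simp only [ENNReal.toReal_ofNat, ENNReal.rpow_ofNat]
  rw [← ENNReal.rpow_ofNat, ← ENNReal.rpow_mul]
  simp

theorem pullback_sub (Λ : SL2C) (f g : ℂ → ℂ) :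
    pullback w s Λ (f - g) = pullback w s Λ f - pullback w s Λ g := by
  funext z; simp [pullback, mul_sub]

theorem smul_sub' (Λ : SL2C) (φ ψ : WFun w s) : Λ • (φ - ψ) = Λ • φ - Λ • ψ := by
  rw [smul_eq_iff_ae]
  refine (pullback_congr w s _ (fn_sub φ ψ)).trans ?_
  rw [pullback_sub]
  exact ((fn_smul Λ φ).symm.sub (fn_smul Λ ψ).symm).trans (fn_sub _ _).symm

theorem smul_zero' (Λ : SL2C) : Λ • (0 : WFun w s) = 0 := by
  have := smul_sub' Λ (0 : WFun w s) 0
  simpa using this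

theorem smul_eq_zero_iff' {Λ : SL2C} {φ : WFun w s} : Λ • φ = 0 ↔ φ = 0 :=
  ⟨fun h => by rw [← inv_smul_smul Λ φ, h, smul_zero'], fun h => by rw [h, smul_zero']⟩

theorem norm_pullback (Λ : SL2C) (f : ℂ → ℂ) {z : ℂ} (h : Λ 1 0 * z + Λ 1 1 ≠ 0) :
    ‖pullback w s Λ f z‖ = confFactor Λ z ^ (-w) * ‖f (mobius Λ z)‖ := by
  have hp := confFactor_pos Λ z
  rw [pullback, norm_mul, norm_mul, norm_zpow, norm_spinPhase Λ h, one_zpow, mul_one,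
    Complex.norm_of_nonneg (by positivity)]

/-- The squared modulus is split into the area Jacobian `ϖ²` and the square of the excess
`ϖ^(-w-1)`. The excess is identically one at `w = -1`, where the action is unitary. -/
theorem enorm_pullback_sq (Λ : SL2C) (f : ℂ → ℂ) {z : ℂ} (h : Λ 1 0 * z + Λ 1 1 ≠ 0) :
    ‖pullback w s Λ f z‖ₑ ^ 2 = ENNReal.ofReal (confFactor Λ z ^ (-w - 1)) ^ 2 *
      (ENNReal.ofReal (confFactor Λ z ^ 2) * ‖f (mobius Λ z)‖ₑ ^ 2) := by
  have hp := confFactor_pos Λ z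
  have : confFactor Λ z ^ (-w) = confFactor Λ z ^ (-w - 1) * confFactor Λ z := by
    rw [← Real.rpow_add_one hp.ne']; congr 1; ring
  rw [← ofReal_norm, norm_pullback Λ f h, this, ENNReal.ofReal_mul (by positivity),
    ENNReal.ofReal_mul (by positivity), ofReal_norm, ENNReal.ofReal_pow hp.le]
  ring

theorem measurable_pullback (Λ : SL2C) {f : ℂ → ℂ} (hf : Measurable f) :
    Measurable (pullback w s Λ f) := by
  refine Measurable.mul (Measurable.mul ?_ ?_) (hf.comp (measurable_mobius Λ))
  · exact Complex.measurable_ofReal.comp ((measurable_confFactor Λ).pow_const _)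
  · exact (measurable_spinPhase Λ).pow_const (-s)

theorem norm_smul_le' (Λ : SL2C) (φ : WFun w s) : ‖Λ • φ‖ ≤ frob Λ ^ |-w - 1| * ‖φ‖ := by
  have hF := frob_pos Λ
  have key : ‖Λ • φ‖ₑ ^ 2 ≤ (ENNReal.ofReal (frob Λ ^ |-w - 1|) * ‖φ‖ₑ) ^ 2 := by
    rw [mul_pow, enorm_sq, enorm_sq, ← lintegral_mobius Λ⁻¹ _ ((measurable_fn φ).enorm.pow_const 2),
      ← lintegral_const_mul' _ _ (by simp)]
    refine lintegral_mono_ae ?_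
    filter_upwards [fn_smul Λ φ, ae_sphere (ae_denom_ne Λ⁻¹)] with z h1 h2
    rw [h1, enorm_pullback_sq _ _ h2]
    gcongr
    rw [← frob_inv]
    exact confFactor_rpow_le _ _ _
  have h2 := (ENNReal.pow_le_pow_left_iff two_ne_zero).1 key
  rw [← ofReal_norm, ← ofReal_norm, ← ENNReal.ofReal_mul (by positivity)] at h2
  exact (ENNReal.ofReal_le_ofReal_iff (by positivity)).1 h2

theorem continuous_confFactor_left (z : ℂ) : Continuous fun Λ : SL2C => confFactor Λ z := by
  unfold confFactor
  exact Continuous.div (by fun_prop) (by fun_prop) fun Λ => (denom_pos Λ z).ne'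

theorem tendsto_pullback {X : Type*} {l : Filter X} {u : X → SL2C} {Λ : SL2C}
    (hu : Tendsto u l (𝓝 Λ)) {g : ℂ → ℂ} (hg : Continuous g) {z : ℂ}
    (h : Λ 1 0 * z + Λ 1 1 ≠ 0) :
    Tendsto (fun x => pullback w s (u x) g z) l (𝓝 (pullback w s Λ g z)) := by
  have he := tendsto_sl_iff.1 hu
  have hd : Tendsto (fun x => u x 1 0 * z + u x 1 1) l (𝓝 (Λ 1 0 * z + Λ 1 1)) :=
    ((he 1 0).mul_const z).add (he 1 1)
  refine Tendsto.mul (Tendsto.mul ?_ ?_) ?_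
  · refine (Complex.continuous_ofReal.tendsto _).comp ?_
    exact (((continuous_confFactor_left z).tendsto Λ).comp hu).rpow_const
      (Or.inl (confFactor_pos Λ z).ne')
  · refine Tendsto.zpow₀ ?_ _ (Or.inl ?_)
    · exact Tendsto.div ((Complex.continuous_conj.tendsto _).comp hd) hd h
    · rw [← norm_ne_zero_iff, norm_spinPhase Λ h]; exact one_ne_zero
  · exact (hg.tendsto _).comp ((((he 0 0).mul_const z).add (he 0 1)).div hd h)

/-- Dominated convergence: the pullbacks converge off a pole, and they are uniformly bounded near
`Λ` on a space of finite measure. -/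
theorem tendsto_smul_of_continuous {g : ℂ → ℂ} (hg : Continuous g) (hc : HasCompactSupport g)
    (hm : MemLp g 2 sphereMeasure) (Λ : SL2C) :
    Tendsto (fun M : SL2C => M • ofFun w s g hm) (𝓝 Λ) (𝓝 (Λ • ofFun w s g hm)) := by
  obtain ⟨C, hC⟩ := hc.exists_bound_of_continuous hg
  have hC0 : 0 ≤ C := (norm_nonneg _).trans (hC 0)
  have hrep : ∀ M : SL2C, (M • ofFun w s g hm).fn =ᵐ[sphereMeasure] pullback w s M⁻¹ g := fun M =>
    (fn_smul M _).trans (pullback_congr w s _ (fn_ofFun hm))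
  set D : ℝ := (frob Λ + 1) ^ |-w| * C with hD
  have hbd : ∀ M : SL2C, frob M ≤ frob Λ + 1 → ∀ z, (M⁻¹) 1 0 * z + (M⁻¹) 1 1 ≠ 0 →
      ‖pullback w s M⁻¹ g z‖ ≤ D := by
    intro M hM z hz
    rw [norm_pullback _ _ hz]
    refine mul_le_mul ?_ (hC _) (norm_nonneg _) (by have := frob_pos Λ; positivity)
    refine (confFactor_rpow_le _ _ _).trans ?_
    rw [frob_inv]
    exact Real.rpow_le_rpow (frob_pos M).le hM (abs_nonneg _)
  have hlim : Tendsto (fun M : SL2C => ‖M • ofFun w s g hm - Λ • ofFun w s g hm‖ₑ ^ 2) (𝓝 Λ)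
      (𝓝 (∫⁻ _, 0 ∂sphereMeasure)) := by
    have hF : ∀ M : SL2C, ‖M • ofFun w s g hm - Λ • ofFun w s g hm‖ₑ ^ 2 =
        ∫⁻ z, ‖pullback w s M⁻¹ g z - pullback w s Λ⁻¹ g z‖ₑ ^ 2 ∂sphereMeasure := by
      intro M
      rw [enorm_sq]
      refine lintegral_congr_ae ?_
      filter_upwards [fn_sub (M • ofFun w s g hm) (Λ • ofFun w s g hm), hrep M, hrep Λ]
        with z h1 h2 h3
      rw [h1, Pi.sub_apply, h2, h3]
    simp only [hF]
    refine tendsto_lintegral_filter_of_dominated_convergence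
      (fun _ => ENNReal.ofReal (2 * D) ^ 2) ?_ ?_ ?_ ?_
    · exact Eventually.of_forall fun M => (((measurable_pullback _ hg.measurable).sub
        (measurable_pullback _ hg.measurable)).enorm.pow_const 2)
    · have : ∀ᶠ M in 𝓝 Λ, frob M < frob Λ + 1 :=
        (continuous_frob.tendsto Λ).eventually_lt_const (by linarith)
      filter_upwards [this] with M hM
      filter_upwards [ae_sphere (ae_denom_ne M⁻¹), ae_sphere (ae_denom_ne Λ⁻¹)] with z h1 h2
      gcongr
      rw [← ofReal_norm]
      refine ENNReal.ofReal_le_ofReal ((norm_sub_le _ _).trans ?_)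
      have := hbd M hM.le z h1
      have := hbd Λ (by linarith) z h2
      linarith
    · rw [lintegral_const]
      exact ENNReal.mul_ne_top (ENNReal.pow_ne_top ENNReal.ofReal_ne_top) (measure_ne_top _ _)
    · filter_upwards [ae_sphere (ae_denom_ne Λ⁻¹)] with z hz
      have h1 := tendsto_pullback (w := w) (s := s) ((continuous_inv.tendsto Λ)) hg hz
      have h2 := ((ENNReal.continuous_pow 2).tendsto _).comp
        (h1.sub_const (pullback w s Λ⁻¹ g z)).enorm
      simpa [Function.comp_def] using h2
  rw [lintegral_zero] at hlim
  rw [tendsto_iff_norm_sub_tendsto_zero]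
  have h3 := ((ENNReal.continuous_rpow_const (y := (1 / 2 : ℝ))).tendsto 0).comp hlim
  have h4 := (ENNReal.tendsto_toReal (a := 0) (by simp)).comp (by simpa using h3)
  refine (h4.congr fun M => ?_)
  simp only [Function.comp_apply]
  rw [← ENNReal.rpow_natCast, ← ENNReal.rpow_mul]
  simp

/-- The usual density argument. Approximate `φ` by a continuous compactly supported `γ`, and use the
operator bound `D`, which is uniform near `Λ`, to control the errors. -/
instance : ContinuousSMul SL2C (WFun w s) := by
  refine ⟨continuous_iff_continuousAt.2 ?_⟩
  rintro ⟨Λ, φ⟩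
  set D : ℝ := (frob Λ + 1) ^ |-w - 1| with hD
  have hD0 : 0 < D := by have := frob_pos Λ; positivity
  have hbd : ∀ M : SL2C, frob M < frob Λ + 1 → ∀ ψ : WFun w s, ‖M • ψ‖ ≤ D * ‖ψ‖ := by
    intro M hM ψ
    refine (norm_smul_le' M ψ).trans ?_
    exact mul_le_mul_of_nonneg_right
      (Real.rpow_le_rpow (frob_pos M).le hM.le (abs_nonneg _)) (norm_nonneg _)
  rw [ContinuousAt, Metric.tendsto_nhds]
  intro ε hε
  obtain ⟨g, hgc, hgl, hg, hgm⟩ := (memLp_fn φ).exists_hasCompactSupport_eLpNorm_sub_le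
    (by norm_num) (ε := ENNReal.ofReal (ε / (8 * D))) (by simp; positivity)
  have hγ : ‖φ - ofFun w s g hgm‖ ≤ ε / (8 * D) := by
    have h1 : ‖φ - ofFun w s g hgm‖ₑ = eLpNorm (φ.fn - g) 2 sphereMeasure := by
      refine (Lp.enorm_def (show Lp ℂ 2 sphereMeasure from (φ - ofFun w s g hgm))).trans ?_
      exact eLpNorm_congr_ae ((fn_sub φ _).trans ((ae_eq_refl _).sub (fn_ofFun hgm)))
    rw [← h1, ← ofReal_norm] at hgl
    exact (ENNReal.ofReal_le_ofReal_iff (by positivity)).1 hgl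
  set γ := ofFun w s g hgm with hγdef
  have e1 : ∀ᶠ M in 𝓝 Λ, frob M < frob Λ + 1 :=
    (continuous_frob.tendsto Λ).eventually_lt_const (by linarith)
  have e2 : ∀ᶠ M in 𝓝 Λ, dist (M • γ) (Λ • γ) < ε / 4 :=
    (Metric.tendsto_nhds.1 (tendsto_smul_of_continuous hg hgc hgm Λ)) _ (by positivity)
  have e3 : ∀ᶠ ψ in 𝓝 φ, dist ψ φ < ε / (4 * D) :=
    Metric.eventually_nhds_iff.2 ⟨_, by positivity, fun _ h => h⟩
  filter_upwards [(e1.and e2).prod_nhds e3] with ⟨M, ψ⟩ ⟨⟨h1, h2⟩, h3⟩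
  simp only at h1 h2 h3 ⊢
  rw [dist_eq_norm] at h2 h3 ⊢
  have hA : M • ψ - Λ • φ = M • (ψ - φ) + M • (φ - γ) + (M • γ - Λ • γ) - Λ • (φ - γ) := by
    simp only [smul_sub']; abel
  rw [hA]
  have b1 := hbd M h1 (ψ - φ)
  have b2 := hbd M h1 (φ - γ)
  have b3 := hbd Λ (by linarith) (φ - γ)
  have c1 : D * ‖ψ - φ‖ < ε / 4 := by
    calc _ < D * (ε / (4 * D)) := by gcongr
      _ = _ := by field_simp
  have c2 : D * ‖φ - γ‖ ≤ ε / 8 := by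
    calc _ ≤ D * (ε / (8 * D)) := by gcongr
      _ = _ := by field_simp
  calc _ ≤ ‖M • (ψ - φ)‖ + ‖M • (φ - γ)‖ + ‖M • γ - Λ • γ‖ + ‖Λ • (φ - γ)‖ := by
        refine (norm_sub_le _ _).trans ?_
        gcongr
        exact norm_add₃_le
    _ < ε := by linarith

end Action

end WeightedSphere

namespace WeightedSphere

/-! ### Properness of the action -/

section Proper

variable {w : ℝ} {s : ℤ}

/-- Change of variables along `M`, which exchanges the two regions. Where `ϖ ≥ 1` the excess factor
is at least one exactly because `-w - 1 ≥ 0`. Properness uses `w ≤ -1` only here. -/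
theorem setLIntegral_le_setLIntegral_pullback (hw : w ≤ -1) (M : SL2C) {f : ℂ → ℂ}
    (hf : Measurable f) :
    ∫⁻ z in {z | confFactor M⁻¹ z ≤ 1}, ‖f z‖ₑ ^ 2 ∂sphereMeasure ≤
      ∫⁻ z in {z | 1 ≤ confFactor M z}, ‖pullback w s M f z‖ₑ ^ 2 ∂sphereMeasure := by
  have hA : MeasurableSet {z | confFactor M⁻¹ z ≤ 1} :=
    measurableSet_le (measurable_confFactor _) measurable_const
  have hB : MeasurableSet {z | 1 ≤ confFactor M z} :=
    measurableSet_le measurable_const (measurable_confFactor _)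
  rw [← lintegral_indicator hA, ← lintegral_indicator hB,
    ← lintegral_mobius M _ ((hf.enorm.pow_const 2).indicator hA)]
  refine lintegral_mono_ae ?_
  filter_upwards [ae_sphere (ae_denom_ne M)] with z hz
  have hp := confFactor_pos M z
  by_cases h : 1 ≤ confFactor M z
  · have hm : mobius M z ∈ {z | confFactor M⁻¹ z ≤ 1} := by
      rw [Set.mem_ofPred_eq, confFactor_inv_mobius M hz]
      exact inv_le_one_of_one_le₀ h
    have hm' : z ∈ {z | 1 ≤ confFactor M z} := h
    rw [Set.indicator_of_mem hm, Set.indicator_of_mem hm', enorm_pullback_sq M f hz]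
    refine le_mul_of_one_le_left zero_le (one_le_pow₀ ?_)
    rw [ENNReal.one_le_ofReal]
    exact Real.one_le_rpow h (by linarith)
  · have hm : mobius M z ∉ {z | confFactor M⁻¹ z ≤ 1} := by
      rw [Set.mem_ofPred_eq, confFactor_inv_mobius M hz, not_le]
      exact (one_lt_inv₀ hp).2 (not_le.1 h)
    rw [Set.indicator_of_notMem hm]
    simp

/-- Pulling back along `M` turns the factor of `M⁻¹` into the reciprocal of that of `M`. -/
theorem measure_one_le_confFactor (M : SL2C) :
    sphereMeasure {z | 1 ≤ confFactor M⁻¹ z} =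
      ∫⁻ z, {z | confFactor M z ≤ 1}.indicator
        (fun z => ENNReal.ofReal (confFactor M z ^ 2)) z ∂sphereMeasure := by
  have hB : MeasurableSet {z | 1 ≤ confFactor M⁻¹ z} :=
    measurableSet_le measurable_const (measurable_confFactor _)
  rw [← lintegral_indicator_one hB, ← lintegral_mobius M _ (measurable_one.indicator hB)]
  refine lintegral_congr_ae ?_
  filter_upwards [ae_sphere (ae_denom_ne M)] with z hz
  have hp := confFactor_pos M z
  have hiff : mobius M z ∈ {z | 1 ≤ confFactor M⁻¹ z} ↔ z ∈ {z | confFactor M z ≤ 1} := by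
    rw [Set.mem_ofPred_eq, Set.mem_ofPred_eq, confFactor_inv_mobius M hz, one_le_inv₀ hp]
  by_cases h : z ∈ {z | confFactor M z ≤ 1}
  · rw [Set.indicator_of_mem h, Set.indicator_of_mem (hiff.2 h)]; simp
  · rw [Set.indicator_of_notMem h, Set.indicator_of_notMem (mt hiff.1 h)]; simp

theorem ENNReal_add_sq_le (x y : ℝ≥0∞) : (x + y) ^ 2 ≤ 4 * (x ^ 2 + y ^ 2) := by
  have key : ∀ x y : ℝ≥0∞, x ≤ y → (x + y) ^ 2 ≤ 4 * (x ^ 2 + y ^ 2) := by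
    intro x y h
    calc (x + y) ^ 2 ≤ (y + y) ^ 2 := by gcongr
      _ = 4 * y ^ 2 := by ring
      _ ≤ _ := by gcongr; exact le_add_self
  rcases le_total x y with h | h
  · exact key x y h
  · rw [add_comm x, add_comm (x ^ 2)]; exact key y x h

/-- The sets `A n` exhaust the sphere up to a null set while the area of `B n` tends to zero. The
mass of `φ` on `A n` is at most the mass of `u n • φ` on `B n`, and the latter tends to zero because
`u n • φ` is close to the fixed function `ψ`. -/
theorem eq_zero_of_tendsto_of_confFactor (hw : w ≤ -1) {φ ψ : WFun w s} {u : ℕ → SL2C}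
    (hu : ∀ᵐ z, Tendsto (fun n => confFactor (u n) z) atTop (𝓝 0))
    (h : Tendsto (fun n => u n • φ) atTop (𝓝 ψ)) : φ = 0 := by
  have hu := ae_sphere hu
  set A : ℕ → Set ℂ := fun n => {z | confFactor (u n) z ≤ 1} with hAdef
  set B : ℕ → Set ℂ := fun n => {z | 1 ≤ confFactor (u n)⁻¹ z} with hBdef
  have hA : ∀ n, MeasurableSet (A n) := fun n =>
    measurableSet_le (measurable_confFactor _) measurable_const
  have hfin : ∀ φ : WFun w s, ∫⁻ z, ‖φ.fn z‖ₑ ^ 2 ∂sphereMeasure ≠ ∞ := fun φ => by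
    rw [← enorm_sq]; exact ENNReal.pow_ne_top enorm_ne_top
  have hAlim : Tendsto (fun n => ∫⁻ z in A n, ‖φ.fn z‖ₑ ^ 2 ∂sphereMeasure) atTop
      (𝓝 (∫⁻ z, ‖φ.fn z‖ₑ ^ 2 ∂sphereMeasure)) := by
    simp_rw [← lintegral_indicator (hA _)]
    refine tendsto_lintegral_of_dominated_convergence (fun z => ‖φ.fn z‖ₑ ^ 2)
      (fun n => ((measurable_fn φ).enorm.pow_const 2).indicator (hA n))
      (fun n => Eventually.of_forall fun z => Set.indicator_le_self _ _ _) (hfin φ) ?_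
    filter_upwards [hu] with z hz
    refine tendsto_const_nhds.congr' ?_
    filter_upwards [hz.eventually_le_const one_pos] with n hn
    exact (Set.indicator_of_mem (s := A n) hn (fun z => ‖φ.fn z‖ₑ ^ 2)).symm
  have hBlim : Tendsto (fun n => sphereMeasure (B n)) atTop (𝓝 0) := by
    simp_rw [hBdef, measure_one_le_confFactor]
    rw [← lintegral_zero (μ := sphereMeasure)]
    refine tendsto_lintegral_of_dominated_convergence (fun _ => 1)
      (fun n => ((measurable_confFactor _).pow_const 2).ennreal_ofReal.indicator (hA n))
      (fun n => Eventually.of_forall fun z => ?_) (by simp) ?_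
    · refine Set.indicator_apply_le (g := fun _ => (1 : ℝ≥0∞)) fun hz => ?_
      rw [ENNReal.ofReal_le_one]
      exact pow_le_one₀ (confFactor_pos _ _).le hz
    · filter_upwards [hu] with z hz
      have h1 := (ENNReal.continuous_ofReal.tendsto 0).comp (by simpa using hz.pow 2)
      rw [ENNReal.ofReal_zero] at h1
      refine tendsto_of_tendsto_of_tendsto_of_le_of_le tendsto_const_nhds h1
        (fun n => zero_le) fun n => ?_
      exact Set.indicator_le_self _ _ _
  have hψ := tendsto_setLIntegral_zero (hfin ψ) hBlim
  have hle : ∀ n, ∫⁻ z in A n, ‖φ.fn z‖ₑ ^ 2 ∂sphereMeasure ≤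
      4 * (‖u n • φ - ψ‖ₑ ^ 2 + ∫⁻ z in B n, ‖ψ.fn z‖ₑ ^ 2 ∂sphereMeasure) := by
    intro n
    have h1 := setLIntegral_le_setLIntegral_pullback (s := s) hw (u n)⁻¹ (measurable_fn φ)
    rw [inv_inv] at h1
    refine h1.trans ?_
    calc _ ≤ ∫⁻ z in B n, 4 * (‖(u n • φ - ψ).fn z‖ₑ ^ 2 + ‖ψ.fn z‖ₑ ^ 2) ∂sphereMeasure := by
          refine lintegral_mono_ae (ae_restrict_of_ae ?_)
          filter_upwards [fn_smul (u n) φ, fn_sub (u n • φ) ψ] with z h1 h2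
          rw [h2, Pi.sub_apply, ← h1]
          refine le_trans ?_ (ENNReal_add_sq_le _ _)
          gcongr
          calc ‖(u n • φ).fn z‖ₑ = ‖((u n • φ).fn z - ψ.fn z) + ψ.fn z‖ₑ := by rw [sub_add_cancel]
            _ ≤ _ := enorm_add_le _ _
      _ = 4 * (∫⁻ z in B n, ‖(u n • φ - ψ).fn z‖ₑ ^ 2 ∂sphereMeasure +
            ∫⁻ z in B n, ‖ψ.fn z‖ₑ ^ 2 ∂sphereMeasure) := by
          rw [lintegral_const_mul' _ _ (by simp),
            lintegral_add_left ((measurable_fn _).enorm.pow_const 2)]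
      _ ≤ _ := by
          gcongr
          rw [enorm_sq]
          exact setLIntegral_le_lintegral _ _
  have hrhs : Tendsto (fun n => 4 * (‖u n • φ - ψ‖ₑ ^ 2 +
      ∫⁻ z in B n, ‖ψ.fn z‖ₑ ^ 2 ∂sphereMeasure)) atTop (𝓝 0) := by
    have h1 := ((ENNReal.continuous_pow 2).tendsto _).comp (h.sub_const ψ).enorm
    rw [sub_self] at h1
    have h2 := ENNReal.Tendsto.const_mul (a := 4) (h1.add hψ) (Or.inr (by simp))
    simpa using h2
  have h0 := le_of_tendsto_of_tendsto' hAlim hrhs hle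
  rw [← enorm_sq, nonpos_iff_eq_zero, pow_eq_zero_iff two_ne_zero, enorm_eq_zero] at h0
  exact h0

/-- Divide by the Frobenius norm and pass to a limit matrix `m` of norm one. The conformal factor is
`(1 + |z|²)` divided by the squared Frobenius norm times `|v (z, 1)|²`, so it tends to zero wherever
`m (z, 1) ≠ 0`. -/
theorem exists_subseq_confFactor_tendsto {u : ℕ → SL2C}
    (hu : Tendsto (fun n => frob (u n)) atTop atTop) :
    ∃ σ : ℕ → ℕ, StrictMono σ ∧
      ∀ᵐ z, Tendsto (fun n => confFactor (u (σ n)) z) atTop (𝓝 0) := by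
  set v : ℕ → Fin 2 → Fin 2 → ℂ := fun n i j => u n i j / (√(frob (u n)) : ℝ) with hv
  have hfp := fun n => frob_pos (u n)
  have hsq : ∀ n, ‖v n 0 0‖ ^ 2 + ‖v n 0 1‖ ^ 2 + ‖v n 1 0‖ ^ 2 + ‖v n 1 1‖ ^ 2 = 1 := by
    intro n
    simp only [hv, norm_div, Complex.norm_real, div_pow, Real.norm_eq_abs, sq_abs,
      Real.sq_sqrt (hfp n).le]
    have := (hfp n).ne'
    rw [← add_div, ← add_div, ← add_div]
    exact div_self this
  have hcpt : IsCompact (Set.univ.pi fun _ : Fin 2 => Set.univ.pi fun _ : Fin 2 =>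
      Metric.closedBall (0 : ℂ) 1) :=
    isCompact_univ_pi fun _ => isCompact_univ_pi fun _ => isCompact_closedBall _ _
  have hmem : ∀ n, v n ∈ (Set.univ.pi fun _ : Fin 2 => Set.univ.pi fun _ : Fin 2 =>
      Metric.closedBall (0 : ℂ) 1) := by
    intro n i _ j _
    rw [mem_closedBall_zero_iff]
    have h1 : ‖v n i j‖ ^ 2 ≤ 1 := by
      have := hsq n
      revert i j
      simp only [Fin.forall_fin_two]
      refine ⟨fun _ => ⟨fun _ => ?_, fun _ => ?_⟩, fun _ => ⟨fun _ => ?_, fun _ => ?_⟩⟩ <;>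
      linarith [sq_nonneg ‖v n 0 0‖, sq_nonneg ‖v n 0 1‖, sq_nonneg ‖v n 1 0‖, sq_nonneg ‖v n 1 1‖]
    nlinarith [norm_nonneg (v n i j)]
  obtain ⟨m, -, σ, hσ, hlim⟩ := hcpt.tendsto_subseq hmem
  have hlim' : ∀ i j, Tendsto (fun n => v (σ n) i j) atTop (𝓝 (m i j)) := fun i j =>
    tendsto_pi_nhds.1 (tendsto_pi_nhds.1 hlim i) j
  have hm1 : ‖m 0 0‖ ^ 2 + ‖m 0 1‖ ^ 2 + ‖m 1 0‖ ^ 2 + ‖m 1 1‖ ^ 2 = 1 := by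
    have := ((((hlim' 0 0).norm.pow 2).add ((hlim' 0 1).norm.pow 2)).add
      ((hlim' 1 0).norm.pow 2)).add ((hlim' 1 1).norm.pow 2)
    simp only [hsq] at this
    exact (tendsto_nhds_unique this tendsto_const_nhds)
  refine ⟨σ, hσ, ?_⟩
  -- If `m` annihilated `(x, 1)` and `(y, 1)` with `x ≠ y` it would be zero, so at most one point is
  -- lost.
  have hae : ∀ᵐ z : ℂ, ¬ (m 0 0 * z + m 0 1 = 0 ∧ m 1 0 * z + m 1 1 = 0) := by
    refine (Set.Subsingleton.countable
      (s := {z : ℂ | ¬ ¬ (m 0 0 * z + m 0 1 = 0 ∧ m 1 0 * z + m 1 1 = 0)}) ?_).measure_zero _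
    intro x hx y hy
    simp only [not_not, Set.mem_ofPred_eq] at hx hy
    by_contra hxy
    have hxy := sub_ne_zero.2 hxy
    have e0 : m 0 0 = 0 := by
      apply (mul_eq_zero.1 (show m 0 0 * (x - y) = 0 by linear_combination hx.1 - hy.1)).resolve_right
      exact hxy
    have e1 : m 1 0 = 0 := by
      apply (mul_eq_zero.1 (show m 1 0 * (x - y) = 0 by linear_combination hx.2 - hy.2)).resolve_right
      exact hxy
    have e2 : m 0 1 = 0 := by simpa [e0] using hx.1
    have e3 : m 1 1 = 0 := by simpa [e1] using hx.2
    simp [e0, e1, e2, e3] at hm1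
  filter_upwards [hae] with z hz
  have hden : Tendsto (fun n => ‖v (σ n) 0 0 * z + v (σ n) 0 1‖ ^ 2 +
      ‖v (σ n) 1 0 * z + v (σ n) 1 1‖ ^ 2) atTop
      (𝓝 (‖m 0 0 * z + m 0 1‖ ^ 2 + ‖m 1 0 * z + m 1 1‖ ^ 2)) :=
    (((((hlim' 0 0).mul_const z).add (hlim' 0 1)).norm).pow 2).add
      ((((hlim' 1 0).mul_const z).add (hlim' 1 1)).norm.pow 2)
  have hpos : 0 < ‖m 0 0 * z + m 0 1‖ ^ 2 + ‖m 1 0 * z + m 1 1‖ ^ 2 := by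
    by_contra hn
    refine hz ⟨?_, ?_⟩ <;> rw [← norm_eq_zero, ← sq_eq_zero_iff] <;>
    linarith [sq_nonneg ‖m 0 0 * z + m 0 1‖, sq_nonneg ‖m 1 0 * z + m 1 1‖]
  have h2 := (hu.comp hσ.tendsto_atTop).atTop_mul_pos hpos hden
  have h3 := (tendsto_const_nhds (x := 1 + ‖z‖ ^ 2)).div_atTop h2
  refine h3.congr fun n => ?_
  simp only [Function.comp_apply, confFactor]
  congr 1
  have hf := (hfp (σ n)).ne'
  have hs : ((√(frob (u (σ n))) : ℝ) : ℂ) ≠ 0 := by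
    exact_mod_cast (Real.sqrt_pos.2 (hfp (σ n))).ne'
  have hvi : ∀ i j, u (σ n) i j = v (σ n) i j * (√(frob (u (σ n))) : ℝ) := fun i j => by
    rw [hv]; field_simp
  have e : ∀ i, ‖u (σ n) i 0 * z + u (σ n) i 1‖ ^ 2 =
      frob (u (σ n)) * ‖v (σ n) i 0 * z + v (σ n) i 1‖ ^ 2 := by
    intro i
    rw [hvi i 0, hvi i 1]
    generalize hr : √(frob (u (σ n))) = r
    rw [show v (σ n) i 0 * (r : ℂ) * z + v (σ n) i 1 * (r : ℂ) =
      (r : ℂ) * (v (σ n) i 0 * z + v (σ n) i 1) by ring, norm_mul, mul_pow, Complex.norm_real,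
      Real.norm_eq_abs, sq_abs, ← hr, Real.sq_sqrt (hfp _).le]
  rw [e 0, e 1]; ring

/-- If `Λₙ φ` converges and `φ ≠ 0`, then a subsequence of `Λₙ` converges. -/
theorem exists_subseq_tendsto (hw : w ≤ -1) {φ ψ : WFun w s} (hφ : φ ≠ 0) {u : ℕ → SL2C}
    (h : Tendsto (fun n => u n • φ) atTop (𝓝 ψ)) :
    ∃ Λ : SL2C, ∃ σ : ℕ → ℕ, StrictMono σ ∧ Tendsto (u ∘ σ) atTop (𝓝 Λ) := by
  -- Unbounded norms would force `φ = 0`. Otherwise the norms stay bounded along a subsequence,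
  -- which lies in a compact set.
  by_cases hb : Tendsto (fun n => frob (u n)) atTop atTop
  · obtain ⟨σ, hσ, hlim⟩ := exists_subseq_confFactor_tendsto hb
    exact absurd (eq_zero_of_tendsto_of_confFactor hw (u := u ∘ σ) hlim
      (h.comp hσ.tendsto_atTop)) hφ
  · have : ∃ C, ∃ᶠ n in atTop, frob (u n) ≤ C := by
      by_contra hn
      push Not at hn
      exact hb (tendsto_atTop.2 fun C => (hn C).mono fun n h => h.le)
    obtain ⟨C, hC⟩ := this
    obtain ⟨σ, hσ, hσC⟩ := extraction_of_frequently_atTop hC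
    obtain ⟨Λ, -, τ, hτ, hlim⟩ := (isCompact_frob_le C).tendsto_subseq hσC
    exact ⟨Λ, σ ∘ τ, hσ.comp hτ, hlim⟩

theorem isClosedMap_smul (hw : w ≤ -1) {φ : WFun w s} (hφ : φ ≠ 0) :
    IsClosedMap fun Λ : SL2C => Λ • φ := by
  intro A hA
  refine IsSeqClosed.isClosed fun x ψ hx hlim => ?_
  choose u huA hux using hx
  simp only at hux
  obtain ⟨Λ, σ, hσ, hΛ⟩ := exists_subseq_tendsto hw hφ (u := u) (by simpa only [hux] using hlim)
  refine ⟨Λ, hA.mem_of_tendsto hΛ (Eventually.of_forall fun n => huA _), ?_⟩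
  refine tendsto_nhds_unique (hΛ.smul_const φ) ?_
  have := hlim.comp hσ.tendsto_atTop
  refine this.congr fun n => (hux _).symm

theorem isCompact_preimage_smul (hw : w ≤ -1) {φ : WFun w s} (hφ : φ ≠ 0) {K : Set (WFun w s)}
    (hK : IsCompact K) : IsCompact ((fun Λ : SL2C => Λ • φ) ⁻¹' K) := by
  let := TopologicalSpace.metrizableSpaceMetric SL2C
  refine IsSeqCompact.isCompact fun u hu => ?_
  obtain ⟨ψ, hψ, σ, hσ, hlim⟩ := hK.tendsto_subseq hu
  obtain ⟨Λ, τ, hτ, hΛ⟩ := exists_subseq_tendsto hw hφ (u := u ∘ σ) hlim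
  refine ⟨Λ, ?_, σ ∘ τ, hσ.comp hτ, hΛ⟩
  refine (hK.isClosed.preimage (by fun_prop)).mem_of_tendsto hΛ
    (Eventually.of_forall fun n => hu _)

theorem isCompact_littleGroup (hw : w ≤ -1) {φ : WFun w s} (hφ : φ ≠ 0) :
    IsCompact (littleGroup φ : Set SL2C) := by
  have : (littleGroup φ : Set SL2C) = (fun Λ : SL2C => Λ • φ) ⁻¹' {φ} := rfl
  rw [this]
  exact isCompact_preimage_smul hw hφ isCompact_singleton

theorem isClosed_littleGroup (φ : WFun w s) : IsClosed (littleGroup φ : Set SL2C) := by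
  have : (littleGroup φ : Set SL2C) = (fun Λ : SL2C => Λ • φ) ⁻¹' {φ} := rfl
  rw [this]
  exact isClosed_singleton.preimage (by fun_prop)

theorem continuous_orbitPoint (φ : WFun w s) : Continuous (orbitPoint φ) :=
  Continuous.subtype_mk (by fun_prop) _

theorem orbitPoint_surjective (φ : WFun w s) : Function.Surjective (orbitPoint φ) := by
  rintro ⟨_, Λ, rfl⟩
  exact ⟨Λ, rfl⟩

theorem orbitPoint_eq_iff {φ : WFun w s} {Λ M : SL2C} :
    orbitPoint φ Λ = orbitPoint φ M ↔ Λ⁻¹ * M ∈ littleGroup φ := by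
  rw [orbitPoint, orbitPoint, Subtype.mk.injEq, MulAction.mem_stabilizer_iff, mul_smul,
    inv_smul_eq_iff, eq_comm]

theorem smul_orbitPoint (φ : WFun w s) (Λ M : SL2C) :
    Λ • orbitPoint φ M = orbitPoint φ (Λ * M) :=
  Subtype.ext (mul_smul Λ M φ).symm

theorem isClosedMap_orbitPoint (hw : w ≤ -1) {φ : WFun w s} (hφ : φ ≠ 0) :
    IsClosedMap (orbitPoint φ) := by
  intro A hA
  have h := isClosedMap_smul hw hφ A hA
  refine isClosed_induced_iff.2 ⟨_, h, ?_⟩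
  ext ⟨x, hx⟩
  simp only [Set.mem_preimage, Set.mem_image, orbitPoint, Subtype.mk.injEq]

theorem isQuotientMap_orbitPoint (hw : w ≤ -1) {φ : WFun w s} (hφ : φ ≠ 0) :
    IsQuotientMap (orbitPoint φ) :=
  (isClosedMap_orbitPoint hw hφ).isQuotientMap (continuous_orbitPoint φ) (orbitPoint_surjective φ)

theorem littleGroup_zero : littleGroup (0 : WFun w s) = ⊤ :=
  eq_top_iff.2 fun Λ _ => smul_zero' Λ

/-- Both sides are quotients of `SL(2,ℂ)` with the same fibres: the coset map always, the orbit map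
because it is closed. The function `0` escapes properness, but there the quotient is a point. -/
theorem isHomeomorph_orbitEquivQuotientStabilizer (hw : w ≤ -1) (φ : WFun w s) :
    IsHomeomorph (MulAction.orbitEquivQuotientStabilizer SL2C φ) := by
  set e := MulAction.orbitEquivQuotientStabilizer SL2C φ with he
  have hcomp : e.symm ∘ (QuotientGroup.mk : SL2C → SL2C ⧸ littleGroup φ) = orbitPoint φ := by
    funext Λ
    exact Subtype.ext (MulAction.orbitEquivQuotientStabilizer_symm_apply SL2C φ Λ)
  have hcomp' : (QuotientGroup.mk : SL2C → SL2C ⧸ littleGroup φ) = e ∘ orbitPoint φ := by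
    rw [← hcomp, ← Function.comp_assoc]; simp
  have hs : Continuous e.symm := by
    refine (QuotientGroup.isQuotientMap_mk (N := littleGroup φ)).continuous_iff.2 ?_
    rw [hcomp]; exact continuous_orbitPoint φ
  have hc : Continuous e := by
    by_cases hφ : φ = 0
    · have : Subsingleton (SL2C ⧸ littleGroup φ) := by
        rw [hφ, littleGroup_zero]; exact QuotientGroup.subsingleton_quotient_top
      exact continuous_of_const fun _ _ => Subsingleton.elim _ _
    · rw [(isQuotientMap_orbitPoint hw hφ).continuous_iff, ← hcomp']
      exact continuous_quotient_mk'
  exact (Homeomorph.mk e hc hs).isHomeomorph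

theorem orbit_zero : MulAction.orbit SL2C (0 : WFun w s) = {0} := by
  ext ψ
  simp only [MulAction.mem_orbit_iff, smul_zero', exists_const, Set.mem_singleton_iff, eq_comm]

end Proper

end WeightedSphere

namespace WeightedSphere

/-! ### Subgroups and decompositions of `SL(2,ℂ)` -/

theorem rotZ_apply_zero_zero (x : ℝ) : rotZ x 0 0 = Complex.exp (-(Complex.I * x / 2)) := rfl
theorem rotZ_apply_zero_one (x : ℝ) : rotZ x 0 1 = 0 := rfl
theorem rotZ_apply_one_zero (x : ℝ) : rotZ x 1 0 = 0 := rfl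
theorem rotZ_apply_one_one (x : ℝ) : rotZ x 1 1 = Complex.exp (Complex.I * x / 2) := rfl
theorem rotY_apply_zero_zero (x : ℝ) : rotY x 0 0 = (Real.cos (x / 2) : ℂ) := rfl
theorem rotY_apply_zero_one (x : ℝ) : rotY x 0 1 = -(Real.sin (x / 2) : ℂ) := rfl
theorem rotY_apply_one_zero (x : ℝ) : rotY x 1 0 = (Real.sin (x / 2) : ℂ) := rfl
theorem rotY_apply_one_one (x : ℝ) : rotY x 1 1 = (Real.cos (x / 2) : ℂ) := rfl
theorem boostZ_apply_zero_zero (x : ℝ) : boostZ x 0 0 = (Real.exp (-(x / 2)) : ℂ) := rfl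
theorem boostZ_apply_zero_one (x : ℝ) : boostZ x 0 1 = 0 := rfl
theorem boostZ_apply_one_zero (x : ℝ) : boostZ x 1 0 = 0 := rfl
theorem boostZ_apply_one_one (x : ℝ) : boostZ x 1 1 = (Real.exp (x / 2) : ℂ) := rfl
theorem nullRot_apply_zero_zero (u v : ℝ) : nullRot u v 0 0 = 1 := rfl
theorem nullRot_apply_zero_one (u v : ℝ) : nullRot u v 0 1 = 0 := rfl
theorem nullRot_apply_one_zero (u v : ℝ) : nullRot u v 1 0 = u + v * Complex.I := rfl
theorem nullRot_apply_one_one (u v : ℝ) : nullRot u v 1 1 = 1 := rfl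

/-- The lower triangular matrix with rows `(e^{-t/2}, 0)` and `(ζ, e^{t/2})`. -/
noncomputable def tri (t : ℝ) (ζ : ℂ) : SL2C :=
  ⟨!![(Real.exp (-(t / 2)) : ℂ), 0; ζ, (Real.exp (t / 2) : ℂ)], by
    rw [Matrix.det_fin_two_of, ← Complex.ofReal_mul, ← Real.exp_add]; simp⟩

theorem tri_apply_zero_zero (t : ℝ) (ζ : ℂ) : tri t ζ 0 0 = (Real.exp (-(t / 2)) : ℂ) := rfl
theorem tri_apply_zero_one (t : ℝ) (ζ : ℂ) : tri t ζ 0 1 = 0 := rfl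
theorem tri_apply_one_zero (t : ℝ) (ζ : ℂ) : tri t ζ 1 0 = ζ := rfl
theorem tri_apply_one_one (t : ℝ) (ζ : ℂ) : tri t ζ 1 1 = (Real.exp (t / 2) : ℂ) := rfl

theorem nullRot_mul_boostZ (u v t : ℝ) :
    nullRot u v * boostZ t = tri t ((u + v * Complex.I) * Real.exp (-(t / 2))) := by
  apply sl_ext <;> simp only [mul_apply', nullRot_apply_zero_zero, nullRot_apply_zero_one,
    nullRot_apply_one_zero, nullRot_apply_one_one, boostZ_apply_zero_zero, boostZ_apply_zero_one,
    boostZ_apply_one_zero, boostZ_apply_one_one, tri_apply_zero_zero, tri_apply_zero_one,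
    tri_apply_one_zero, tri_apply_one_one] <;> ring

theorem boostZ_mul_nullRot (u v t : ℝ) :
    boostZ t * nullRot u v = tri t (Real.exp (t / 2) * (u + v * Complex.I)) := by
  apply sl_ext <;> simp only [mul_apply', nullRot_apply_zero_zero, nullRot_apply_zero_one,
    nullRot_apply_one_zero, nullRot_apply_one_one, boostZ_apply_zero_zero, boostZ_apply_zero_one,
    boostZ_apply_one_zero, boostZ_apply_one_one, tri_apply_zero_zero, tri_apply_zero_one,
    tri_apply_one_zero, tri_apply_one_one] <;> ring

theorem tri_mul (t t' : ℝ) (ζ ζ' : ℂ) :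
    tri t ζ * tri t' ζ' =
      tri (t + t') (ζ * Real.exp (-(t' / 2)) + Real.exp (t / 2) * ζ') := by
  apply sl_ext <;> simp only [mul_apply', tri_apply_zero_zero, tri_apply_zero_one,
    tri_apply_one_zero, tri_apply_one_one]
  · rw [show -((t + t') / 2) = -(t / 2) + -(t' / 2) by ring, Real.exp_add]; push_cast; ring
  · ring
  · rw [add_div, Real.exp_add]; push_cast; ring

theorem tri_inv (t : ℝ) (ζ : ℂ) : (tri t ζ)⁻¹ = tri (-t) (-ζ) := by
  apply sl_ext <;> simp only [inv_apply_zero_zero, inv_apply_zero_one, inv_apply_one_zero,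
    inv_apply_one_one, tri_apply_zero_zero, tri_apply_zero_one, tri_apply_one_zero,
    tri_apply_one_one, neg_div, neg_neg, neg_zero]

theorem rotZ_add (x y : ℝ) : rotZ (x + y) = rotZ x * rotZ y := by
  apply sl_ext <;> simp only [mul_apply', rotZ_apply_zero_zero, rotZ_apply_zero_one,
    rotZ_apply_one_zero, rotZ_apply_one_one, mul_zero, zero_mul, add_zero, zero_add,
    ← Complex.exp_add] <;> push_cast <;> ring_nf

theorem rotZ_zero : rotZ 0 = 1 := by
  apply sl_ext <;> simp [rotZ]

theorem rotZ_neg (x : ℝ) : rotZ (-x) = (rotZ x)⁻¹ := by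
  rw [eq_inv_iff_mul_eq_one, ← rotZ_add, neg_add_cancel, rotZ_zero]

theorem rotZ_two_pi : rotZ (2 * Real.pi) = -1 := by
  have h : Complex.I * ((2 * Real.pi : ℝ) : ℂ) / 2 = Real.pi * Complex.I := by push_cast; ring
  apply sl_ext <;> simp only [rotZ_apply_zero_zero, rotZ_apply_zero_one, rotZ_apply_one_zero,
    rotZ_apply_one_one, h, Complex.exp_neg, Complex.exp_pi_mul_I] <;> simp

theorem rotZ_add_two_pi (x : ℝ) : rotZ (x + 2 * Real.pi) = -rotZ x := by
  rw [rotZ_add, rotZ_two_pi, mul_neg, mul_one]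

theorem rotY_add (x y : ℝ) : rotY (x + y) = rotY x * rotY y := by
  apply sl_ext <;> simp only [mul_apply', rotY_apply_zero_zero, rotY_apply_zero_one,
    rotY_apply_one_zero, rotY_apply_one_one, add_div, Real.cos_add, Real.sin_add] <;>
  push_cast <;> ring

theorem rotY_zero : rotY 0 = 1 := by
  apply sl_ext <;> simp [rotY]

theorem continuous_rotZ : Continuous rotZ := by
  rw [continuous_sl_iff]
  simp only [Fin.forall_fin_two, rotZ_apply_zero_zero, rotZ_apply_zero_one, rotZ_apply_one_zero,
    rotZ_apply_one_one]
  refine ⟨⟨?_, ?_⟩, ?_, ?_⟩ <;> fun_prop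

theorem continuous_rotY : Continuous rotY := by
  rw [continuous_sl_iff]
  simp only [Fin.forall_fin_two, rotY_apply_zero_zero, rotY_apply_zero_one, rotY_apply_one_zero,
    rotY_apply_one_one]
  refine ⟨⟨?_, ?_⟩, ?_, ?_⟩ <;> fun_prop

theorem continuous_boostZ : Continuous boostZ := by
  rw [continuous_sl_iff]
  simp only [Fin.forall_fin_two, boostZ_apply_zero_zero, boostZ_apply_zero_one,
    boostZ_apply_one_zero, boostZ_apply_one_one]
  refine ⟨⟨?_, ?_⟩, ?_, ?_⟩ <;> fun_prop

theorem continuous_nullRot : Continuous fun p : ℝ × ℝ => nullRot p.1 p.2 := by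
  rw [continuous_sl_iff]
  simp only [Fin.forall_fin_two, nullRot_apply_zero_zero, nullRot_apply_zero_one,
    nullRot_apply_one_zero, nullRot_apply_one_one]
  refine ⟨⟨?_, ?_⟩, ?_, ?_⟩ <;> fun_prop

theorem continuous_tri : Continuous fun p : ℝ × ℂ => tri p.1 p.2 := by
  rw [continuous_sl_iff]
  simp only [Fin.forall_fin_two, tri_apply_zero_zero, tri_apply_zero_one,
    tri_apply_one_zero, tri_apply_one_one]
  refine ⟨⟨?_, ?_⟩, ?_, ?_⟩ <;> fun_prop

theorem mem_SU2_iff_mul {Λ : SL2C} : Λ ∈ SU2 ↔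
    (Λ : Matrix (Fin 2) (Fin 2) ℂ) * (Λ : Matrix (Fin 2) (Fin 2) ℂ).conjTranspose = 1 :=
  Matrix.mem_unitaryGroup_iff

theorem mem_SU2_iff {Λ : SL2C} :
    Λ ∈ SU2 ↔ Λ 1 1 = conj (Λ 0 0) ∧ Λ 1 0 = -conj (Λ 0 1) := by
  rw [mem_SU2_iff_mul]
  constructor
  · intro h
    have h2 : ((Λ⁻¹ : SL2C) : Matrix (Fin 2) (Fin 2) ℂ) * (Λ : Matrix (Fin 2) (Fin 2) ℂ) = 1 := by
      rw [← Matrix.SpecialLinearGroup.coe_mul, inv_mul_cancel, Matrix.SpecialLinearGroup.coe_one]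
    have h3 := left_inv_eq_right_inv h2 h
    have e0 : (Λ⁻¹) 0 0 = conj (Λ 0 0) := congrFun (congrFun h3 0) 0
    have e1 : (Λ⁻¹) 1 0 = conj (Λ 0 1) := congrFun (congrFun h3 1) 0
    rw [inv_apply_zero_zero] at e0
    rw [inv_apply_one_zero] at e1
    exact ⟨e0, by rw [← e1, neg_neg]⟩
  · rintro ⟨h0, h1⟩
    have hd := det_eq Λ
    rw [h0, h1] at hd
    ext i j
    rw [Matrix.mul_apply, Fin.sum_univ_two]
    simp only [Matrix.conjTranspose_apply]
    revert i j
    simp only [Fin.forall_fin_two, h0, h1, Matrix.one_apply_eq, Complex.star_def, map_neg,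
      Complex.conj_conj]
    refine ⟨⟨?_, ?_⟩, ?_, ?_⟩
    · linear_combination hd
    · simp; ring
    · simp; ring
    · linear_combination hd

theorem SU2_norm_sq {Λ : SL2C} (h : Λ ∈ SU2) : ‖Λ 0 0‖ ^ 2 + ‖Λ 0 1‖ ^ 2 = 1 := by
  obtain ⟨h0, h1⟩ := mem_SU2_iff.1 h
  have hd := det_eq Λ
  rw [h0, h1] at hd
  have e : ((‖Λ 0 0‖ ^ 2 + ‖Λ 0 1‖ ^ 2 : ℝ) : ℂ) = 1 := by
    push_cast
    rw [← Complex.mul_conj', ← Complex.mul_conj']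
    linear_combination hd
  exact_mod_cast e

/-- The element of `SU(2)` with first row `(a, b)`. -/
noncomputable def suMk (a b : ℂ) (h : ‖a‖ ^ 2 + ‖b‖ ^ 2 = 1) : SL2C :=
  ⟨!![a, b; -conj b, conj a], by
    rw [Matrix.det_fin_two_of, mul_neg, sub_neg_eq_add, Complex.mul_conj', Complex.mul_conj']
    exact_mod_cast h⟩

theorem suMk_mem (a b : ℂ) (h : ‖a‖ ^ 2 + ‖b‖ ^ 2 = 1) : suMk a b h ∈ SU2 :=
  mem_SU2_iff.2 ⟨rfl, rfl⟩

theorem rotZ_mem_SU2 (x : ℝ) : rotZ x ∈ SU2 := by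
  rw [mem_SU2_iff]
  simp only [rotZ_apply_zero_zero, rotZ_apply_zero_one, rotZ_apply_one_zero,
    rotZ_apply_one_one, ← Complex.exp_conj]
  refine ⟨?_, by simp⟩
  rw [show -(Complex.I * (x : ℂ) / 2) = ((-(x / 2) : ℝ) : ℂ) * Complex.I by push_cast; ring,
    map_mul, Complex.conj_ofReal, Complex.conj_I]
  congr 1; push_cast; ring

theorem rotY_mem_SU2 (x : ℝ) : rotY x ∈ SU2 := by
  rw [mem_SU2_iff]
  simp only [rotY_apply_zero_zero, rotY_apply_zero_one, rotY_apply_one_zero,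
    rotY_apply_one_one, Complex.conj_ofReal, map_neg, neg_neg, and_self]

theorem Gam_le_SU2 : Gam ≤ SU2 := by
  rintro _ ⟨x, rfl⟩
  exact rotZ_mem_SU2 x

theorem rotZ_mem_Gam (x : ℝ) : rotZ x ∈ Gam := ⟨x, rfl⟩

theorem isClosed_SU2 : IsClosed (SU2 : Set SL2C) := by
  have : (SU2 : Set SL2C) = {Λ | Λ 1 1 = conj (Λ 0 0)} ∩ {Λ | Λ 1 0 = -conj (Λ 0 1)} := by
    ext Λ; exact mem_SU2_iff
  rw [this]
  exact (isClosed_eq (by fun_prop) (by fun_prop)).inter (isClosed_eq (by fun_prop) (by fun_prop))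

theorem frob_eq_of_mem_SU2 {Λ : SL2C} (h : Λ ∈ SU2) : frob Λ = 2 := by
  have h1 := SU2_norm_sq h
  obtain ⟨h2, h3⟩ := mem_SU2_iff.1 h
  rw [frob, h2, h3, norm_neg, RCLike.norm_conj, RCLike.norm_conj]
  linarith

theorem isCompact_SU2 : IsCompact (SU2 : Set SL2C) :=
  (isCompact_frob_le 2).of_isClosed_subset isClosed_SU2 fun _ h => (frob_eq_of_mem_SU2 h).le

theorem confFactor_of_mem_SU2 {Λ : SL2C} (h : Λ ∈ SU2) (z : ℂ) : confFactor Λ z = 1 := by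
  have h1 := SU2_norm_sq h
  obtain ⟨h2, h3⟩ := mem_SU2_iff.1 h
  rw [confFactor, div_eq_one_iff_eq (denom_pos Λ z).ne', h2, h3]
  have e : ((1 + ‖z‖ ^ 2 : ℝ) : ℂ) = ((‖Λ 0 0 * z + Λ 0 1‖ ^ 2 +
      ‖-conj (Λ 0 1) * z + conj (Λ 0 0)‖ ^ 2 : ℝ) : ℂ) := by
    have h1' : (Λ 0 0) * conj (Λ 0 0) + Λ 0 1 * conj (Λ 0 1) = 1 := by
      rw [Complex.mul_conj', Complex.mul_conj']; exact_mod_cast h1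
    push_cast
    simp only [← Complex.mul_conj', map_add, map_mul, map_neg, Complex.conj_conj]
    linear_combination (-1 - z * conj z) * h1'
  exact_mod_cast e

/-- The decomposition of `SL(2,ℂ)` into `SU(2)` times lower triangular matrices. -/
theorem exists_SU2_mul_tri (Λ : SL2C) : ∃ κ ∈ SU2, ∃ t ζ, Λ = κ * tri t ζ := by
  have hp : 0 < ‖Λ 0 1‖ ^ 2 + ‖Λ 1 1‖ ^ 2 := by simpa using denom_pos Λ 0
  -- The second column of `Λ`, divided by its length `n`, is taken as the second column of `κ`. This
  -- clears the upper right entry of `κ⁻¹ Λ` and leaves `n = e^{t/2}` in the lower right.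
  set n := √(‖Λ 0 1‖ ^ 2 + ‖Λ 1 1‖ ^ 2) with hn
  have hn0 : 0 < n := Real.sqrt_pos.2 hp
  have hn2 : n ^ 2 = ‖Λ 0 1‖ ^ 2 + ‖Λ 1 1‖ ^ 2 := Real.sq_sqrt hp.le
  have hnc : (n : ℂ) ≠ 0 := by exact_mod_cast hn0.ne'
  have hn2c : (n : ℂ) ^ 2 = Λ 0 1 * conj (Λ 0 1) + Λ 1 1 * conj (Λ 1 1) := by
    rw [Complex.mul_conj', Complex.mul_conj']; exact_mod_cast hn2
  have hk : ‖conj (Λ 1 1) / n‖ ^ 2 + ‖Λ 0 1 / n‖ ^ 2 = 1 := by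
    rw [norm_div, norm_div, RCLike.norm_conj, Complex.norm_real, Real.norm_of_nonneg hn0.le,
      div_pow, div_pow, ← add_div, hn2, add_comm, div_self hp.ne']
  set κ := suMk _ _ hk with hκ
  have k00 : κ 0 0 = conj (Λ 1 1) / n := rfl
  have k01 : κ 0 1 = Λ 0 1 / n := rfl
  have k10 : κ 1 0 = -conj (Λ 0 1 / n) := rfl
  have k11 : κ 1 1 = conj (conj (Λ 1 1) / n) := rfl
  refine ⟨κ, suMk_mem _ _ hk, 2 * Real.log n, (κ⁻¹ * Λ) 1 0, ?_⟩
  rw [← inv_mul_eq_iff_eq_mul]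
  have e1 : Real.exp (2 * Real.log n / 2) = n := by
    rw [mul_div_cancel_left₀ _ two_ne_zero, Real.exp_log hn0]
  have e2 : Real.exp (-(2 * Real.log n / 2)) = n⁻¹ := by rw [Real.exp_neg, e1]
  have hd := det_eq Λ
  apply sl_ext <;> simp only [mul_apply', tri_apply_zero_zero, tri_apply_zero_one,
    tri_apply_one_zero, tri_apply_one_one, inv_apply_zero_zero, inv_apply_zero_one,
    inv_apply_one_zero, inv_apply_one_one, k00, k01, k10, k11, map_div₀, Complex.conj_conj,
    Complex.conj_ofReal, e1, e2]
  · push_cast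
    field_simp
    linear_combination hd
  · field_simp
    ring
  · field_simp
    rw [hn2c]; ring

theorem tri_mem_SU2_iff {t : ℝ} {ζ : ℂ} : tri t ζ ∈ SU2 ↔ t = 0 ∧ ζ = 0 := by
  rw [mem_SU2_iff]
  simp only [tri_apply_zero_zero, tri_apply_zero_one, tri_apply_one_zero, tri_apply_one_one,
    Complex.conj_ofReal, map_zero, neg_zero, Complex.ofReal_inj, Real.exp_eq_exp]
  constructor
  · rintro ⟨h1, h2⟩; exact ⟨by linarith, h2⟩
  · rintro ⟨rfl, rfl⟩; simp

theorem tri_zero : tri 0 0 = 1 := by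
  apply sl_ext <;> simp [tri]

theorem tri_injective {t t' : ℝ} {ζ ζ' : ℂ} (h : tri t ζ = tri t' ζ') : t = t' ∧ ζ = ζ' := by
  have h1 := congrArg (fun Λ : SL2C => Λ 1 1) h
  have h2 := congrArg (fun Λ : SL2C => Λ 1 0) h
  simp only [tri_apply_one_zero, tri_apply_one_one, Complex.ofReal_inj, Real.exp_eq_exp] at h1 h2
  exact ⟨by linarith, h2⟩

/-- A unitary lower triangular matrix with positive diagonal is the identity. -/
theorem SU2_mul_tri_injective {κ κ' : SL2C} (hκ : κ ∈ SU2) (hκ' : κ' ∈ SU2) {t t' : ℝ} {ζ ζ' : ℂ}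
    (h : κ * tri t ζ = κ' * tri t' ζ') : κ = κ' ∧ t = t' ∧ ζ = ζ' := by
  have h1 : κ'⁻¹ * κ = tri t' ζ' * (tri t ζ)⁻¹ := by
    rw [eq_mul_inv_iff_mul_eq, mul_assoc, h, inv_mul_cancel_left]
  have h2 := SU2.mul_mem (SU2.inv_mem hκ') hκ
  have h3 := h2
  rw [h1, tri_inv, tri_mul, tri_mem_SU2_iff] at h3
  have h4 : κ'⁻¹ * κ = 1 := by rw [h1, tri_inv, tri_mul, h3.1, h3.2, tri_zero]
  have h5 : κ = κ' := by rw [← mul_one κ', ← h4, mul_inv_cancel_left]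
  subst h5
  exact ⟨rfl, tri_injective (mul_left_cancel h)⟩

theorem exists_tri_mul_SU2 (Λ : SL2C) : ∃ κ ∈ SU2, ∃ t ζ, Λ = tri t ζ * κ := by
  obtain ⟨κ, hκ, t, ζ, h⟩ := exists_SU2_mul_tri Λ⁻¹
  refine ⟨κ⁻¹, SU2.inv_mem hκ, -t, -ζ, ?_⟩
  rw [← inv_inv Λ, h, mul_inv_rev, tri_inv]

theorem tri_eq_nullRot_mul_boostZ (t : ℝ) (ζ : ℂ) :
    ∃ u v, tri t ζ = nullRot u v * boostZ t := by
  refine ⟨(ζ * Real.exp (t / 2)).re, (ζ * Real.exp (t / 2)).im, ?_⟩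
  rw [nullRot_mul_boostZ, Complex.re_add_im, mul_assoc, ← Complex.ofReal_mul, ← Real.exp_add]
  simp

theorem tri_eq_boostZ_mul_nullRot (t : ℝ) (ζ : ℂ) :
    ∃ u v, tri t ζ = boostZ t * nullRot u v := by
  refine ⟨(Real.exp (-(t / 2)) * ζ).re, (Real.exp (-(t / 2)) * ζ).im, ?_⟩
  rw [boostZ_mul_nullRot, Complex.re_add_im, ← mul_assoc, ← Complex.ofReal_mul, ← Real.exp_add]
  simp

theorem SU2_ext {κ κ' : SL2C} (h : κ ∈ SU2) (h' : κ' ∈ SU2) (h0 : κ 0 0 = κ' 0 0)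
    (h1 : κ 1 0 = κ' 1 0) : κ = κ' := by
  obtain ⟨a, b⟩ := mem_SU2_iff.1 h
  obtain ⟨a', b'⟩ := mem_SU2_iff.1 h'
  have e : κ 0 1 = κ' 0 1 := by
    rw [b, b', neg_inj] at h1
    exact (starRingEnd ℂ).injective h1
  exact sl_ext h0 e h1 (by rw [a, a', h0])

theorem euler_apply_zero_zero (φ θ ψ : ℝ) : (rotZ φ * rotY θ * rotZ ψ) 0 0 =
    Real.cos (θ / 2) * Complex.exp (-(φ + ψ) / 2 * Complex.I) := by
  simp only [mul_apply', rotZ_apply_zero_zero, rotZ_apply_zero_one, rotZ_apply_one_zero,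
    rotY_apply_zero_zero, rotY_apply_zero_one]
  rw [show -((φ : ℂ) + ψ) / 2 * Complex.I = -(Complex.I * φ / 2) + -(Complex.I * ψ / 2) by ring,
    Complex.exp_add]
  ring

theorem euler_apply_one_zero (φ θ ψ : ℝ) : (rotZ φ * rotY θ * rotZ ψ) 1 0 =
    Real.sin (θ / 2) * Complex.exp ((φ - ψ) / 2 * Complex.I) := by
  simp only [mul_apply', rotZ_apply_zero_zero, rotZ_apply_one_one, rotZ_apply_one_zero,
    rotY_apply_one_zero, rotY_apply_one_one, rotY_apply_zero_zero]
  rw [show ((φ : ℂ) - ψ) / 2 * Complex.I = Complex.I * φ / 2 + -(Complex.I * ψ / 2) by ring,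
    Complex.exp_add]
  ring

theorem euler_mem_SU2 (φ θ ψ : ℝ) : rotZ φ * rotY θ * rotZ ψ ∈ SU2 :=
  SU2.mul_mem (SU2.mul_mem (rotZ_mem_SU2 φ) (rotY_mem_SU2 θ)) (rotZ_mem_SU2 ψ)

/-- Euler angles. -/
theorem exists_euler {κ : SL2C} (h : κ ∈ SU2) : ∃ φ ψ : ℝ,
    κ = rotZ φ * rotY (2 * Real.arccos ‖κ 0 0‖) * rotZ ψ := by
  have h1 := SU2_norm_sq h
  obtain ⟨h2, h3⟩ := mem_SU2_iff.1 h
  set α := (κ 0 0).arg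
  set γ := (κ 1 0).arg
  have ha : κ 0 0 = ‖κ 0 0‖ * Complex.exp (α * Complex.I) :=
    (Complex.norm_mul_exp_arg_mul_I _).symm
  have hc : κ 1 0 = ‖κ 1 0‖ * Complex.exp (γ * Complex.I) :=
    (Complex.norm_mul_exp_arg_mul_I _).symm
  have hcn : √(1 - ‖κ 0 0‖ ^ 2) = ‖κ 1 0‖ := by
    rw [h3, norm_neg, RCLike.norm_conj, ← Real.sqrt_sq (norm_nonneg (κ 0 1))]
    congr 1; linarith
  -- The solution of `-(φ + ψ)/2 = α` and `(φ - ψ)/2 = γ`, the phases of the first column.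
  refine ⟨γ - α, -α - γ, SU2_ext h (euler_mem_SU2 _ _ _) ?_ ?_⟩
  · rw [euler_apply_zero_zero, mul_div_cancel_left₀ _ two_ne_zero,
      Real.cos_arccos (by linarith [norm_nonneg (κ 0 0)]) (by nlinarith [sq_nonneg ‖κ 0 1‖])]
    conv_lhs => rw [ha]
    congr 2; push_cast; ring
  · rw [euler_apply_one_zero, mul_div_cancel_left₀ _ two_ne_zero, Real.sin_arccos, hcn]
    conv_lhs => rw [hc]
    congr 2; push_cast; ring

theorem norm_apply_le_one {κ : SL2C} (h : κ ∈ SU2) : ‖κ 0 0‖ ≤ 1 := by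
  nlinarith [SU2_norm_sq h, sq_nonneg ‖κ 0 1‖, norm_nonneg (κ 0 0)]

theorem two_mul_arccos_norm_mem (κ : SL2C) :
    2 * Real.arccos ‖κ 0 0‖ ∈ Set.Icc 0 Real.pi := by
  have h1 := Real.arccos_nonneg ‖κ 0 0‖
  have h2 := Real.arccos_le_pi_div_two.2 (norm_nonneg (κ 0 0))
  exact ⟨by linarith, by linarith⟩

/-! ### Connectedness -/

theorem isConnected_Gam : IsConnected (Gam : Set SL2C) :=
  isConnected_range continuous_rotZ

theorem isConnected_SU2 : IsConnected (SU2 : Set SL2C) := by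
  have : (SU2 : Set SL2C) =
      Set.range fun p : ℝ × ℝ × ℝ => rotZ p.1 * rotY p.2.1 * rotZ p.2.2 := by
    ext κ
    constructor
    · intro h
      obtain ⟨φ, ψ, e⟩ := exists_euler h
      exact ⟨(φ, _, ψ), e.symm⟩
    · rintro ⟨p, rfl⟩
      exact euler_mem_SU2 _ _ _
  rw [this]
  exact isConnected_range (((continuous_rotZ.comp continuous_fst).mul
    (continuous_rotY.comp (continuous_fst.comp continuous_snd))).mul
    (continuous_rotZ.comp (continuous_snd.comp continuous_snd)))

instance : ConnectedSpace SL2C := by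
  rw [connectedSpace_iff_univ]
  have : (Set.univ : Set SL2C) =
      (fun p : SL2C × ℝ × ℂ => p.1 * tri p.2.1 p.2.2) '' ((SU2 : Set SL2C) ×ˢ Set.univ) := by
    symm
    rw [Set.eq_univ_iff_forall]
    intro Λ
    obtain ⟨κ, hκ, t, ζ, h⟩ := exists_SU2_mul_tri Λ
    exact ⟨(κ, t, ζ), ⟨hκ, trivial⟩, h.symm⟩
  rw [this]
  exact (isConnected_SU2.prod isConnected_univ).image _
    (continuous_fst.mul (continuous_tri.comp continuous_snd)).continuousOn

/-! ### Connected closed subgroups of `SU(2)` -/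

theorem eq_rotZ_of_apply_eq_zero {κ : SL2C} (h : κ ∈ SU2) (h0 : κ 0 1 = 0) : κ ∈ Gam := by
  have h1 := SU2_norm_sq h
  have hn : ‖κ 0 0‖ = 1 := by
    rw [h0, norm_zero] at h1
    nlinarith [norm_nonneg (κ 0 0)]
  refine ⟨-2 * (κ 0 0).arg, SU2_ext (rotZ_mem_SU2 _) h ?_ ?_⟩
  · rw [rotZ_apply_zero_zero]
    conv_rhs => rw [← Complex.norm_mul_exp_arg_mul_I (κ 0 0), hn]
    push_cast
    rw [one_mul]; congr 1; ring
  · rw [rotZ_apply_one_zero, (mem_SU2_iff.1 h).2, h0]; simp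

/-- Diagonalization: `l` is an eigenvalue with eigenvector `(h₀₁, l - h₀₀)`, and its normalization
is the second column of `κ`. That vector could vanish when `h₀₁ = 0`, but then `h` is already
diagonal. -/
theorem exists_conj_rotZ {h : SL2C} (hh : h ∈ SU2) :
    ∃ κ ∈ SU2, ∃ x, h = κ * rotZ x * κ⁻¹ := by
  by_cases hb : h 0 1 = 0
  · obtain ⟨x, hx⟩ := eq_rotZ_of_apply_eq_zero hh hb
    exact ⟨1, SU2.one_mem, x, by simp [hx]⟩
  obtain ⟨μ, hμ⟩ : ∃ μ : ℂ, μ ^ 2 = (h 0 0 + h 1 1) ^ 2 - 4 :=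
    IsAlgClosed.exists_pow_nat_eq _ two_pos
  set l : ℂ := (h 0 0 + h 1 1 + μ) / 2 with hl
  have hroot : l ^ 2 - (h 0 0 + h 1 1) * l + 1 = 0 := by
    rw [hl]; linear_combination hμ / 4
  have hd := det_eq h
  set n := √(‖h 0 1‖ ^ 2 + ‖l - h 0 0‖ ^ 2) with hn
  have hp : 0 < ‖h 0 1‖ ^ 2 + ‖l - h 0 0‖ ^ 2 := by
    have := norm_pos_iff.2 hb
    positivity
  have hn0 : 0 < n := Real.sqrt_pos.2 hp
  have hn2 : n ^ 2 = ‖h 0 1‖ ^ 2 + ‖l - h 0 0‖ ^ 2 := Real.sq_sqrt hp.le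
  have hnc : (n : ℂ) ≠ 0 := by exact_mod_cast hn0.ne'
  have hk : ‖conj (l - h 0 0) / n‖ ^ 2 + ‖h 0 1 / n‖ ^ 2 = 1 := by
    rw [norm_div, norm_div, RCLike.norm_conj, Complex.norm_real, Real.norm_of_nonneg hn0.le,
      div_pow, div_pow, ← add_div, hn2, add_comm, div_self hp.ne']
  set κ := suMk _ _ hk with hκ
  have hκm : κ ∈ SU2 := suMk_mem _ _ hk
  have k01 : κ 0 1 = h 0 1 / n := rfl
  have k11 : κ 1 1 = (l - h 0 0) / n := by
    change conj (conj (l - h 0 0) / n) = _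
    rw [map_div₀, Complex.conj_conj, Complex.conj_ofReal]
  have hmem : κ⁻¹ * h * κ ∈ SU2 := SU2.mul_mem (SU2.mul_mem (SU2.inv_mem hκm) hh) hκm
  have hz : (κ⁻¹ * h * κ) 0 1 = 0 := by
    rw [mul_assoc, mul_apply' κ⁻¹, mul_apply', mul_apply', inv_apply_zero_zero,
      inv_apply_zero_one, k01, k11]
    field_simp
    linear_combination (h 0 1) * hroot + (h 0 1) * hd
  obtain ⟨x, hx⟩ := eq_rotZ_of_apply_eq_zero hmem hz
  exact ⟨κ, hκm, x, by rw [hx]; group⟩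

theorem rotZ_mem_of_irrational {S : AddSubgroup ℝ} (hS : IsClosed (S : Set ℝ)) {x y : ℝ}
    (hx : x ∈ S) (hy : y ∈ S) (h : Irrational (x / y)) (r : ℝ) : r ∈ S := by
  have hd : Dense ((AddSubgroup.closure {x, y} : AddSubgroup ℝ) : Set ℝ) :=
    dense_addSubgroupClosure_pair_iff.2 h
  have hle : AddSubgroup.closure {x, y} ≤ S := by
    rw [AddSubgroup.closure_le]
    rintro _ (rfl | rfl) <;> assumption
  have : Dense (S : Set ℝ) := hd.mono hle
  have h2 := this.closure_eq
  rw [hS.closure_eq] at h2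
  exact SetLike.mem_coe.1 (by rw [h2]; trivial)

/-- A nontrivial closed connected subgroup of `SU(2)` contains a conjugate of `Γ`. -/
theorem exists_conj_Gam_le {G : Subgroup SL2C} (hG : G ≤ SU2)
    (hconn : IsPreconnected (G : Set SL2C)) (hcl : IsClosed (G : Set SL2C)) (hne : G ≠ ⊥) :
    ∃ κ ∈ SU2, ∀ x, κ * rotZ x * κ⁻¹ ∈ G := by
  obtain ⟨⟨g, hg⟩, hg1⟩ := G.ne_bot_iff_exists_ne_one.1 hne
  replace hg1 : g ≠ 1 := fun h => hg1 (Subtype.ext h)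
  have hre : (g 0 0).re < 1 := by
    by_contra hn
    push Not at hn
    have h1 := SU2_norm_sq (hG hg)
    have h2 : (g 0 0).re ≤ ‖g 0 0‖ := (Complex.abs_re_le_norm _).trans' (le_abs_self _)
    have h3 := norm_apply_le_one (hG hg)
    have h4 : (g 0 0).re = 1 := by linarith
    have h5 : ‖g 0 0‖ = 1 := by linarith
    have h6 : g 0 0 = 1 := by
      have h7 := Complex.sq_norm (g 0 0)
      rw [Complex.normSq_apply, h5, h4] at h7
      apply Complex.ext
      · simpa using h4
      · have : (g 0 0).im * (g 0 0).im = 0 := by linarith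
        simpa using this
    have h8 : g 0 1 = 0 := by
      rw [h5] at h1
      have : ‖g 0 1‖ ^ 2 = 0 := by linarith
      simpa using this
    apply hg1
    refine SU2_ext (hG hg) SU2.one_mem (by simpa using h6) ?_
    rw [(mem_SU2_iff.1 (hG hg)).2, h8]; simp
  have hre' : -1 ≤ (g 0 0).re := by
    have := norm_apply_le_one (hG hg)
    have := (abs_le.1 (Complex.abs_re_le_norm (g 0 0))).1
    linarith
  have hac : 0 < Real.arccos (g 0 0).re := Real.arccos_pos.2 hre
  -- An irrational `r` with `cos (r π)` between `Re g₀₀` and `1`. The real part of the upper left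
  -- entry, half the trace on `SU(2)`, takes this value on the connected group `G`.
  obtain ⟨r, hr, hr0, hr1⟩ := exists_irrational_btwn (div_pos hac Real.pi_pos)
  have hrπ : r * Real.pi < Real.arccos (g 0 0).re := by rwa [lt_div_iff₀ Real.pi_pos] at hr1
  have hcos : (g 0 0).re ≤ Real.cos (r * Real.pi) := by
    rw [← Real.cos_arccos hre' hre.le]
    exact Real.cos_le_cos_of_nonneg_of_le_pi (by positivity) (Real.arccos_le_pi _) hrπ.le
  obtain ⟨h, hhG, hh⟩ := hconn.intermediate_value hg G.one_mem
    (f := fun Λ : SL2C => (Λ 0 0).re)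
    (Complex.continuous_re.comp (continuous_entry 0 0)).continuousOn
    (show Real.cos (r * Real.pi) ∈ _ from ⟨hcos, by simpa using Real.cos_le_one _⟩)
  obtain ⟨κ, hκ, x, hx⟩ := exists_conj_rotZ (hG hhG)
  have htr : Real.cos (x / 2) = Real.cos (r * Real.pi) := by
    have e1 : h 0 0 + h 1 1 = rotZ x 0 0 + rotZ x 1 1 := by
      rw [hx]
      simp only [mul_apply', inv_apply_zero_zero, inv_apply_zero_one, inv_apply_one_zero,
        inv_apply_one_one, rotZ_apply_zero_one, rotZ_apply_one_zero]
      linear_combination (rotZ x 0 0 + rotZ x 1 1) * det_eq κ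
    rw [(mem_SU2_iff.1 (hG hhG)).1, (mem_SU2_iff.1 (rotZ_mem_SU2 x)).1, Complex.add_conj,
      Complex.add_conj] at e1
    have e2 : (h 0 0).re = (rotZ x 0 0).re := by
      have : 2 * (h 0 0).re = 2 * (rotZ x 0 0).re := by exact_mod_cast e1
      linarith
    simp only at hh
    rw [← hh, e2, rotZ_apply_zero_zero,
      show -(Complex.I * (x : ℂ) / 2) = ((-(x / 2) : ℝ) : ℂ) * Complex.I by push_cast; ring,
      Complex.exp_ofReal_mul_I_re, Real.cos_neg]
  -- Equality of cosines gives `x/2 = ±rπ` modulo `2π`. Hence `x` is incommensurable with `4π`, the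
  -- period of `rotZ`.
  have hirr : Irrational (x / (2 * (2 * Real.pi))) := by
    have hπ := Real.pi_ne_zero
    rw [Real.cos_eq_cos_iff] at htr
    obtain ⟨k, hk | hk⟩ := htr
    · have : x / (2 * (2 * Real.pi)) = (r - 2 * (k : ℝ)) / 2 := by
        have hx' : x = 2 * (r * Real.pi - 2 * k * Real.pi) := by linarith
        rw [hx']; field_simp
      rw [this]
      have h1 : Irrational (r - ((2 * k : ℤ) : ℝ)) := hr.sub_intCast _
      have h2 := h1.div_natCast (m := 2) two_ne_zero
      push_cast at h2
      exact h2
    · have : x / (2 * (2 * Real.pi)) = (2 * (k : ℝ) - r) / 2 := by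
        have hx' : x = 2 * (2 * k * Real.pi - r * Real.pi) := by linarith
        rw [hx']; field_simp
      rw [this]
      have h1 : Irrational (((2 * k : ℤ) : ℝ) - r) := hr.intCast_sub _
      have h2 := h1.div_natCast (m := 2) two_ne_zero
      push_cast at h2
      exact h2
  -- The parameters whose conjugated rotation lies in `G` form a closed subgroup of `ℝ`. It contains
  -- `x` and `4π`, so it is all of `ℝ`.
  let S : AddSubgroup ℝ :=
    { carrier := {x | κ * rotZ x * κ⁻¹ ∈ G}
      zero_mem' := by simp [rotZ_zero, G.one_mem]
      add_mem' := by
        intro a b ha hb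
        have := G.mul_mem ha hb
        rw [Set.mem_ofPred_eq, rotZ_add]
        convert this using 1
        group
      neg_mem' := by
        intro a ha
        have := G.inv_mem ha
        rw [Set.mem_ofPred_eq, rotZ_neg]
        convert this using 1
        group }
  have hS : IsClosed (S : Set ℝ) :=
    hcl.preimage ((continuous_const.mul continuous_rotZ).mul continuous_const)
  have h1 : x ∈ S := by
    change κ * rotZ x * κ⁻¹ ∈ G
    rw [← hx]; exact hhG
  have h2 : 2 * (2 * Real.pi) ∈ S := by
    change κ * rotZ _ * κ⁻¹ ∈ G
    rw [two_mul (2 * Real.pi), rotZ_add, rotZ_two_pi]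
    simp [G.one_mem]
  exact ⟨κ, hκ, fun r => rotZ_mem_of_irrational hS h1 h2 hirr r⟩

theorem rotY_nat_mul (x : ℝ) (n : ℕ) : rotY (n * x) = rotY x ^ n := by
  induction n with
  | zero => simp [rotY_zero]
  | succ n ih => rw [Nat.cast_succ, add_mul, one_mul, rotY_add, ih, pow_succ]

/-- On `G` the modulus of the upper left entry takes every value from `|g₀₀| < 1` up to `1`.
Stripping the outer Euler factors, which lie in `Γ`, leaves all small rotations about the second
axis. Their powers give the rest. -/
theorem SU2_le_of_Gam_lt {G : Subgroup SL2C} (hG : G ≤ SU2)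
    (hconn : IsPreconnected (G : Set SL2C)) (hΓ : Gam ≤ G) (hne : G ≠ Gam) : SU2 ≤ G := by
  obtain ⟨g, hg, hgΓ⟩ := SetLike.exists_of_lt (lt_of_le_of_ne hΓ hne.symm)
  have hg1 : ‖g 0 0‖ < 1 := by
    refine lt_of_le_of_ne (norm_apply_le_one (hG hg)) fun h => hgΓ ?_
    refine eq_rotZ_of_apply_eq_zero (hG hg) ?_
    have h1 := SU2_norm_sq (hG hg)
    rw [h] at h1
    have : ‖g 0 1‖ ^ 2 = 0 := by linarith
    simpa using this
  have hac : 0 < Real.arccos ‖g 0 0‖ := Real.arccos_pos.2 hg1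
  have hsmall : ∀ x, 0 ≤ x → x ≤ Real.arccos ‖g 0 0‖ → rotY (2 * x) ∈ G := by
    intro x hx0 hx
    have hxπ : x ≤ Real.pi := hx.trans (Real.arccos_le_pi _)
    have hcos : ‖g 0 0‖ ≤ Real.cos x := by
      rw [← Real.cos_arccos (by linarith [norm_nonneg (g 0 0)]) hg1.le]
      exact Real.cos_le_cos_of_nonneg_of_le_pi hx0 (Real.arccos_le_pi _) hx
    obtain ⟨h, hhG, hh⟩ := hconn.intermediate_value hg G.one_mem
      (f := fun Λ : SL2C => ‖Λ 0 0‖) (continuous_entry 0 0).norm.continuousOn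
      (show Real.cos x ∈ _ from ⟨hcos, by simpa using Real.cos_le_one _⟩)
    obtain ⟨φ, ψ, e⟩ := exists_euler (hG hhG)
    simp only at hh
    rw [hh, Real.arccos_cos hx0 hxπ] at e
    have : rotY (2 * x) = (rotZ φ)⁻¹ * h * (rotZ ψ)⁻¹ := by rw [e]; group
    rw [this]
    exact G.mul_mem (G.mul_mem (G.inv_mem (hΓ (rotZ_mem_Gam φ))) hhG)
      (G.inv_mem (hΓ (rotZ_mem_Gam ψ)))
  have hall : ∀ x, 0 ≤ x → rotY (2 * x) ∈ G := by
    intro x hx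
    obtain ⟨n, hn⟩ := exists_nat_gt (x / Real.arccos ‖g 0 0‖)
    have hn0 : (0 : ℝ) < n := lt_of_le_of_lt (by positivity) hn
    have h1 := hsmall (x / n) (by positivity) (by
      rw [div_le_iff₀ hn0]
      rw [div_lt_iff₀ hac] at hn
      linarith)
    have h2 := G.pow_mem h1 n
    rw [← rotY_nat_mul] at h2
    convert h2 using 2
    field_simp
  intro κ hκ
  obtain ⟨φ, ψ, e⟩ := exists_euler hκ
  rw [e]
  exact G.mul_mem (G.mul_mem (hΓ (rotZ_mem_Gam φ)) (hall _ (Real.arccos_nonneg _)))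
    (hΓ (rotZ_mem_Gam ψ))

end WeightedSphere

namespace WeightedSphere

/-! ### Compact subgroups -/

/-- The lower triangular matrix `h` for which `h h†` has first row `(p, q)`. -/
noncomputable def cholesky (p : ℝ) (q : ℂ) : SL2C := tri (-Real.log p) (conj q / √p)

theorem cholesky_mul_conjTranspose {p r : ℝ} {q : ℂ} (hp : 0 < p) (h : p * r - ‖q‖ ^ 2 = 1) :
    (cholesky p q : Matrix (Fin 2) (Fin 2) ℂ) *
      (cholesky p q : Matrix (Fin 2) (Fin 2) ℂ).conjTranspose =
      !![(p : ℂ), q; conj q, (r : ℂ)] := by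
  have hs : 0 < √p := Real.sqrt_pos.2 hp
  have e1 : Real.exp (-(-Real.log p / 2)) = √p := by
    rw [neg_div, neg_neg, Real.exp_half, Real.exp_log hp]
  have e2 : Real.exp (-Real.log p / 2) = (√p)⁻¹ := by
    rw [← e1, ← Real.exp_neg, neg_neg]
  have c00 : cholesky p q 0 0 = (√p : ℝ) := by rw [← e1]; rfl
  have c01 : cholesky p q 0 1 = 0 := rfl
  have c10 : cholesky p q 1 0 = conj q / (√p : ℝ) := rfl
  have c11 : cholesky p q 1 1 = ((√p)⁻¹ : ℝ) := by rw [← e2]; rfl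
  have hsc : ((√p : ℝ) : ℂ) ≠ 0 := by exact_mod_cast hs.ne'
  have hsq : ((√p : ℝ) : ℂ) * (√p : ℝ) = p := by
    rw [← Complex.ofReal_mul, Real.mul_self_sqrt hp.le]
  have hpc : (p : ℂ) ≠ 0 := by exact_mod_cast hp.ne'
  have hc : (p : ℂ) * r - q * conj q = 1 := by
    rw [Complex.mul_conj']; exact_mod_cast h
  ext i j
  rw [Matrix.mul_apply, Fin.sum_univ_two]
  simp only [Matrix.conjTranspose_apply]
  revert i j
  simp only [Fin.forall_fin_two, c00, c01, c10, c11, Complex.star_def, map_zero, map_div₀,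
    Complex.conj_ofReal, Complex.conj_conj, mul_zero, zero_mul, add_zero]
  refine ⟨⟨?_, ?_⟩, ?_, ?_⟩
  · exact hsq
  · change _ = q
    field_simp
  · change _ = conj q
    field_simp
  · change _ = (r : ℂ)
    push_cast
    rw [div_mul_div_comm, hsq, ← mul_inv, hsq]
    field_simp
    linear_combination -hc

/-- Weyl's averaging trick. The Haar average `P` of `g g†` satisfies `k P k† = P` for `k` in `L` and
is positive definite. Scaled to determinant one it has a Cholesky factorization `h h†`, and then
`h⁻¹ g h` is unitary. -/
theorem exists_conj_mem_SU2 {L : Subgroup SL2C} (hL : IsCompact (L : Set SL2C)) :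
    ∃ h : SL2C, ∀ g ∈ L, h⁻¹ * g * h ∈ SU2 := by
  have : CompactSpace L := isCompact_iff_compactSpace.1 hL
  let : MeasurableSpace L := borel L
  have : BorelSpace L := ⟨rfl⟩
  set μ : Measure L := Measure.haar
  let H : SL2C → Fin 2 → Fin 2 → ℂ := fun Λ i j => Λ i 0 * conj (Λ j 0) + Λ i 1 * conj (Λ j 1)
  have hent : ∀ i j, Continuous fun g : L => (g : SL2C) i j := fun i j =>
    (continuous_entry i j).comp continuous_subtype_val
  have hHc : ∀ i j, Continuous fun g : L => H g i j := fun i j =>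
    ((hent i 0).mul (Complex.continuous_conj.comp (hent j 0))).add
      ((hent i 1).mul (Complex.continuous_conj.comp (hent j 1)))
  have hintg : ∀ i j, Integrable (fun g : L => H g i j) μ := fun i j =>
    (hHc i j).integrable_of_hasCompactSupport (HasCompactSupport.of_compactSpace _)
  let P : Fin 2 → Fin 2 → ℂ := fun i j => ∫ g : L, H g i j ∂μ
  have hlin : ∀ a b c d : ℂ, ∫ g : L, (a * H g 0 0 + b * H g 0 1 + c * H g 1 0 + d * H g 1 1) ∂μ =
      a * P 0 0 + b * P 0 1 + c * P 1 0 + d * P 1 1 := by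
    intro a b c d
    have h0 := (hintg 0 0).const_mul a
    have h1 := (hintg 0 1).const_mul b
    have h2 := (hintg 1 0).const_mul c
    have h3 := (hintg 1 1).const_mul d
    rw [integral_add ((h0.fun_add h1).fun_add h2) h3, integral_add (h0.fun_add h1) h2,
      integral_add h0 h1, integral_const_mul, integral_const_mul, integral_const_mul,
      integral_const_mul]
  have hreal : ∀ F : L → ℝ, ((∫ g, F g ∂μ : ℝ) : ℂ) = ∫ g, (F g : ℂ) ∂μ := fun F =>
    integral_complex_ofReal.symm
  have hinv : ∀ k ∈ L, ∀ i j, P i j = k i 0 * conj (k j 0) * P 0 0 + k i 0 * conj (k j 1) * P 0 1 +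
      k i 1 * conj (k j 0) * P 1 0 + k i 1 * conj (k j 1) * P 1 1 := by
    intro k hk i j
    have e1 : ∀ g : L, H ((⟨k, hk⟩ * g : L) : SL2C) i j =
        k i 0 * conj (k j 0) * H g 0 0 + k i 0 * conj (k j 1) * H g 0 1 +
        k i 1 * conj (k j 0) * H g 1 0 + k i 1 * conj (k j 1) * H g 1 1 := by
      intro g
      simp only [H, Subgroup.coe_mul, mul_apply', map_add, map_mul]
      ring
    have e2 := integral_mul_left_eq_self (μ := μ) (fun g : L => H g i j) ⟨k, hk⟩
    simp only [e1] at e2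
    change ∫ g : L, H g i j ∂μ = _
    rw [← e2, hlin]
  have hherm : P 1 0 = conj (P 0 1) := by
    change ∫ g : L, H g 1 0 ∂μ = conj (∫ g : L, H g 0 1 ∂μ)
    rw [← integral_conj]
    congr 1; funext g
    simp only [H, map_add, map_mul, Complex.conj_conj]; ring
  let p : ℝ := ∫ g : L, ‖(g : SL2C) 0 0‖ ^ 2 + ‖(g : SL2C) 0 1‖ ^ 2 ∂μ
  let r : ℝ := ∫ g : L, ‖(g : SL2C) 1 0‖ ^ 2 + ‖(g : SL2C) 1 1‖ ^ 2 ∂μ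
  have hp : P 0 0 = p := by
    refine Eq.trans ?_ (hreal _).symm
    change ∫ g : L, H g 0 0 ∂μ = _
    congr 1; funext g
    simp only [H, Complex.mul_conj']; push_cast; rfl
  have hr : P 1 1 = r := by
    refine Eq.trans ?_ (hreal _).symm
    change ∫ g : L, H g 1 1 ∂μ = _
    congr 1; funext g
    simp only [H, Complex.mul_conj']; push_cast; rfl
  set q : ℂ := P 0 1 with hq
  have hposint : ∀ F : L → ℝ, Continuous F → (∀ g, 0 < F g) → 0 < ∫ g, F g ∂μ := by
    intro F hF hpos
    refine hF.integral_pos_of_hasCompactSupport_nonneg_nonzero (HasCompactSupport.of_compactSpace _)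
      (fun g => (hpos g).le) (x := 1) (hpos 1).ne'
  have hrow : ∀ (g : SL2C) (x y : ℂ), y ≠ 0 →
      0 < ‖x * g 0 0 + y * g 1 0‖ ^ 2 + ‖x * g 0 1 + y * g 1 1‖ ^ 2 := by
    intro g x y hy
    by_contra hn
    have h1 : x * g 0 0 + y * g 1 0 = 0 := by
      rw [← norm_eq_zero, ← sq_eq_zero_iff]
      linarith [sq_nonneg ‖x * g 0 0 + y * g 1 0‖, sq_nonneg ‖x * g 0 1 + y * g 1 1‖]
    have h2 : x * g 0 1 + y * g 1 1 = 0 := by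
      rw [← norm_eq_zero, ← sq_eq_zero_iff]
      linarith [sq_nonneg ‖x * g 0 0 + y * g 1 0‖, sq_nonneg ‖x * g 0 1 + y * g 1 1‖]
    exact hy (by linear_combination g 0 0 * h2 - g 0 1 * h1 - y * det_eq g)
  have hp0 : 0 < p := by
    refine hposint _ (((hent 0 0).norm.pow 2).add ((hent 0 1).norm.pow 2)) fun g => ?_
    by_contra hn
    have h1 : (g : SL2C) 0 0 = 0 := by
      rw [← norm_eq_zero, ← sq_eq_zero_iff]
      linarith [sq_nonneg ‖(g : SL2C) 0 0‖, sq_nonneg ‖(g : SL2C) 0 1‖]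
    have h2 : (g : SL2C) 0 1 = 0 := by
      rw [← norm_eq_zero, ← sq_eq_zero_iff]
      linarith [sq_nonneg ‖(g : SL2C) 0 0‖, sq_nonneg ‖(g : SL2C) 0 1‖]
    have := det_eq (g : SL2C)
    simp [h1, h2] at this
  -- Evaluate the averaged form on the row vector `(-q̄, p)`: its value is `p (p r - |q|²)`, and it
  -- is positive because its second entry is nonzero.
  have hdet : 0 < p * r - ‖q‖ ^ 2 := by
    have h1 := hposint (fun g => ‖-conj q * (g : SL2C) 0 0 + p * (g : SL2C) 1 0‖ ^ 2 +
      ‖-conj q * (g : SL2C) 0 1 + p * (g : SL2C) 1 1‖ ^ 2)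
      ((((continuous_const.mul (hent 0 0)).add (continuous_const.mul (hent 1 0))).norm.pow 2).add
      (((continuous_const.mul (hent 0 1)).add (continuous_const.mul (hent 1 1))).norm.pow 2))
      fun g => hrow g _ _ (by exact_mod_cast hp0.ne')
    have h2 : ((∫ g : L, ‖-conj q * (g : SL2C) 0 0 + p * (g : SL2C) 1 0‖ ^ 2 +
      ‖-conj q * (g : SL2C) 0 1 + p * (g : SL2C) 1 1‖ ^ 2 ∂μ : ℝ) : ℂ) =
        ((p * (p * r - ‖q‖ ^ 2) : ℝ) : ℂ) := by
      refine (hreal _).trans ?_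
      have e : ∀ g : L, ((‖-conj q * (g : SL2C) 0 0 + p * (g : SL2C) 1 0‖ ^ 2 +
          ‖-conj q * (g : SL2C) 0 1 + p * (g : SL2C) 1 1‖ ^ 2 : ℝ) : ℂ) =
          q * conj q * H g 0 0 + -(p * conj q) * H g 0 1 + -(p * q) * H g 1 0 +
          p * p * H g 1 1 := by
        intro g
        simp only [H]
        push_cast
        simp only [← Complex.mul_conj', map_add, map_mul, map_neg, Complex.conj_conj,
          Complex.conj_ofReal]
        ring
      calc _ = ∫ g : L, (q * conj q * H g 0 0 + -(p * conj q) * H g 0 1 + -(p * q) * H g 1 0 +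
          p * p * H g 1 1) ∂μ := by congr 1; funext g; exact e g
        _ = q * conj q * P 0 0 + -(p * conj q) * P 0 1 + -(p * q) * P 1 0 + p * p * P 1 1 := by
          exact hlin _ _ _ _
        _ = _ := by
          rw [hp, hr, hherm, ← hq]
          push_cast
          rw [← Complex.mul_conj']
          ring
    have h3 := Complex.ofReal_injective h2
    rw [h3] at h1
    exact (mul_pos_iff_of_pos_left hp0).1 h1
  set c := √(p * r - ‖q‖ ^ 2) with hc
  have hc0 : 0 < c := Real.sqrt_pos.2 hdet
  have hc2 : c * c = p * r - ‖q‖ ^ 2 := Real.mul_self_sqrt hdet.le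
  have hcc : (c : ℂ) ≠ 0 := by exact_mod_cast hc0.ne'
  have hnorm : p / c * (r / c) - ‖q / c‖ ^ 2 = 1 := by
    rw [norm_div, Complex.norm_real, Real.norm_of_nonneg hc0.le]
    field_simp
    linarith
  have hchol := cholesky_mul_conjTranspose (div_pos hp0 hc0) hnorm
  set h := cholesky (p / c) (q / c)
  refine ⟨h, fun g hg => ?_⟩
  have hg' : (g : Matrix (Fin 2) (Fin 2) ℂ) * (h : Matrix (Fin 2) (Fin 2) ℂ) *
      (h : Matrix (Fin 2) (Fin 2) ℂ).conjTranspose * (g : Matrix (Fin 2) (Fin 2) ℂ).conjTranspose =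
      (h : Matrix (Fin 2) (Fin 2) ℂ) * (h : Matrix (Fin 2) (Fin 2) ℂ).conjTranspose := by
    rw [mul_assoc (g : Matrix (Fin 2) (Fin 2) ℂ), hchol]
    have hPe : !![((p / c : ℝ) : ℂ), q / c; conj (q / c), ((r / c : ℝ) : ℂ)] =
        Matrix.of fun i j => P i j / c := by
      ext i j
      revert i j
      simp only [Fin.forall_fin_two, Matrix.of_apply, hp, hr, hherm, ← hq, map_div₀,
        Complex.conj_ofReal]
      refine ⟨⟨?_, ?_⟩, ?_, ?_⟩ <;> simp
    rw [hPe]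
    ext i j
    simp only [Matrix.mul_apply, Fin.sum_univ_two, Matrix.conjTranspose_apply, Matrix.of_apply,
      Complex.star_def]
    rw [hinv g hg i j]
    field_simp
    ring
  rw [mem_SU2_iff_mul, Matrix.SpecialLinearGroup.coe_mul, Matrix.SpecialLinearGroup.coe_mul,
    Matrix.conjTranspose_mul, Matrix.conjTranspose_mul]
  set hi : Matrix (Fin 2) (Fin 2) ℂ := ((h⁻¹ : SL2C) : Matrix (Fin 2) (Fin 2) ℂ)
  have hih : hi * (h : Matrix (Fin 2) (Fin 2) ℂ) = 1 := by
    rw [← Matrix.SpecialLinearGroup.coe_mul, inv_mul_cancel, Matrix.SpecialLinearGroup.coe_one]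
  calc _ = hi * ((g : Matrix (Fin 2) (Fin 2) ℂ) * (h : Matrix (Fin 2) (Fin 2) ℂ) *
      (h : Matrix (Fin 2) (Fin 2) ℂ).conjTranspose *
        (g : Matrix (Fin 2) (Fin 2) ℂ).conjTranspose) * hi.conjTranspose := by noncomm_ring
    _ = (hi * (h : Matrix (Fin 2) (Fin 2) ℂ)) *
        (hi * (h : Matrix (Fin 2) (Fin 2) ℂ)).conjTranspose := by
      rw [hg', Matrix.conjTranspose_mul]; noncomm_ring
    _ = 1 := by rw [hih]; simp

end WeightedSphere

namespace WeightedSphere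

/-! ### Functions invariant under the standard subgroups -/

section Invariant

variable {w : ℝ} {s : ℤ}

theorem pullback_neg (Λ : SL2C) (f : ℂ → ℂ) : pullback w s (-Λ) f = pullback w s Λ f := by
  funext z
  have h : ∀ i j, (-Λ) i j = -Λ i j := fun i j => rfl
  have e : ∀ i, -Λ i 0 * z + -Λ i 1 = -(Λ i 0 * z + Λ i 1) := fun i => by ring
  simp only [pullback, confFactor, spinPhase, mobius, h, e, norm_neg, map_neg, neg_div_neg_eq]

theorem Z2_le_littleGroup (φ : WFun w s) : Z2 ≤ littleGroup φ := by
  rintro Λ (rfl | rfl)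
  · exact one_smul _ φ
  · have h : (-1 : SL2C)⁻¹ = -1 := inv_eq_of_mul_eq_one_left (by simp)
    rw [MulAction.mem_stabilizer_iff, smul_eq_iff_ae, h, pullback_neg, pullback_one]

theorem mobius_rotZ (x : ℝ) (z : ℂ) : mobius (rotZ x) z = Complex.exp (-(x * Complex.I)) * z := by
  rw [mobius, rotZ_apply_one_zero, rotZ_apply_zero_one, rotZ_apply_zero_zero,
    rotZ_apply_one_one, zero_mul, zero_add, add_zero, mul_div_right_comm, ← Complex.exp_sub]
  congr 2; ring

theorem pullback_rotZ (x : ℝ) (f : ℂ → ℂ) (z : ℂ) :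
    pullback w s (rotZ x) f z =
      Complex.exp (s * (x * Complex.I)) * f (Complex.exp (-(x * Complex.I)) * z) := by
  have h1 : spinPhase (rotZ x) z = Complex.exp (-(x * Complex.I)) := by
    have := (mem_SU2_iff.1 (rotZ_mem_SU2 x)).1
    rw [spinPhase, rotZ_apply_one_zero, zero_mul, zero_add, this, Complex.conj_conj, ← this,
      rotZ_apply_zero_zero, rotZ_apply_one_one, ← Complex.exp_sub]
    congr 1; ring
  rw [pullback, confFactor_of_mem_SU2 (rotZ_mem_SU2 x), h1, mobius_rotZ, Real.one_rpow, zpow_neg,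
    ← Complex.exp_int_mul, ← Complex.exp_neg]
  simp

theorem exp_mul_arg {z : ℂ} (hz : z ≠ 0) :
    Complex.exp (Complex.I * s * Complex.arg z) = (z / ‖z‖) ^ s := by
  have hn : (‖z‖ : ℂ) ≠ 0 := by simpa using hz
  have h : z / ‖z‖ = Complex.exp (Complex.arg z * Complex.I) := by
    rw [div_eq_iff hn, mul_comm]; exact (Complex.norm_mul_exp_arg_mul_I z).symm
  rw [h, ← Complex.exp_int_mul]
  congr 1; ring

theorem Gam_le_littleGroup_iff (φ : WFun w s) : Gam ≤ littleGroup φ ↔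
    ∀ x : ℝ, ∀ᵐ z, φ.fn z =
      Complex.exp (s * (x * Complex.I)) * φ.fn (Complex.exp (-(x * Complex.I)) * z) := by
  have key : ∀ x : ℝ, rotZ x ∈ littleGroup φ ↔ ∀ᵐ z, φ.fn z =
      Complex.exp (s * ((-x : ℝ) * Complex.I)) *
        φ.fn (Complex.exp (-((-x : ℝ) * Complex.I)) * z) := by
    intro x
    rw [MulAction.mem_stabilizer_iff, smul_eq_iff_ae, ← rotZ_neg]
    refine ae_sphere_iff.trans ?_
    simp only [pullback_rotZ]
    constructor <;> intro h <;> filter_upwards [h] with z hz <;> exact hz.symm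
  constructor
  · intro h x
    have := (key (-x)).1 (h (rotZ_mem_Gam _))
    simpa only [neg_neg] using this
  · rintro h _ ⟨x, rfl⟩
    exact (key x).2 (h (-x))

/-- The candidate for `φ₀(r)` is the mean of `e^{-isα} φ(r e^{iα})` over the circle. Averaging
avoids choosing a good point on each circle. -/
theorem Gam_le_littleGroup_iff_isAxisymmetric (φ : WFun w s) :
    Gam ≤ littleGroup φ ↔ IsAxisymmetric φ := by
  constructor
  · intro h
    rw [Gam_le_littleGroup_iff] at h
    have hm := measurable_fn φ
    have hmeas : MeasurableSet {p : ℝ × ℂ | φ.fn p.2 =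
        Complex.exp (s * (p.1 * Complex.I)) * φ.fn (Complex.exp (-(p.1 * Complex.I)) * p.2)} :=
      measurableSet_eq_fun (by fun_prop) (by fun_prop)
    -- The exceptional null set of `z` depends on the angle. Fubini replaces this by: for almost
    -- every `z` the relation holds for almost every angle.
    have h2 := (Measure.ae_ae_comm (μ := (volume : Measure ℝ)) (ν := (volume : Measure ℂ))
      (p := fun x z => φ.fn z = Complex.exp (s * (x * Complex.I)) *
        φ.fn (Complex.exp (-(x * Complex.I)) * z)) hmeas).1 (Eventually.of_forall h)
    refine ⟨fun r => (2 * Real.pi : ℝ)⁻¹ * ∫ α in (0 : ℝ)..(2 * Real.pi),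
      Complex.exp (-(s * (α * Complex.I))) * φ.fn (r * Complex.exp (α * Complex.I)), ?_⟩
    refine ae_sphere ?_
    filter_upwards [h2] with z hz
    set θ := Complex.arg z with hθ
    have hz' := (Measure.measurePreserving_sub_left volume θ).quasiMeasurePreserving.ae hz
    have hc : ∀ᵐ α : ℝ, Complex.exp (-(s * (α * Complex.I))) *
        φ.fn (‖z‖ * Complex.exp (α * Complex.I)) =
        Complex.exp (-(Complex.I * s * θ)) * φ.fn z := by
      filter_upwards [hz'] with α hα
      have e : Complex.exp (-(((θ - α : ℝ) : ℂ) * Complex.I)) * z =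
          ‖z‖ * Complex.exp (α * Complex.I) := by
        conv_lhs => rw [← Complex.norm_mul_exp_arg_mul_I z]
        rw [mul_left_comm, ← Complex.exp_add]
        congr 2; push_cast; ring
      rw [e] at hα
      rw [hα, ← mul_assoc (Complex.exp (-(Complex.I * s * θ))), ← Complex.exp_add]
      congr 2; push_cast; ring
    rw [intervalIntegral.integral_congr_ae (hc.mono fun α h _ => h),
      intervalIntegral.integral_const, sub_zero, Complex.real_smul]
    have hπ : ((2 * Real.pi : ℝ) : ℂ) ≠ 0 := by exact_mod_cast Real.two_pi_pos.ne'
    rw [← mul_assoc, ← mul_assoc, mul_assoc (Complex.exp _), mul_assoc (Complex.exp _)]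
    push_cast at hπ ⊢
    rw [inv_mul_cancel₀ hπ, one_mul, ← mul_assoc, ← Complex.exp_add]
    simp
  · rintro ⟨φ₀, h⟩
    rw [Gam_le_littleGroup_iff]
    intro x
    have h0 := ae_of_ae_sphere h
    have h1 := ae_of_ae_sphere (pullback_congr w s (rotZ x) h)
    filter_upwards [h0, h1, (Set.countable_singleton (0 : ℂ)).ae_notMem volume]
      with z hz hz1 hz0
    have hz0 : z ≠ 0 := hz0
    rw [pullback_rotZ, pullback_rotZ] at hz1
    rw [hz1, hz]
    have hn : ‖Complex.exp (-(x * Complex.I)) * z‖ = ‖z‖ := by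
      rw [norm_mul, Complex.norm_exp]; simp
    rw [exp_mul_arg hz0, exp_mul_arg (mul_ne_zero (Complex.exp_ne_zero _) hz0), hn, ← mul_assoc,
      mul_div_assoc, mul_zpow, ← mul_assoc, ← Complex.exp_int_mul, ← Complex.exp_add]
    simp

/-! ### Invariance under `SU(2)`. -/

theorem mem_littleGroup_of_SU2 {φ : WFun w s} (h : SU2 ≤ littleGroup φ) {κ : SL2C}
    (hκ : κ ∈ SU2) : ∀ᵐ z, φ.fn z = spinPhase κ z ^ (-s) * φ.fn (mobius κ z) := by
  have h1 := h (SU2.inv_mem hκ)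
  rw [MulAction.mem_stabilizer_iff, smul_eq_iff_ae, inv_inv] at h1
  filter_upwards [ae_of_ae_sphere h1] with z hz
  rw [← hz, pullback, confFactor_of_mem_SU2 hκ]
  simp

/-- The phase of the rotation that takes `0` to `p`. -/
noncomputable def rotPhase (p z : ℂ) : ℂ := conj (1 - conj p * z) / (1 - conj p * z)

/-- The element of `SU(2)` with first row proportional to `(1, p)`. The normalizing real factor
drops out of both the Möbius map and the phase. -/
theorem ae_eq_of_SU2_le {φ : WFun w s} (h : SU2 ≤ littleGroup φ) (p : ℂ) :
    ∀ᵐ z, φ.fn z = rotPhase p z ^ (-s) * φ.fn ((z + p) / (1 - conj p * z)) := by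
  have hp : (0 : ℝ) < 1 + ‖p‖ ^ 2 := by positivity
  set n := √(1 + ‖p‖ ^ 2) with hn
  have hn0 : 0 < n := Real.sqrt_pos.2 hp
  have hn2 : n ^ 2 = 1 + ‖p‖ ^ 2 := Real.sq_sqrt hp.le
  have hnc : (n : ℂ) ≠ 0 := by exact_mod_cast hn0.ne'
  have hk : ‖1 / (n : ℂ)‖ ^ 2 + ‖p / n‖ ^ 2 = 1 := by
    rw [norm_div, norm_div, norm_one, Complex.norm_real, Real.norm_of_nonneg hn0.le,
      div_pow, div_pow, ← add_div, hn2, one_pow, div_self hp.ne']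
  set κ := suMk _ _ hk with hκ
  have k00 : κ 0 0 = 1 / n := rfl
  have k01 : κ 0 1 = p / n := rfl
  have k10 : κ 1 0 = -conj p / n := by
    change -conj (p / n) = _
    rw [map_div₀, Complex.conj_ofReal, neg_div]
  have k11 : κ 1 1 = 1 / n := by
    change conj (1 / (n : ℂ)) = _
    simp
  filter_upwards [mem_littleGroup_of_SU2 h (suMk_mem _ _ hk)] with z hz
  rw [hz]
  have e1 : κ 1 0 * z + κ 1 1 = (1 - conj p * z) / n := by rw [k10, k11]; ring
  have e0 : κ 0 0 * z + κ 0 1 = (z + p) / n := by rw [k00, k01]; ring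
  rw [← hκ, spinPhase, mobius, e1, e0, map_div₀, Complex.conj_ofReal,
    div_div_div_cancel_right₀ hnc, div_div_div_cancel_right₀ hnc]
  rfl

/-- The centre `p` of the rotation `z ↦ (z + p) / (1 - p̄ z)` that takes `z` to `q`. -/
noncomputable def rotCenter (z q : ℂ) : ℂ :=
  ((q - z) - q * z * conj (q - z)) / (1 - ‖q * z‖ ^ 2 : ℝ)

/-- The condition `z + p = q (1 - p̄ z)` reads `p + q z p̄ = q - z`. This is real linear in `p`, and
eliminating `p̄` with the conjugate equation leaves the factor `1 - |q z|²`. -/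
theorem rotCenter_spec {z q : ℂ} (h : ‖q * z‖ ≠ 1) :
    1 - conj (rotCenter z q) * z ≠ 0 ∧
      (z + rotCenter z q) / (1 - conj (rotCenter z q) * z) = q := by
  have hD : (1 - ‖q * z‖ ^ 2 : ℝ) ≠ 0 := by
    intro h0
    apply h
    nlinarith [norm_nonneg (q * z)]
  have hDc : ((1 - ‖q * z‖ ^ 2 : ℝ) : ℂ) ≠ 0 := by exact_mod_cast hD
  have hDe : ((1 - ‖q * z‖ ^ 2 : ℝ) : ℂ) = 1 - q * z * (conj q * conj z) := by
    push_cast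
    rw [← Complex.mul_conj', map_mul]
  have e1 : conj (rotCenter z q) * (1 - ‖q * z‖ ^ 2 : ℝ) =
      conj (q - z) - conj q * conj z * (q - z) := by
    rw [rotCenter, map_div₀, Complex.conj_ofReal, div_mul_cancel₀ _ hDc]
    simp only [map_sub, map_mul, Complex.conj_conj]
  have e2 : rotCenter z q * (1 - ‖q * z‖ ^ 2 : ℝ) = (q - z) - q * z * conj (q - z) :=
    div_mul_cancel₀ _ hDc
  have e3 : rotCenter z q + q * z * conj (rotCenter z q) = q - z := by
    apply mul_right_cancel₀ hDc
    rw [add_mul, mul_assoc, e1, e2, hDe]; ring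
  have hne : 1 - conj (rotCenter z q) * z ≠ 0 := by
    intro h0
    have h1 : rotCenter z q = -z := by linear_combination e3 + q * h0
    rw [h1] at h0
    have h2 : ((1 + ‖z‖ ^ 2 : ℝ) : ℂ) = 0 := by
      push_cast
      rw [← Complex.conj_mul']
      rw [map_neg] at h0
      linear_combination h0
    have h3 : (1 + ‖z‖ ^ 2 : ℝ) = 0 := by exact_mod_cast h2
    nlinarith [sq_nonneg ‖z‖]
  refine ⟨hne, ?_⟩
  rw [div_eq_iff hne]
  linear_combination e3

theorem norm_rotPhase {p z : ℂ} (h : 1 - conj p * z ≠ 0) : ‖rotPhase p z‖ = 1 := by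
  have hn : ‖1 - conj p * z‖ ≠ 0 := by simpa using h
  rw [rotPhase, norm_div, RCLike.norm_conj, div_self hn]

/-- Transfers a null set of centres `p` to a null set of images `q`: differentiable maps of the
plane preserve null sets, and `|q z| = 1` is at most a circle. -/
theorem ae_rotCenter {z : ℂ} {P : ℂ → Prop} (h : ∀ᵐ p, P p) :
    ∀ᵐ q : ℂ, ‖q * z‖ ≠ 1 ∧ P (rotCenter z q) := by
  have h1 : ∀ᵐ q : ℂ, ‖q * z‖ ≠ 1 := by
    by_cases hz : z = 0
    · simp [hz]
    · have h2 : volume (Metric.sphere (0 : ℂ) ‖z‖⁻¹) = 0 := Measure.addHaar_sphere _ _ _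
      filter_upwards [measure_eq_zero_iff_ae_notMem.1 h2] with q hq hq1
      apply hq
      rw [mem_sphere_zero_iff_norm]
      rw [norm_mul] at hq1
      exact eq_inv_of_mul_eq_one_left hq1
  have h2 : volume ((fun p : ℂ => (z + p) / (1 - conj p * z)) ''
      ({p | ¬ P p} ∩ {p | 1 - conj p * z ≠ 0})) = 0 := by
    refine addHaar_image_eq_zero_of_differentiableOn_of_addHaar_eq_zero volume ?_
      (measure_mono_null Set.inter_subset_left h)
    intro p hp
    have hc : DifferentiableAt ℝ (fun p : ℂ => conj p) p := Complex.conjCLE.differentiableAt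
    have hd : DifferentiableAt ℝ (fun p : ℂ => 1 - conj p * z) p :=
      (differentiableAt_const 1).sub (hc.mul_const z)
    have hnum : DifferentiableAt ℝ (fun p : ℂ => z + p) p :=
      (differentiableAt_const z).add differentiableAt_id
    have := hnum.mul (hd.inv hp.2)
    exact (DifferentiableAt.congr_of_eventuallyEq this
      (Eventually.of_forall fun x => by simp [div_eq_mul_inv])).differentiableWithinAt
  filter_upwards [h1, measure_eq_zero_iff_ae_notMem.1 h2] with q hq hq2
  refine ⟨hq, ?_⟩
  by_contra hn
  obtain ⟨hne, he⟩ := rotCenter_spec hq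
  exact hq2 ⟨_, ⟨hn, hne⟩, he⟩

/-- Transitivity of `SU(2)` determines `φ` from its value at one good point `z`. For `s = 0` this
means that `φ` is constant. For `s ≠ 0` the resulting formula is continuous at `0`, a point fixed by
`Γ`, where a rotation multiplies the value by a nontrivial phase. -/
theorem SU2_le_littleGroup_iff (φ : WFun w s) :
    SU2 ≤ littleGroup φ ↔ φ = 0 ∨ (s = 0 ∧ IsConst φ) := by
  constructor
  · intro h
    have hm := measurable_fn φ
    have hcm : Measurable (fun z : ℂ => conj z) := Complex.continuous_conj.measurable
    have hmeas : MeasurableSet {p : ℂ × ℂ | φ.fn p.2 =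
        rotPhase p.1 p.2 ^ (-s) * φ.fn ((p.2 + p.1) / (1 - conj p.1 * p.2))} := by
      have hden : Measurable fun p : ℂ × ℂ => 1 - conj p.1 * p.2 :=
        measurable_const.sub ((hcm.comp measurable_fst).mul measurable_snd)
      refine measurableSet_eq_fun (by fun_prop) (Measurable.mul ?_ (hm.comp ?_))
      · exact ((hcm.comp hden).div hden).pow_const _
      · exact (measurable_snd.add measurable_fst).div hden
    have h2 := (Measure.ae_ae_comm (μ := (volume : Measure ℂ)) (ν := (volume : Measure ℂ))
      (p := fun p z => φ.fn z = rotPhase p z ^ (-s) * φ.fn ((z + p) / (1 - conj p * z))) hmeas).1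
      (Eventually.of_forall fun p => ae_eq_of_SU2_le h p)
    -- For fixed `z` the free parameter is changed from the rotation to the image point `q` of `z`.
    have h3 : ∀ᵐ z, ∀ᵐ q, φ.fn q = rotPhase (rotCenter z q) z ^ s * φ.fn z := by
      filter_upwards [h2] with z hz
      filter_upwards [ae_rotCenter (z := z) hz] with q hq
      obtain ⟨hne, he⟩ := rotCenter_spec hq.1
      have hq2 := hq.2
      rw [he] at hq2
      have hph : rotPhase (rotCenter z q) z ≠ 0 := by
        rw [← norm_ne_zero_iff, norm_rotPhase hne]; exact one_ne_zero
      rw [hq2, ← mul_assoc, ← zpow_add₀ hph]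
      simp
    by_cases hs : s = 0
    · right
      refine ⟨hs, ?_⟩
      obtain ⟨z, hz⟩ := h3.exists
      refine ⟨φ.fn z, ae_sphere ?_⟩
      filter_upwards [hz] with q hq
      rw [hq, hs]; simp
    · left
      rw [eq_zero_iff_ae]
      refine ae_sphere ?_
      -- The angle `π / s` is chosen so that the spin phase is `-1`.
      have hΓ := (Gam_le_littleGroup_iff φ).1 (Gam_le_SU2.trans h) (Real.pi / s)
      set ε : ℂ := Complex.exp (-(((Real.pi / s : ℝ) : ℂ) * Complex.I)) with hε
      have hεn : ‖ε‖ = 1 := by rw [hε, Complex.norm_exp]; simp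
      have hm1 : Complex.exp (s * (((Real.pi / s : ℝ) : ℂ) * Complex.I)) = -1 := by
        have : (s : ℂ) * (((Real.pi / s : ℝ) : ℂ) * Complex.I) = Real.pi * Complex.I := by
          have : (s : ℂ) ≠ 0 := by exact_mod_cast hs
          push_cast; field_simp
        rw [this, Complex.exp_pi_mul_I]
      filter_upwards [h3] with z hz
      set F : ℂ → ℂ := fun q => rotPhase (rotCenter z q) z ^ s * φ.fn z with hF
      have hz2 := ae_of_ae_sphere
        ((quasiMeasurePreserving_mobius (rotZ (Real.pi / s))).ae (ae_sphere hz))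
      simp only [mobius_rotZ, ← hε] at hz2
      have hG : ∀ᵐ q, F q + F (ε * q) = 0 := by
        filter_upwards [hz, hz2, hΓ] with q h1 h2 h3
        rw [hm1, h1, h2] at h3
        simp only [hF]
        rw [h3]; ring
      have hr0 : rotCenter z 0 = -z := by simp [rotCenter]
      have hne0 : 1 - conj (rotCenter z 0) * z ≠ 0 := (rotCenter_spec (q := 0) (by simp)).1
      have hcent : ContinuousAt (rotCenter z) 0 := by
        unfold rotCenter
        refine ContinuousAt.div (Continuous.continuousAt (by fun_prop))
          (Continuous.continuousAt (by fun_prop)) (by simp)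
      have hden : ContinuousAt (fun q => 1 - conj (rotCenter z q) * z) 0 :=
        continuousAt_const.sub (((Complex.continuous_conj.continuousAt).comp hcent).mul
          continuousAt_const)
      have hFc : ContinuousAt F 0 := by
        refine ContinuousAt.mul (ContinuousAt.zpow₀ ?_ _ (Or.inl ?_)) continuousAt_const
        · exact ((Complex.continuous_conj.continuousAt).comp hden).div hden hne0
        · rw [← norm_ne_zero_iff, norm_rotPhase hne0]; exact one_ne_zero
      have hGc : ContinuousAt (fun q => F q + F (ε * q)) 0 := by
        have h0 : ContinuousAt F (ε * 0) := by rwa [mul_zero]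
        exact hFc.add (h0.comp (f := fun q => ε * q) (Continuous.continuousAt (by fun_prop)))
      -- An almost everywhere identity holds on a dense set, hence at a point of continuity. At `q =
      -- 0` it reads `2 F(0) = 0`, and `F(0)` is `φ(z)` times a phase.
      have hG0 : F 0 + F (ε * 0) = 0 := by
        by_contra hne
        have hev := hGc.eventually_ne hne
        have hd := Measure.dense_of_ae hG
        have hfr := mem_closure_iff_frequently.1 (hd 0)
        obtain ⟨q, hq1, hq2⟩ := (hfr.and_eventually hev).exists
        exact hq2 hq1
      rw [mul_zero, ← two_mul, mul_eq_zero, or_iff_right two_ne_zero] at hG0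
      refine (mul_eq_zero.1 hG0).resolve_left (zpow_ne_zero _ ?_)
      rw [← norm_ne_zero_iff, norm_rotPhase hne0]; exact one_ne_zero
  · rintro (rfl | ⟨hs, c, hc⟩) κ hκ
    · exact smul_zero' κ
    · rw [MulAction.mem_stabilizer_iff, smul_eq_iff_ae]
      refine (pullback_congr w s κ⁻¹ hc).trans (EventuallyEq.trans ?_ hc.symm)
      refine Eventually.of_forall fun z => ?_
      simp [pullback, confFactor_of_mem_SU2 (SU2.inv_mem hκ), hs]

/-- The equation `|az + b|² + |cz + d|² = 1 + |z|²` is evaluated at `0`, `±ρ` and `iρ`. These four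
points determine all coefficients, which say that the columns are orthonormal. -/
theorem mem_SU2_of_confFactor {Λ : SL2C} {r : ℝ} (hr : 0 < r)
    (h : ∀ z, ‖z‖ < r → confFactor Λ z = 1) : Λ ∈ SU2 := by
  set a := Λ 0 0
  set b := Λ 0 1
  set c := Λ 1 0
  set d := Λ 1 1
  have hd : a * d - b * c = 1 := det_eq Λ
  have h' : ∀ z, ‖z‖ < r → (a * z + b) * (conj a * conj z + conj b) +
      (c * z + d) * (conj c * conj z + conj d) = 1 + z * conj z := by
    intro z hz
    have h1 := h z hz
    rw [confFactor, div_eq_one_iff_eq (denom_pos Λ z).ne'] at h1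
    have h2 : ((1 + ‖z‖ ^ 2 : ℝ) : ℂ) = ((‖a * z + b‖ ^ 2 + ‖c * z + d‖ ^ 2 : ℝ) : ℂ) := by
      exact_mod_cast h1
    push_cast at h2
    simp only [← Complex.mul_conj', map_add, map_mul] at h2
    exact h2.symm
  have hρ : (0 : ℝ) < r / 2 := by positivity
  set ρ : ℂ := ((r / 2 : ℝ) : ℂ) with hρd
  have hρ0 : ρ ≠ 0 := by rw [hρd]; exact_mod_cast hρ.ne'
  have hρn : ‖ρ‖ < r := by rw [hρd, Complex.norm_real, Real.norm_of_nonneg hρ.le]; linarith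
  have hρc : conj ρ = ρ := Complex.conj_ofReal _
  have z0 := h' 0 (by simpa using hr)
  have z1 := h' ρ hρn
  have z2 := h' (-ρ) (by simpa using hρn)
  have z3 := h' (Complex.I * ρ) (by simpa using hρn)
  simp only [map_zero, map_neg, map_mul, Complex.conj_I, hρc, mul_zero, zero_add, add_zero] at z0 z1 z2 z3
  have hI : Complex.I ^ 2 = -1 := Complex.I_sq
  have e1 : a * conj a + c * conj c = 1 := by
    have : 2 * ρ ^ 2 * (a * conj a + c * conj c - 1) = 0 := by
      linear_combination z1 + z2 - 2 * z0
    have h2 : 2 * ρ ^ 2 ≠ 0 := mul_ne_zero two_ne_zero (pow_ne_zero 2 hρ0)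
    exact sub_eq_zero.1 ((mul_eq_zero.1 this).resolve_left h2)
  have e2 : (a * conj b + c * conj d) + (conj a * b + conj c * d) = 0 := by
    have : ρ * ((a * conj b + c * conj d) + (conj a * b + conj c * d)) = 0 := by
      linear_combination (z1 - z2) / 2
    exact (mul_eq_zero.1 this).resolve_left hρ0
  have e3 : (a * conj b + c * conj d) - (conj a * b + conj c * d) = 0 := by
    have : Complex.I * ρ * ((a * conj b + c * conj d) - (conj a * b + conj c * d)) = 0 := by
      linear_combination z3 - z0 - ρ ^ 2 * e1 + ρ ^ 2 * (a * conj a + c * conj c - 1) * hI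
    exact (mul_eq_zero.1 this).resolve_left (mul_ne_zero Complex.I_ne_zero hρ0)
  have e4 : a * conj b + c * conj d = 0 := by linear_combination (e2 + e3) / 2
  have e5 : conj a * b + conj c * d = 0 := by linear_combination (e2 - e3) / 2
  rw [mem_SU2_iff]
  constructor
  · change d = conj a
    linear_combination -d * e1 + c * e5 + conj a * hd
  · change c = -conj b
    linear_combination -c * z0 + d * e4 - conj b * hd

theorem continuous_confFactor (Λ : SL2C) : Continuous (confFactor Λ) := by
  unfold confFactor
  exact Continuous.div (by fun_prop) (by fun_prop) fun z => (denom_pos Λ z).ne'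

theorem mem_SU2_of_ae_confFactor {Λ : SL2C} {r : ℝ} (hr : 0 < r)
    (h : ∀ᵐ z, ‖z‖ < r → confFactor Λ z = 1) : Λ ∈ SU2 := by
  refine mem_SU2_of_confFactor hr fun z hz => ?_
  have hd := Measure.dense_of_ae h
  have h1 := hd.open_subset_closure_inter (Metric.isOpen_ball (x := (0 : ℂ)) (ε := r))
    (show z ∈ Metric.ball (0 : ℂ) r by simpa using hz)
  refine (isClosed_eq (continuous_confFactor Λ) continuous_const).closure_subset_iff.2 ?_ h1
  rintro x ⟨hx1, hx2⟩
  exact hx2 (by simpa using hx1)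

/-- The exponent is at least one, in particular nonzero. For `w = 0` the conformal factor would not
be seen at all. -/
theorem rpow_neg_eq_one (hw : w ≤ -1) {x : ℝ} (hx : 0 < x) (h : x ^ (-w) = 1) : x = 1 :=
  (Real.rpow_left_inj hx.le zero_le_one (by linarith)).1 (h.trans (Real.one_rpow _).symm)

theorem littleGroup_of_isConst (hw : w ≤ -1) {φ : WFun w s} (hs : s = 0) (hφ : φ ≠ 0)
    (hc : IsConst φ) : littleGroup φ = SU2 := by
  refine le_antisymm (fun Λ hΛ => ?_) ((SU2_le_littleGroup_iff φ).2 (Or.inr ⟨hs, hc⟩))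
  obtain ⟨c, hc⟩ := hc
  have hc0 : c ≠ 0 := by
    rintro rfl
    exact hφ (eq_zero_iff_ae.2 hc)
  rw [MulAction.mem_stabilizer_iff, smul_eq_iff_ae] at hΛ
  have h1 := ae_of_ae_sphere ((pullback_congr w s Λ⁻¹ hc).symm.trans (hΛ.trans hc))
  rw [← inv_inv Λ]
  refine SU2.inv_mem (mem_SU2_of_ae_confFactor one_pos ?_)
  filter_upwards [h1] with z hz _
  rw [pullback, hs, neg_zero, zpow_zero, mul_one] at hz
  have h2 := mul_right_cancel₀ hc0 (hz.trans (one_mul c).symm)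
  exact rpow_neg_eq_one hw (confFactor_pos _ _) (by exact_mod_cast h2)

/-! ### A function with little group `Γ` -/

/-- `e^{i s arg z}` on the disc `|z| < 1/2`. -/
noncomputable def discFun (s : ℤ) (z : ℂ) : ℂ :=
  Complex.exp (Complex.I * s * Complex.arg z) * (Set.Iio (1 / 2 : ℝ)).indicator (fun _ => 1) ‖z‖

theorem norm_discFun (s : ℤ) (z : ℂ) :
    ‖discFun s z‖ = (Set.Iio (1 / 2 : ℝ)).indicator (fun _ => 1) ‖z‖ := by
  rw [discFun, norm_mul, show Complex.I * s * Complex.arg z =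
    ((s * Complex.arg z : ℝ) : ℂ) * Complex.I by push_cast; ring, Complex.norm_exp_ofReal_mul_I,
    one_mul]
  by_cases h : ‖z‖ ∈ Set.Iio (1 / 2 : ℝ)
  · rw [Set.indicator_of_mem h, Set.indicator_of_mem h, norm_one]
  · rw [Set.indicator_of_notMem h, Set.indicator_of_notMem h, norm_zero]

theorem memLp_discFun (s : ℤ) : MemLp (discFun s) 2 sphereMeasure := by
  refine MemLp.of_bound (C := 1) ?_ (Eventually.of_forall fun z => ?_)
  · refine Measurable.aestronglyMeasurable (Measurable.mul (by fun_prop) ?_)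
    exact (measurable_const.indicator measurableSet_Iio).comp measurable_norm
  · rw [norm_discFun]
    exact Set.indicator_le_self' (fun _ _ => zero_le_one) _

/-- The modulus is one on the disc and zero outside it. A transformation in the little group must
therefore preserve the disc and have `ϖ = 1` on it. The second condition puts it in `SU(2)`, and a
rotation that preserves a disc about the origin other than a hemisphere is a rotation about the
axis. -/
theorem littleGroup_discFun (hw : w ≤ -1) :
    littleGroup (ofFun w s (discFun s) (memLp_discFun s)) = Gam := by
  set φ := ofFun w s (discFun s) (memLp_discFun s) with hφ
  refine le_antisymm (fun Λ hΛ => ?_) ((Gam_le_littleGroup_iff_isAxisymmetric φ).2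
    ⟨_, fn_ofFun (memLp_discFun s)⟩)
  rw [MulAction.mem_stabilizer_iff, smul_eq_iff_ae] at hΛ
  have h1 := ae_of_ae_sphere ((pullback_congr w s Λ⁻¹ (fn_ofFun (memLp_discFun s))).symm.trans
    (hΛ.trans (fn_ofFun (memLp_discFun s))))
  rw [← inv_inv Λ]
  set M := Λ⁻¹
  have h2 : ∀ᵐ z, M 1 0 * z + M 1 1 ≠ 0 ∧ confFactor M z ^ (-w) *
      (Set.Iio (1 / 2 : ℝ)).indicator (fun _ => (1 : ℝ)) ‖mobius M z‖ =
      (Set.Iio (1 / 2 : ℝ)).indicator (fun _ => 1) ‖z‖ := by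
    filter_upwards [h1, ae_denom_ne M] with z hz hz2
    have := congrArg norm hz
    rw [norm_pullback M _ hz2, norm_discFun, norm_discFun] at this
    exact ⟨hz2, this⟩
  have hin : ∀ᵐ z, ‖z‖ < 1 / 2 → confFactor M z = 1 ∧
      ‖M 0 0 * z + M 0 1‖ ^ 2 - 1 / 4 * ‖M 1 0 * z + M 1 1‖ ^ 2 ≤ 0 := by
    filter_upwards [h2] with z hz hzn
    obtain ⟨hne, hz⟩ := hz
    rw [Set.indicator_of_mem (show ‖z‖ ∈ Set.Iio (1 / 2 : ℝ) from hzn)] at hz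
    by_cases hm : ‖mobius M z‖ ∈ Set.Iio (1 / 2 : ℝ)
    · rw [Set.indicator_of_mem hm, mul_one] at hz
      refine ⟨rpow_neg_eq_one hw (confFactor_pos _ _) hz, ?_⟩
      have hp : 0 < ‖M 1 0 * z + M 1 1‖ := norm_pos_iff.2 hne
      rw [Set.mem_Iio, mobius, norm_div, div_lt_iff₀ hp] at hm
      nlinarith [norm_nonneg (M 0 0 * z + M 0 1)]
    · rw [Set.indicator_of_notMem hm] at hz
      simp at hz
  have hout : ∀ᵐ z, 1 / 2 < ‖z‖ →
      0 ≤ ‖M 0 0 * z + M 0 1‖ ^ 2 - 1 / 4 * ‖M 1 0 * z + M 1 1‖ ^ 2 := by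
    filter_upwards [h2] with z hz hzn
    obtain ⟨hne, hz⟩ := hz
    rw [Set.indicator_of_notMem (show ‖z‖ ∉ Set.Iio (1 / 2 : ℝ) from not_lt.2 hzn.le)] at hz
    by_cases hm : ‖mobius M z‖ ∈ Set.Iio (1 / 2 : ℝ)
    · rw [Set.indicator_of_mem hm, mul_one] at hz
      exact absurd hz (Real.rpow_pos_of_pos (confFactor_pos _ _) _).ne'
    · have hp : 0 < ‖M 1 0 * z + M 1 1‖ := norm_pos_iff.2 hne
      rw [Set.mem_Iio, mobius, norm_div, not_lt, le_div_iff₀ hp] at hm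
      nlinarith [norm_nonneg (M 0 0 * z + M 0 1)]
  have hM : M ∈ SU2 := mem_SU2_of_ae_confFactor (r := 1 / 2) (by norm_num)
    (hin.mono fun z h hz => (h hz).1)
  refine Gam.inv_mem (eq_rotZ_of_apply_eq_zero hM ?_)
  have hcont : Continuous fun z : ℂ =>
      ‖M 0 0 * z + M 0 1‖ ^ 2 - 1 / 4 * ‖M 1 0 * z + M 1 1‖ ^ 2 := by fun_prop
  have hle : ∀ z : ℂ, ‖z‖ = 1 / 2 →
      ‖M 0 0 * z + M 0 1‖ ^ 2 - 1 / 4 * ‖M 1 0 * z + M 1 1‖ ^ 2 ≤ 0 := by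
    intro z hz
    have hd := (Measure.dense_of_ae hin).open_subset_closure_inter
      (Metric.isOpen_ball (x := (0 : ℂ)) (ε := 1 / 2))
    have hz' : z ∈ closure (Metric.ball (0 : ℂ) (1 / 2)) := by
      rw [closure_ball _ (by norm_num)]; simpa using hz.le
    have := closure_minimal hd isClosed_closure hz'
    refine (isClosed_le hcont continuous_const).closure_subset_iff.2 ?_ this
    rintro x ⟨hx1, hx2⟩
    exact (hx2 (by simpa using hx1)).2
  have hge : ∀ z : ℂ, ‖z‖ = 1 / 2 →
      0 ≤ ‖M 0 0 * z + M 0 1‖ ^ 2 - 1 / 4 * ‖M 1 0 * z + M 1 1‖ ^ 2 := by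
    intro z hz
    have hd := (Measure.dense_of_ae hout).open_subset_closure_inter
      (Metric.isClosed_closedBall (x := (0 : ℂ)) (ε := 1 / 2)).isOpen_compl
    have hz' : z ∈ closure (Metric.closedBall (0 : ℂ) (1 / 2))ᶜ := by
      rw [closure_compl, interior_closedBall _ (by norm_num)]; simp [hz]
    have := closure_minimal hd isClosed_closure hz'
    refine (isClosed_le continuous_const hcont).closure_subset_iff.2 ?_ this
    rintro x ⟨hx1, hx2⟩
    exact hx2 (by simpa using hx1)
  have hn : ‖(1 / 2 : ℂ)‖ = 1 / 2 := by norm_num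
  have g1 := le_antisymm (hle (1 / 2) hn) (hge (1 / 2) hn)
  have g2 := le_antisymm (hle (-(1 / 2)) (by rw [norm_neg, hn])) (hge (-(1 / 2)) (by rw [norm_neg, hn]))
  obtain ⟨hM1, hM2⟩ := mem_SU2_iff.1 hM
  -- Adding the boundary condition at `1/2` and `-1/2` removes the cross terms. The sum forces `M₀₁
  -- = 0` because the radius is not `1`; for a hemisphere it would be an identity.
  have par : ∀ x y : ℂ, ‖x * (1 / 2) + y‖ ^ 2 + ‖x * (-(1 / 2)) + y‖ ^ 2 =
      ‖x‖ ^ 2 / 2 + 2 * ‖y‖ ^ 2 := by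
    intro x y
    have := parallelogram_law_with_norm ℝ (x * (1 / 2)) y
    have e : ‖x * (-(1 / 2)) + y‖ = ‖x * (1 / 2) - y‖ := by
      rw [← norm_neg]; congr 1; ring
    rw [norm_mul, hn] at this
    rw [e]
    nlinarith
  have p1 := par (M 0 0) (M 0 1)
  have p2 := par (M 1 0) (M 1 1)
  rw [hM1, hM2] at p2
  simp only [norm_neg, RCLike.norm_conj] at p2
  rw [hM1, hM2] at g1 g2
  have : ‖M 0 1‖ ^ 2 = 0 := by linarith
  simpa using this

end Invariant

end WeightedSphere

namespace WeightedSphere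

/-! ### The identity component -/

section Component

theorem mem_map_conj {H : Subgroup SL2C} {g x : SL2C} :
    x ∈ H.map (MulAut.conj g).toMonoidHom ↔ g⁻¹ * x * g ∈ H := by
  rw [Subgroup.mem_map]
  constructor
  · rintro ⟨y, hy, rfl⟩
    simpa [mul_assoc] using hy
  · intro h
    exact ⟨_, h, by simp [mul_assoc]⟩

theorem map_conj_map_conj (H : Subgroup SL2C) (g h : SL2C) :
    (H.map (MulAut.conj h).toMonoidHom).map (MulAut.conj g).toMonoidHom =
      H.map (MulAut.conj (g * h)).toMonoidHom := by
  ext x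
  simp only [mem_map_conj, mul_inv_rev, mul_assoc]

theorem map_conj_one (H : Subgroup SL2C) : H.map (MulAut.conj (1 : SL2C)).toMonoidHom = H := by
  ext x
  simp

theorem eq_map_conj_iff {G H : Subgroup SL2C} {g : SL2C} :
    G = H.map (MulAut.conj g).toMonoidHom ↔ G.map (MulAut.conj g⁻¹).toMonoidHom = H := by
  constructor
  · rintro rfl
    rw [map_conj_map_conj, inv_mul_cancel, map_conj_one]
  · rintro rfl
    rw [map_conj_map_conj, mul_inv_cancel, map_conj_one]

theorem coe_map_conj (H : Subgroup SL2C) (g : SL2C) :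
    ((H.map (MulAut.conj g).toMonoidHom : Subgroup SL2C) : Set SL2C) =
      ((Homeomorph.mulLeft g).trans (Homeomorph.mulRight g⁻¹)) '' (H : Set SL2C) := by
  ext x
  simp

theorem isPreconnected_map_conj {H : Subgroup SL2C} (hH : IsPreconnected (H : Set SL2C))
    (g : SL2C) :
    IsPreconnected ((H.map (MulAut.conj g).toMonoidHom : Subgroup SL2C) : Set SL2C) := by
  rw [coe_map_conj]
  exact hH.image _ (Homeomorph.continuous _).continuousOn

theorem isClosed_map_conj {H : Subgroup SL2C} (hH : IsClosed (H : Set SL2C)) (g : SL2C) :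
    IsClosed ((H.map (MulAut.conj g).toMonoidHom : Subgroup SL2C) : Set SL2C) := by
  rw [coe_map_conj]
  exact (Homeomorph.isClosed_image _).2 hH

variable {w : ℝ} {s : ℤ}

theorem map_conj_le_littleGroup_iff {H : Subgroup SL2C} {g : SL2C} {φ : WFun w s} :
    H.map (MulAut.conj g).toMonoidHom ≤ littleGroup φ ↔ H ≤ littleGroup (g⁻¹ • φ) := by
  constructor
  · intro h x hx
    have h1 := h (mem_map_conj.2 (show g⁻¹ * (g * x * g⁻¹) * g ∈ H by simpa [mul_assoc] using hx))
    rw [MulAction.mem_stabilizer_iff] at h1 ⊢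
    rw [eq_inv_smul_iff]
    simpa only [mul_smul] using h1
  · intro h x hx
    have h1 := h (mem_map_conj.1 hx)
    rw [MulAction.mem_stabilizer_iff, smul_smul, mul_assoc, mul_inv_cancel, mul_one, mul_smul,
      smul_left_cancel_iff] at h1
    exact h1

theorem littleGroupIdComponent_le (φ : WFun w s) : littleGroupIdComponent φ ≤ littleGroup φ :=
  Subgroup.map_subtype_le _

theorem coe_littleGroupIdComponent (φ : WFun w s) :
    (littleGroupIdComponent φ : Set SL2C) =
      Subtype.val '' (connectedComponent (1 : littleGroup φ)) := rfl

theorem isPreconnected_littleGroupIdComponent (φ : WFun w s) :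
    IsPreconnected (littleGroupIdComponent φ : Set SL2C) := by
  rw [coe_littleGroupIdComponent]
  exact isPreconnected_connectedComponent.image _ continuous_subtype_val.continuousOn

theorem isClosed_littleGroupIdComponent (φ : WFun w s) :
    IsClosed (littleGroupIdComponent φ : Set SL2C) := by
  rw [coe_littleGroupIdComponent]
  exact (isClosed_littleGroup φ).isClosedEmbedding_subtypeVal.isClosedMap _
    isClosed_connectedComponent

theorem le_littleGroupIdComponent {φ : WFun w s} {G : Subgroup SL2C} (hG : G ≤ littleGroup φ)
    (hc : IsPreconnected (G : Set SL2C)) : G ≤ littleGroupIdComponent φ := by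
  intro g hg
  have h1 : IsPreconnected ((Subtype.val : littleGroup φ → SL2C) ⁻¹' (G : Set SL2C)) := by
    rw [← IsInducing.subtypeVal.isPreconnected_image]
    have e : (Subtype.val : littleGroup φ → SL2C) '' (Subtype.val ⁻¹' (G : Set SL2C)) = G :=
      Set.image_preimage_eq_of_subset fun x hx => ⟨⟨x, hG hx⟩, rfl⟩
    convert hc
    exact e
  have h2 := h1.subset_connectedComponent (x := (1 : littleGroup φ)) G.one_mem
  exact ⟨⟨g, hG hg⟩, h2 hg, rfl⟩

theorem littleGroupIdComponent_eq {φ : WFun w s} (hc : IsPreconnected (littleGroup φ : Set SL2C)) :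
    littleGroupIdComponent φ = littleGroup φ :=
  le_antisymm (littleGroupIdComponent_le φ) (le_littleGroupIdComponent le_rfl hc)

/-- Conjugate by `h` to land in `SU(2)`, and then by `κ` to make the circle subgroup equal to `Γ`.
Beyond `Γ` there is only `SU(2)` itself. -/
theorem idComponent_trichotomy (hw : w ≤ -1) {φ : WFun w s} (hφ : φ ≠ 0) :
    littleGroupIdComponent φ = ⊥ ∨ IsConjSubgroup (littleGroupIdComponent φ) Gam ∨
      IsConjSubgroup (littleGroupIdComponent φ) SU2 := by
  set G := littleGroupIdComponent φ with hGdef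
  have hGc := isPreconnected_littleGroupIdComponent φ
  have hGcl := isClosed_littleGroupIdComponent φ
  obtain ⟨h, hh⟩ := exists_conj_mem_SU2 (isCompact_littleGroup hw hφ)
  by_cases hb : G = ⊥
  · exact Or.inl hb
  right
  set G' := G.map (MulAut.conj h⁻¹).toMonoidHom with hG'
  have hG'le : G' ≤ SU2 := by
    rintro _ ⟨g, hg, rfl⟩
    simpa using hh g (littleGroupIdComponent_le φ hg)
  have hG'ne : G' ≠ ⊥ := by
    intro h0
    apply hb
    have := eq_map_conj_iff.2 h0
    simpa using this
  obtain ⟨κ, hκ, hκG⟩ := exists_conj_Gam_le hG'le (isPreconnected_map_conj hGc _)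
    (isClosed_map_conj hGcl _) hG'ne
  set G'' := G'.map (MulAut.conj κ⁻¹).toMonoidHom with hG''
  have hΓ : Gam ≤ G'' := by
    rintro _ ⟨x, rfl⟩
    rw [hG'', mem_map_conj, inv_inv]
    exact hκG x
  have hG''le : G'' ≤ SU2 := by
    rintro _ ⟨g, hg, rfl⟩
    simpa using SU2.mul_mem (SU2.mul_mem (SU2.inv_mem hκ) (hG'le hg)) hκ
  have hconj : G = G''.map (MulAut.conj (h * κ)).toMonoidHom := by
    rw [eq_map_conj_iff, hG'', hG', map_conj_map_conj, mul_inv_rev]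
  by_cases he : G'' = Gam
  · exact Or.inl ⟨h * κ, he ▸ hconj⟩
  · have := SU2_le_of_Gam_lt hG''le
      (isPreconnected_map_conj (isPreconnected_map_conj hGc _) _) hΓ he
    exact Or.inr ⟨h * κ, (le_antisymm hG''le this) ▸ hconj⟩

theorem Gam_comm {x y : SL2C} (hx : x ∈ Gam) (hy : y ∈ Gam) : x * y = y * x := by
  obtain ⟨a, rfl⟩ := hx
  obtain ⟨b, rfl⟩ := hy
  rw [← rotZ_add, ← rotZ_add, add_comm]

/-- Noncommutativity distinguishes conjugates of `SU(2)` from conjugates of `Γ`. -/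
theorem SU2_not_comm : ∃ x ∈ SU2, ∃ y ∈ SU2, x * y ≠ y * x := by
  refine ⟨rotZ Real.pi, rotZ_mem_SU2 _, rotY Real.pi, rotY_mem_SU2 _, fun h => ?_⟩
  have h1 := congrArg (fun Λ : SL2C => Λ 1 0) h
  simp only [mul_apply', rotZ_apply_zero_zero, rotZ_apply_one_zero, rotZ_apply_one_one,
    rotY_apply_zero_zero, rotY_apply_one_zero, rotY_apply_one_one, Real.sin_pi_div_two,
    Real.cos_pi_div_two, Complex.ofReal_one, Complex.ofReal_zero, zero_mul, mul_one, one_mul,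
    add_zero, zero_add] at h1
  have e : Complex.I * (Real.pi : ℂ) / 2 = Real.pi / 2 * Complex.I := by ring
  rw [e, Complex.exp_neg, Complex.exp_pi_div_two_mul_I, Complex.inv_I] at h1
  have h2 := congrArg Complex.im h1
  norm_num at h2

theorem not_isConj_Gam_SU2 {G : Subgroup SL2C} (h1 : IsConjSubgroup G Gam)
    (h2 : IsConjSubgroup G SU2) : False := by
  obtain ⟨g, hg⟩ := h1
  obtain ⟨h, hh⟩ := h2
  obtain ⟨x, hx, y, hy, hxy⟩ := SU2_not_comm
  have hmem : ∀ z ∈ SU2, g⁻¹ * (h * z * h⁻¹) * g ∈ Gam := by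
    intro z hz
    rw [← mem_map_conj, ← hg, hh, mem_map_conj]
    simpa [mul_assoc] using hz
  have hc := Gam_comm (hmem x hx) (hmem y hy)
  apply hxy
  have e1 : ∀ a b : SL2C, g⁻¹ * (h * a * h⁻¹) * g * (g⁻¹ * (h * b * h⁻¹) * g) =
      g⁻¹ * (h * (a * b) * h⁻¹) * g := fun a b => by group
  rw [e1, e1] at hc
  simpa using hc

theorem boostZ_notMem_SU2 {t : ℝ} (ht : t ≠ 0) : boostZ t ∉ SU2 := fun h =>
  ht (tri_mem_SU2_iff (ζ := 0).1 h).1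

theorem SU2_ne_top : SU2 ≠ ⊤ := fun h =>
  boostZ_notMem_SU2 one_ne_zero (h ▸ Subgroup.mem_top (boostZ 1))

theorem not_isConj_top_SU2 : ¬ IsConjSubgroup ⊤ SU2 := by
  rintro ⟨g, hg⟩
  rw [eq_map_conj_iff] at hg
  apply SU2_ne_top
  rw [← hg, eq_top_iff]
  intro x _
  exact mem_map_conj.2 trivial

theorem not_isConj_top_Gam : ¬ IsConjSubgroup ⊤ Gam := by
  rintro ⟨g, hg⟩
  rw [eq_map_conj_iff] at hg
  apply SU2_ne_top
  rw [eq_top_iff]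
  intro x _
  apply Gam_le_SU2
  rw [← hg]
  exact mem_map_conj.2 trivial

theorem rotZ_pi_ne_one : rotZ Real.pi ∉ Z2 := by
  have e : Complex.I * (Real.pi : ℂ) / 2 = Real.pi / 2 * Complex.I := by ring
  have h11 : rotZ Real.pi 1 1 = Complex.I := by
    rw [rotZ_apply_one_one, e, Complex.exp_pi_div_two_mul_I]
  rintro (h | h)
  · rw [h] at h11
    have := congrArg Complex.re h11
    simp at this
  · rw [show rotZ Real.pi = -1 from h] at h11
    have := congrArg Complex.re h11
    simp at this

theorem neg_one_ne_one : (-1 : SL2C) ≠ 1 := by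
  intro h
  have := congrArg (fun Λ : SL2C => (Λ 0 0).re) h
  norm_num at this

theorem map_conj_Gam_not_le_Z2 (g : SL2C) : ¬ Gam.map (MulAut.conj g).toMonoidHom ≤ Z2 := by
  intro h
  have h1 : g * rotZ Real.pi * g⁻¹ ∈ Z2 :=
    h (mem_map_conj.2 (by simpa [mul_assoc] using rotZ_mem_Gam Real.pi))
  apply rotZ_pi_ne_one
  rcases h1 with h1 | h1
  · left
    rw [mul_inv_eq_iff_eq_mul, one_mul] at h1
    exact mul_left_cancel (h1.trans (mul_one g).symm)
  · right
    have h2 : g * rotZ Real.pi * g⁻¹ = -1 := h1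
    rw [mul_inv_eq_iff_eq_mul, neg_mul, one_mul] at h2
    exact mul_left_cancel (h2.trans (by simp))

theorem isAxisymmetricUpToLorentz_iff {φ : WFun w s} : IsAxisymmetricUpToLorentz φ ↔
    ∃ g : SL2C, Gam.map (MulAut.conj g).toMonoidHom ≤ littleGroup φ := by
  constructor
  · rintro ⟨Λ, h⟩
    refine ⟨Λ⁻¹, map_conj_le_littleGroup_iff.2 ?_⟩
    rw [inv_inv]
    exact (Gam_le_littleGroup_iff_isAxisymmetric _).2 h
  · rintro ⟨g, h⟩
    exact ⟨g⁻¹, (Gam_le_littleGroup_iff_isAxisymmetric _).1 (map_conj_le_littleGroup_iff.1 h)⟩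

theorem littleGroup_of_isConstUpToLorentz (hw : w ≤ -1) {φ : WFun w s} (hφ : φ ≠ 0)
    (hc : IsConstUpToLorentz φ) : IsConjSubgroup (littleGroup φ) SU2 := by
  obtain ⟨hs, Λ, hΛ⟩ := hc
  have h1 := littleGroup_of_isConst hw hs (fun h => hφ (smul_eq_zero_iff'.1 h)) hΛ
  refine ⟨Λ⁻¹, ?_⟩
  rw [eq_map_conj_iff, inv_inv, ← h1]
  exact (MulAction.stabilizer_smul_eq_stabilizer_map_conj Λ φ).symm

theorem isConstUpToLorentz_of_map_conj {φ : WFun w s} (hφ : φ ≠ 0) {g : SL2C}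
    (h : SU2.map (MulAut.conj g).toMonoidHom ≤ littleGroup φ) : IsConstUpToLorentz φ := by
  rw [map_conj_le_littleGroup_iff, SU2_le_littleGroup_iff] at h
  rcases h with h | ⟨hs, h⟩
  · exact absurd (smul_eq_zero_iff'.1 h) hφ
  · exact ⟨hs, _, h⟩

theorem littleGroupIdComponent_of_isConstUpToLorentz (hw : w ≤ -1) {φ : WFun w s} (hφ : φ ≠ 0)
    (hc : IsConstUpToLorentz φ) : IsConjSubgroup (littleGroupIdComponent φ) SU2 := by
  have h := littleGroup_of_isConstUpToLorentz hw hφ hc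
  rw [littleGroupIdComponent_eq]
  · exact h
  · obtain ⟨g, hg⟩ := h
    rw [hg]
    exact isPreconnected_map_conj isConnected_SU2.isPreconnected g

theorem littleGroup_eq_top_iff (hw : w ≤ -1) (φ : WFun w s) : littleGroup φ = ⊤ ↔ φ = 0 := by
  constructor
  · intro h
    by_contra hφ
    have h1 := (SU2_le_littleGroup_iff φ).1 (h ▸ le_top)
    obtain ⟨hs, hc⟩ := h1.resolve_left hφ
    exact SU2_ne_top ((littleGroup_of_isConst hw hs hφ hc).symm.trans h)
  · rintro rfl; exact littleGroup_zero

theorem littleGroupIdComponent_zero : littleGroupIdComponent (0 : WFun w s) = ⊤ := by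
  rw [littleGroupIdComponent_eq, littleGroup_zero]
  rw [littleGroup_zero]
  exact isPreconnected_univ

theorem idComponent_eq_top_iff (hw : w ≤ -1) (φ : WFun w s) :
    littleGroupIdComponent φ = ⊤ ↔ φ = 0 := by
  constructor
  · intro h
    rw [← littleGroup_eq_top_iff hw, eq_top_iff, ← h]
    exact littleGroupIdComponent_le φ
  · rintro rfl; exact littleGroupIdComponent_zero

theorem idComponent_isConj_SU2_iff (hw : w ≤ -1) (φ : WFun w s) :
    IsConjSubgroup (littleGroupIdComponent φ) SU2 ↔ φ ≠ 0 ∧ IsConstUpToLorentz φ := by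
  constructor
  · intro h
    have hφ : φ ≠ 0 := by
      rintro rfl
      rw [littleGroupIdComponent_zero] at h
      exact not_isConj_top_SU2 h
    obtain ⟨g, hg⟩ := h
    exact ⟨hφ, isConstUpToLorentz_of_map_conj hφ (hg ▸ littleGroupIdComponent_le φ)⟩
  · rintro ⟨hφ, hc⟩
    exact littleGroupIdComponent_of_isConstUpToLorentz hw hφ hc

theorem idComponent_eq_bot_iff (hw : w ≤ -1) (φ : WFun w s) :
    littleGroupIdComponent φ = ⊥ ↔ ¬ IsAxisymmetricUpToLorentz φ := by
  rw [isAxisymmetricUpToLorentz_iff]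
  constructor
  · rintro h ⟨g, hg⟩
    have h1 := le_littleGroupIdComponent hg
      (isPreconnected_map_conj isConnected_Gam.isPreconnected g)
    rw [h] at h1
    exact map_conj_Gam_not_le_Z2 g (h1.trans bot_le)
  · intro h
    have hφ : φ ≠ 0 := by
      rintro rfl
      exact h ⟨1, by rw [littleGroup_zero]; exact le_top⟩
    rcases idComponent_trichotomy hw hφ with h1 | ⟨g, hg⟩ | ⟨g, hg⟩
    · exact h1
    · exact absurd ⟨g, hg ▸ littleGroupIdComponent_le φ⟩ h
    · exact absurd ⟨g, (Subgroup.map_mono Gam_le_SU2).trans (hg ▸ littleGroupIdComponent_le φ)⟩ h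

theorem idComponent_isConj_Gam_iff (hw : w ≤ -1) (φ : WFun w s) :
    IsConjSubgroup (littleGroupIdComponent φ) Gam ↔
      φ ≠ 0 ∧ ¬ IsConstUpToLorentz φ ∧ IsAxisymmetricUpToLorentz φ := by
  constructor
  · intro h
    have hφ : φ ≠ 0 := by
      rintro rfl
      rw [littleGroupIdComponent_zero] at h
      exact not_isConj_top_Gam h
    refine ⟨hφ, fun hc => not_isConj_Gam_SU2 h
      (littleGroupIdComponent_of_isConstUpToLorentz hw hφ hc), ?_⟩
    obtain ⟨g, hg⟩ := h
    exact isAxisymmetricUpToLorentz_iff.2 ⟨g, hg ▸ littleGroupIdComponent_le φ⟩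
  · rintro ⟨hφ, hc, ha⟩
    rcases idComponent_trichotomy hw hφ with h1 | h1 | h1
    · exact absurd ha ((idComponent_eq_bot_iff hw φ).1 h1)
    · exact h1
    · exact absurd ((idComponent_isConj_SU2_iff hw φ).1 h1).2 hc

/-- A connected little group equals its identity component. This cannot be trivial, because `-1`
always acts as the identity. -/
theorem littleGroup_cases (hw : w ≤ -1) (φ : WFun w s)
    (h : IsConnected (littleGroup φ : Set SL2C) ∨ littleGroup φ = Z2) :
    (littleGroup φ = ⊤ ∧ φ = 0) ∨
      (IsConjSubgroup (littleGroup φ) SU2 ∧ φ ≠ 0 ∧ IsConstUpToLorentz φ) ∨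
      (IsConjSubgroup (littleGroup φ) Gam ∧
        φ ≠ 0 ∧ ¬ IsConstUpToLorentz φ ∧ IsAxisymmetricUpToLorentz φ) ∨
      (littleGroup φ = Z2 ∧ ¬ IsAxisymmetricUpToLorentz φ) := by
  rcases h with h | h
  · have e := littleGroupIdComponent_eq h.isPreconnected
    by_cases hφ : φ = 0
    · exact Or.inl ⟨(littleGroup_eq_top_iff hw φ).2 hφ, hφ⟩
    rcases idComponent_trichotomy hw hφ with h1 | h1 | h1
    · rw [e] at h1
      have h2 : (-1 : SL2C) ∈ littleGroup φ := Z2_le_littleGroup φ (Or.inr rfl)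
      rw [h1, Subgroup.mem_bot] at h2
      exact absurd h2 neg_one_ne_one
    · exact Or.inr (Or.inr (Or.inl ⟨e ▸ h1, (idComponent_isConj_Gam_iff hw φ).1 h1⟩))
    · exact Or.inr (Or.inl ⟨e ▸ h1, (idComponent_isConj_SU2_iff hw φ).1 h1⟩)
  · refine Or.inr (Or.inr (Or.inr ⟨h, fun ha => ?_⟩))
    obtain ⟨g, hg⟩ := isAxisymmetricUpToLorentz_iff.1 ha
    exact map_conj_Gam_not_le_Z2 g (h ▸ hg)

theorem memLp_one : MemLp (fun _ : ℂ => (1 : ℂ)) 2 sphereMeasure := memLp_const 1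

theorem exists_littleGroup_eq_SU2_iff (hw : w ≤ -1) :
    (∃ φ : WFun w s, littleGroup φ = SU2) ↔ s = 0 := by
  constructor
  · rintro ⟨φ, h⟩
    rcases (SU2_le_littleGroup_iff φ).1 h.ge with h1 | h1
    · rw [h1, littleGroup_zero] at h
      exact absurd h.symm SU2_ne_top
    · exact h1.1
  · intro hs
    refine ⟨ofFun w s _ memLp_one, littleGroup_of_isConst hw hs ?_ ⟨1, fn_ofFun _⟩⟩
    intro h
    have h1 := ae_of_ae_sphere ((fn_ofFun memLp_one).symm.trans (eq_zero_iff_ae.1 h))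
    obtain ⟨z, hz⟩ := h1.exists
    exact one_ne_zero hz

end Component

/-! ### Generic little groups -/

section Generic

variable {w : ℝ} {s : ℤ}

/-- If no point is moved, the cubic `(cz + d)(az + b - z(cz + d))` vanishes identically; the first
factor takes care of the pole. -/
theorem exists_moved_point {Λ : SL2C} (h : Λ ∉ Z2) :
    ∃ z, Λ 1 0 * z + Λ 1 1 ≠ 0 ∧ mobius Λ z ≠ z := by
  by_contra hn
  push Not at hn
  set a := Λ 0 0 with ha
  set b := Λ 0 1 with hb
  set c := Λ 1 0 with hc
  set d := Λ 1 1 with hd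
  have hdet : a * d - b * c = 1 := det_eq Λ
  have key : ∀ z, (c * z + d) * (a * z + b - z * (c * z + d)) = 0 := by
    intro z
    by_cases hz : c * z + d = 0
    · rw [hz, zero_mul]
    · have h1 := hn z hz
      rw [mobius, div_eq_iff hz] at h1
      rw [h1, sub_self, mul_zero]
  have k0 := key 0
  have k1 := key 1
  have k2 := key (-1)
  have k3 := key 2
  -- The third difference over `-1, 0, 1, 2` isolates the leading coefficient `-c²`.
  have hc0 : c = 0 := by
    have : c ^ 2 = 0 := by linear_combination (-1 / 6) * k3 + (1 / 2) * k1 - (1 / 2) * k0 + (1 / 6) * k2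
    simpa using this
  rw [hc0] at k0 k1 hdet
  have hd0 : d ≠ 0 := by intro h0; simp [h0] at hdet
  have hb0 : b = 0 := by
    have : d * b = 0 := by linear_combination k0
    exact (mul_eq_zero.1 this).resolve_left hd0
  have had : a = d := by
    have : d * (a - d) = 0 := by rw [hb0] at k1; linear_combination k1
    exact sub_eq_zero.1 ((mul_eq_zero.1 this).resolve_left hd0)
  have hd2 : d ^ 2 = 1 := by rw [had] at hdet; linear_combination hdet
  apply h
  have hd3 : (d - 1) * (d + 1) = 0 := by linear_combination hd2
  rcases (mul_eq_zero.1 hd3).imp sub_eq_zero.1 eq_neg_of_add_eq_zero_left with h1 | h1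
  · exact Or.inl (sl_ext (had.trans h1) hb0 hc0 h1)
  · exact Or.inr (sl_ext (had.trans h1) (hb0.trans neg_zero.symm) (hc0.trans neg_zero.symm) h1)

theorem continuousAt_mobius {Λ : SL2C} {z : ℂ} (hz : Λ 1 0 * z + Λ 1 1 ≠ 0) :
    ContinuousAt (fun p : SL2C × ℂ => mobius p.1 p.2) (Λ, z) := by
  have h1 : ∀ i j, Continuous fun p : SL2C × ℂ => p.1 i j := fun i j =>
    (continuous_entry i j).comp continuous_fst
  have h2 : ∀ i, Continuous fun p : SL2C × ℂ => p.1 i 0 * p.2 + p.1 i 1 := fun i =>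
    ((h1 i 0).mul continuous_snd).add (h1 i 1)
  exact (h2 0).continuousAt.div (h2 1).continuousAt hz

/-- Joint continuity at a moved point `z₀`: nearby matrices send points near `z₀` farther than `δ`
from it. -/
theorem exists_compact_moving {Λ : SL2C} (h : Λ ∉ Z2) :
    ∃ K ∈ 𝓝 Λ, IsCompact K ∧ ∃ (z₀ : ℂ) (r : ℝ), 0 < r ∧
      ∀ M ∈ K, ∀ z ∈ Metric.ball z₀ r, mobius M z ∉ Metric.ball z₀ r := by
  obtain ⟨z₀, hz, hne⟩ := exists_moved_point h
  obtain ⟨δ, hδ, hδ'⟩ := exists_between (dist_pos.2 hne)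
  have hev : ∀ᶠ p : SL2C × ℂ in 𝓝 (Λ, z₀), δ < dist (mobius p.1 p.2) z₀ :=
    (Tendsto.dist (continuousAt_mobius hz) tendsto_const_nhds).eventually_const_lt hδ'
  rw [nhds_prod_eq] at hev
  obtain ⟨U, hU, V, hV, hUV⟩ := eventually_prod_iff.1 hev
  obtain ⟨r, hr, hrV⟩ := Metric.eventually_nhds_iff.1 hV
  obtain ⟨K, hK, hKU, hKc⟩ := local_compact_nhds hU
  refine ⟨K, hK, hKc, z₀, min r δ, lt_min hr hδ, fun M hM z hz hmem => ?_⟩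
  have h1 := hUV (hKU hM) (hrV (hz.trans_le (min_le_left _ _)))
  have h2 := (Metric.mem_ball.1 hmem).trans_le (min_le_right r δ)
  exact lt_asymm h1 h2

/-- Functions of equal norm, supported on disjoint parts of a disc. -/
theorem exists_disjoint_family (z₀ : ℂ) {r ε : ℝ} (hr : 0 < r) (hε : 0 < ε) :
    ∃ e : ℕ → WFun w s, (∀ n, ‖e n‖ = ε) ∧ (∀ n m, n ≠ m → ε ≤ ‖e n - e m‖) ∧
      ∀ n, ∀ᵐ z ∂sphereMeasure, z ∉ Metric.ball z₀ r → (e n).fn z = 0 := by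
  let A : ℕ → Set ℂ := fun n =>
    (fun z => ‖z - z₀‖) ⁻¹' Set.Ioo (r / (n + 2)) (r / (n + 1))
  have hlt : ∀ n : ℕ, r / (n + 2) < r / (n + 1) := fun n => by gcongr; norm_num
  have hAo : ∀ n, IsOpen (A n) := fun n => isOpen_Ioo.preimage (by fun_prop)
  have hAne : ∀ n, (A n).Nonempty := by
    intro n
    obtain ⟨x, hx⟩ := exists_between (hlt n)
    have hx0 : 0 < x := lt_trans (by positivity) hx.1
    refine ⟨z₀ + x, ?_⟩
    change ‖z₀ + (x : ℂ) - z₀‖ ∈ Set.Ioo (r / ((n : ℝ) + 2)) (r / ((n : ℝ) + 1))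
    rw [add_sub_cancel_left, Complex.norm_real, Real.norm_of_nonneg hx0.le]
    exact hx
  have hAm : ∀ n, MeasurableSet (A n) := fun n => (hAo n).measurableSet
  have hApos : ∀ n, 0 < sphereMeasure.real (A n) := by
    intro n
    refine ENNReal.toReal_pos ?_ (measure_ne_top _ _)
    intro h0
    have h1 := ae_of_ae_sphere (measure_eq_zero_iff_ae_notMem.1 h0)
    exact ((hAo n).measure_pos volume (hAne n)).ne' (measure_eq_zero_iff_ae_notMem.2 h1)
  have hAdis : ∀ n m, n ≠ m → ∀ z ∈ A n, z ∉ A m := by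
    have key : ∀ n m : ℕ, n < m → ∀ z, z ∈ A n → z ∈ A m → False := by
      intro n m hnm z hz hz'
      have h1 : r / (n + 2) < ‖z - z₀‖ := hz.1
      have h2 : ‖z - z₀‖ < r / (m + 1) := hz'.2
      have h3 : r / ((m : ℝ) + 1) ≤ r / (n + 2) := by
        have : (n : ℝ) + 1 ≤ m := by exact_mod_cast hnm
        exact div_le_div_of_nonneg_left hr.le (by positivity) (by linarith)
      linarith
    intro n m hnm z hz hz'
    rcases lt_or_gt_of_ne hnm with h | h
    · exact key n m h z hz hz'
    · exact key m n h z hz' hz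
  have hAD : ∀ n, A n ⊆ Metric.ball z₀ r := by
    intro n z hz
    rw [mem_ball_iff_norm]
    have h2 : ‖z - z₀‖ < r / (n + 1) := hz.2
    refine h2.trans_le (div_le_self hr.le ?_)
    have : (0 : ℝ) ≤ n := n.cast_nonneg
    linarith
  let c : ℕ → ℝ := fun n => ε / sphereMeasure.real (A n) ^ (1 / 2 : ℝ)
  let e : ℕ → WFun w s := fun n =>
    indicatorConstLp 2 (hAm n) (measure_ne_top sphereMeasure _) (c n : ℂ)
  have hefn : ∀ n, (e n).fn =ᵐ[sphereMeasure] (A n).indicator fun _ => (c n : ℂ) := fun n =>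
    indicatorConstLp_coeFn
  have hnorm : ∀ n, ‖e n‖ = ε := by
    intro n
    have h1 : ‖e n‖ = ‖(c n : ℂ)‖ * sphereMeasure.real (A n) ^ (1 / (2 : ℝ≥0∞).toReal) :=
      norm_indicatorConstLp (by norm_num) (by norm_num)
    have hp := hApos n
    rw [h1, Complex.norm_real, Real.norm_of_nonneg (by positivity), ENNReal.toReal_ofNat]
    exact div_mul_cancel₀ _ (by positivity)
  refine ⟨e, hnorm, fun n m hnm => ?_, fun n => ?_⟩
  -- The supports are disjoint, so subtracting `e m` does not change `e n` where it lives.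
  · have key : ‖e n‖ₑ ^ 2 ≤ ‖e n - e m‖ₑ ^ 2 := by
      rw [enorm_sq, enorm_sq]
      refine lintegral_mono_ae ?_
      filter_upwards [hefn n, hefn m, fn_sub (e n) (e m)] with z h1 h2 h3
      rw [h3, Pi.sub_apply, h1, h2]
      by_cases hz : z ∈ A n
      · rw [Set.indicator_of_notMem (hAdis n m hnm z hz), sub_zero]
      · rw [Set.indicator_of_notMem hz]; simp
    have h2 := (ENNReal.pow_le_pow_left_iff two_ne_zero).1 key
    rw [← ofReal_norm, ← ofReal_norm, ENNReal.ofReal_le_ofReal_iff (norm_nonneg _)] at h2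
    rwa [← hnorm n]
  · filter_upwards [hefn n] with z hz hzD
    rw [hz, Set.indicator_of_notMem fun h => hzD (hAD n h)]

/-- The functions fixed by some element of `K`. -/
def fixedBy (w : ℝ) (s : ℤ) (K : Set SL2C) : Set (WFun w s) := {φ | ∃ Λ ∈ K, Λ⁻¹ • φ = φ}

/-- The fixing elements of a convergent sequence have a limit point in the compact set `K`, and it
fixes the limit by continuity of the action. -/
theorem isClosed_fixedBy {K : Set SL2C} (hK : IsCompact K) : IsClosed (fixedBy w s K) := by
  refine IsSeqClosed.isClosed fun x φ hx hlim => ?_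
  choose u huK hu using hx
  obtain ⟨Λ, hΛ, σ, hσ, hlimΛ⟩ := hK.tendsto_subseq huK
  refine ⟨Λ, hΛ, ?_⟩
  have h1 := hlim.comp hσ.tendsto_atTop
  have h2 := hlimΛ.inv.smul h1
  refine tendsto_nhds_unique h2 (h1.congr fun n => ?_)
  exact (hu (σ n)).symm

/-- Suppose a ball about `φ` consisted of such functions. Perturb `φ` by infinitely many separated
`e n` supported in the disc, with `φ + e n` fixed by `u n`. Then `e n` is determined by `u n`, which
has a convergent subsequence, and this contradicts the separation. -/
theorem dense_compl_fixedBy {K : Set SL2C} (hK : IsCompact K) {z₀ : ℂ} {r : ℝ} (hr : 0 < r)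
    (hmove : ∀ M ∈ K, ∀ z ∈ Metric.ball z₀ r, mobius M z ∉ Metric.ball z₀ r) :
    Dense (fixedBy w s K)ᶜ := by
  rw [← interior_eq_empty_iff_dense_compl, Set.eq_empty_iff_forall_notMem]
  intro φ hφ
  obtain ⟨ε, hε, hball⟩ := Metric.mem_nhds_iff.1 (mem_interior_iff_mem_nhds.1 hφ)
  obtain ⟨e, hen, hed, hesupp⟩ := exists_disjoint_family (w := w) (s := s) z₀ hr (half_pos hε)
  have hmem : ∀ n, φ + e n ∈ fixedBy w s K := fun n => hball (by
    rw [mem_ball_iff_norm, add_sub_cancel_left, hen]; linarith)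
  choose u huK hu using hmem
  -- In the disc `u n` fetches values from outside the disc, where the perturbation vanishes.
  -- Invariance then expresses `e n` through `φ` and `u n` alone.
  have hD : ∀ n, ∀ᵐ z ∂sphereMeasure, z ∈ Metric.ball z₀ r →
      (e n).fn z = ((u n)⁻¹ • φ).fn z - φ.fn z := by
    intro n
    have h1 := smul_eq_iff_ae.1 (hu n)
    rw [inv_inv] at h1
    have h2 := fn_smul (u n)⁻¹ φ
    rw [inv_inv] at h2
    filter_upwards [h1, h2, fn_add φ (e n),
      (quasiMeasurePreserving_mobius (u n)).ae (fn_add φ (e n)),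
      (quasiMeasurePreserving_mobius (u n)).ae (hesupp n)] with z a1 a2 a3 a4 a5 hz
    rw [a3, pullback, a4, Pi.add_apply, Pi.add_apply, a5 (hmove _ (huK n) z hz), add_zero] at a1
    rw [a2, pullback, a1]; ring
  have hle : ∀ n m, ‖e n - e m‖ ≤ ‖(u n)⁻¹ • φ - (u m)⁻¹ • φ‖ := by
    intro n m
    have key : ‖e n - e m‖ₑ ^ 2 ≤ ‖(u n)⁻¹ • φ - (u m)⁻¹ • φ‖ₑ ^ 2 := by
      rw [enorm_sq, enorm_sq]
      refine lintegral_mono_ae ?_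
      filter_upwards [hD n, hD m, hesupp n, hesupp m, fn_sub (e n) (e m),
        fn_sub ((u n)⁻¹ • φ) ((u m)⁻¹ • φ)] with z a1 a2 a3 a4 a5 a6
      rw [a5, a6, Pi.sub_apply, Pi.sub_apply]
      by_cases hz : z ∈ Metric.ball z₀ r
      · rw [a1 hz, a2 hz, sub_sub_sub_cancel_right]
      · rw [a3 hz, a4 hz]; simp
    have h2 := (ENNReal.pow_le_pow_left_iff two_ne_zero).1 key
    rwa [← ofReal_norm, ← ofReal_norm, ENNReal.ofReal_le_ofReal_iff (norm_nonneg _)] at h2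
  obtain ⟨Λ, -, σ, hσ, hlim⟩ := hK.tendsto_subseq huK
  have hc := (hlim.inv.smul_const φ).cauchySeq
  obtain ⟨N, hN⟩ := Metric.cauchySeq_iff.1 hc (ε / 2) (half_pos hε)
  have h1 := hN N le_rfl (N + 1) (Nat.le_succ N)
  have h2 := hed (σ N) (σ (N + 1)) (hσ (Nat.lt_succ_self N)).ne
  rw [dist_eq_norm] at h1
  exact absurd (h2.trans (hle _ _)) (not_le.2 h1)

/-- `SL(2,ℂ)` is second countable, so countably many of the compact neighbourhoods cover the
complement of `{±1}`. -/
theorem residual_littleGroup_eq_Z2 :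
    {φ : WFun w s | littleGroup φ = Z2} ∈ residual (WFun w s) := by
  have hex : ∀ Λ : SL2C, ∃ K : Set SL2C, Λ ∉ Z2 → K ∈ 𝓝 Λ ∧ IsCompact K ∧
      ∃ (z₀ : ℂ) (r : ℝ), 0 < r ∧
        ∀ M ∈ K, ∀ z ∈ Metric.ball z₀ r, mobius M z ∉ Metric.ball z₀ r := by
    intro Λ
    by_cases h : Λ ∈ Z2
    · exact ⟨∅, fun h' => absurd h h'⟩
    · obtain ⟨K, hK⟩ := exists_compact_moving h
      exact ⟨K, fun _ => hK⟩
  choose K hK using hex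
  obtain ⟨t, htZ, htc, hcov⟩ := TopologicalSpace.countable_cover_nhdsWithin
    (s := {Λ : SL2C | Λ ∉ Z2}) (f := K) fun Λ hΛ => mem_nhdsWithin_of_mem_nhds (hK Λ hΛ).1
  have h1 : (⋂ Λ ∈ t, (fixedBy w s (K Λ))ᶜ) ∈ residual (WFun w s) := by
    refine (countable_bInter_mem htc).2 fun Λ hΛ => ?_
    obtain ⟨-, hc, z₀, r, hr, hmove⟩ := hK Λ (htZ hΛ)
    exact residual_of_dense_open (isClosed_fixedBy hc).isOpen_compl
      (dense_compl_fixedBy hc hr hmove)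
  refine mem_of_superset h1 fun φ hφ => ?_
  refine le_antisymm (fun M hM => ?_) (Z2_le_littleGroup φ)
  by_contra hMZ
  obtain ⟨Λ, hΛ, hMΛ⟩ := Set.mem_iUnion₂.1 (hcov hMZ)
  exact Set.mem_iInter₂.1 hφ Λ hΛ ⟨M, hMΛ, (littleGroup φ).inv_mem hM⟩

end Generic

end WeightedSphere

namespace WeightedSphere

/-! ### Models of the orbits -/

variable {w : ℝ} {s : ℤ}

/-- Two quotient maps on the same space with the same fibres have canonically homeomorphic targets.
Each model of an orbit is obtained by exhibiting such an `F`. -/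
theorem exists_homeomorph_of_isQuotientMap (hw : w ≤ -1) {φ : WFun w s} (hφ : φ ≠ 0) {Y : Type*}
    [TopologicalSpace Y] {F : SL2C → Y} (hF : IsQuotientMap F)
    (h : ∀ Λ M, F Λ = F M ↔ Λ⁻¹ * M ∈ littleGroup φ) :
    ∃ e : Orbit φ ≃ₜ Y, ∀ Λ, e (orbitPoint φ Λ) = F Λ := by
  have hq := isQuotientMap_orbitPoint hw hφ
  have h1 : ∀ Λ, F (Function.surjInv hq.surjective (orbitPoint φ Λ)) = F Λ := fun Λ =>
    (h _ _).2 (orbitPoint_eq_iff.1 (Function.surjInv_eq hq.surjective _))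
  have h2 : ∀ Λ, orbitPoint φ (Function.surjInv hF.surjective (F Λ)) = orbitPoint φ Λ := fun Λ =>
    orbitPoint_eq_iff.2 ((h _ _).1 (Function.surjInv_eq hF.surjective _))
  refine ⟨{ toFun := F ∘ Function.surjInv hq.surjective
            invFun := orbitPoint φ ∘ Function.surjInv hF.surjective
            left_inv := fun x => ?_
            right_inv := fun y => ?_
            continuous_toFun := ?_
            continuous_invFun := ?_ }, h1⟩
  · obtain ⟨Λ, rfl⟩ := hq.surjective x
    simp only [Function.comp_apply, h1, h2]
  · obtain ⟨Λ, rfl⟩ := hF.surjective y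
    simp only [Function.comp_apply, h1, h2]
  · rw [hq.continuous_iff]
    exact hF.continuous.congr fun Λ => (h1 Λ).symm
  · rw [hF.continuous_iff]
    exact (continuous_orbitPoint φ).congr fun Λ => (h2 Λ).symm

/-! ### The hyperboloid and the splitting of `SL(2,ℂ)` over it. -/

theorem norm_sq_R3 (k : R3) : ‖k‖ ^ 2 = k 0 ^ 2 + k 1 ^ 2 + k 2 ^ 2 := by
  rw [EuclideanSpace.norm_sq_eq, Fin.sum_univ_three]
  simp only [Real.norm_eq_abs, sq_abs]

/-- The vector `k` with `Λ Λ† = hyperboloidMatrix k`. -/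
noncomputable def hyperVec (Λ : SL2C) : R3 :=
  !₂[(Λ 0 0 * conj (Λ 1 0) + Λ 0 1 * conj (Λ 1 1)).re,
    (Λ 0 0 * conj (Λ 1 0) + Λ 0 1 * conj (Λ 1 1)).im,
    (‖Λ 0 0‖ ^ 2 + ‖Λ 0 1‖ ^ 2 - ‖Λ 1 0‖ ^ 2 - ‖Λ 1 1‖ ^ 2) / 2]

/-- This is `det (Λ Λ†) = |det Λ|² = 1`, with half the trace of `Λ Λ†` as `k₀`. -/
theorem sqrt_one_add_hyperVec (Λ : SL2C) :
    √(1 + ‖hyperVec Λ‖ ^ 2) = (‖Λ 0 0‖ ^ 2 + ‖Λ 0 1‖ ^ 2 + ‖Λ 1 0‖ ^ 2 + ‖Λ 1 1‖ ^ 2) / 2 := by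
  rw [Real.sqrt_eq_iff_mul_self_eq (by positivity) (by positivity), norm_sq_R3]
  have h := det_eq Λ
  have hr := congrArg Complex.re h
  have hi := congrArg Complex.im h
  simp only [hyperVec, Complex.sq_norm, Complex.normSq_apply]
  simp [Complex.mul_re, Complex.mul_im] at hr hi ⊢
  generalize (Λ 0 0).re = a at *
  generalize (Λ 0 0).im = a' at *
  generalize (Λ 0 1).re = b at *
  generalize (Λ 0 1).im = b' at *
  generalize (Λ 1 0).re = c at *
  generalize (Λ 1 0).im = c' at *
  generalize (Λ 1 1).re = d at *
  generalize (Λ 1 1).im = d' at *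
  linear_combination -(a * d - a' * d' - (b * c - b' * c') + 1) * hr -
    (a * d' + a' * d - (b * c' + b' * c)) * hi

theorem hyperboloidMatrix_hyperVec (Λ : SL2C) : hyperboloidMatrix (hyperVec Λ) =
    (Λ : Matrix (Fin 2) (Fin 2) ℂ) * (Λ : Matrix (Fin 2) (Fin 2) ℂ).conjTranspose := by
  have e : ((hyperVec Λ 0 : ℝ) : ℂ) + Complex.I * (hyperVec Λ 1 : ℝ) =
      Λ 0 0 * conj (Λ 1 0) + Λ 0 1 * conj (Λ 1 1) := by
    rw [mul_comm]
    exact Complex.re_add_im (Λ 0 0 * conj (Λ 1 0) + Λ 0 1 * conj (Λ 1 1))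
  have e' : ((hyperVec Λ 0 : ℝ) : ℂ) - Complex.I * (hyperVec Λ 1 : ℝ) =
      Λ 1 0 * conj (Λ 0 0) + Λ 1 1 * conj (Λ 0 1) := by
    have := congrArg conj e
    simp only [map_add, map_mul, Complex.conj_ofReal, Complex.conj_I, Complex.conj_conj] at this
    linear_combination this
  have e2 : hyperVec Λ 2 = (‖Λ 0 0‖ ^ 2 + ‖Λ 0 1‖ ^ 2 - ‖Λ 1 0‖ ^ 2 - ‖Λ 1 1‖ ^ 2) / 2 := rfl
  ext i j
  rw [Matrix.mul_apply, Fin.sum_univ_two, hyperboloidMatrix, sqrt_one_add_hyperVec, e, e', e2]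
  simp only [Matrix.conjTranspose_apply, Complex.star_def]
  revert i j
  simp only [Fin.forall_fin_two]
  refine ⟨⟨?_, ?_⟩, ?_, ?_⟩
  · simp only [Complex.mul_conj']
    simp; ring
  · simp
  · simp
  · simp only [Complex.mul_conj']
    simp; ring

theorem hyperboloidMatrix_injective : Function.Injective hyperboloidMatrix := by
  intro k l h
  have h00 := congrFun₂ h 0 0
  have h11 := congrFun₂ h 1 1
  have h01 := congrFun₂ h 0 1
  simp only [hyperboloidMatrix, Matrix.of_apply, Matrix.cons_val', Matrix.cons_val_zero,
    Matrix.cons_val_one, Matrix.cons_val_fin_one] at h00 h11 h01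
  have r0 := congrArg Complex.re h01
  have r1 := congrArg Complex.im h01
  simp at r0 r1
  have r2 : k 2 = l 2 := by
    have : ((k 2 : ℝ) : ℂ) = l 2 := by linear_combination (h00 - h11) / 2
    exact_mod_cast this
  ext i
  fin_cases i
  exacts [r0, r1, r2]

theorem hyperVec_eq_iff {Λ M : SL2C} : hyperVec Λ = hyperVec M ↔ Λ⁻¹ * M ∈ SU2 := by
  rw [← hyperboloidMatrix_injective.eq_iff, hyperboloidMatrix_hyperVec, hyperboloidMatrix_hyperVec,
    mem_SU2_iff_mul]
  have h1 : (Λ : Matrix (Fin 2) (Fin 2) ℂ) * ((Λ⁻¹ : SL2C) : Matrix (Fin 2) (Fin 2) ℂ) = 1 := by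
    rw [← Matrix.SpecialLinearGroup.coe_mul, mul_inv_cancel, Matrix.SpecialLinearGroup.coe_one]
  have h2 : ((Λ⁻¹ : SL2C) : Matrix (Fin 2) (Fin 2) ℂ) * (Λ : Matrix (Fin 2) (Fin 2) ℂ) = 1 := by
    rw [← Matrix.SpecialLinearGroup.coe_mul, inv_mul_cancel, Matrix.SpecialLinearGroup.coe_one]
  rw [Matrix.SpecialLinearGroup.coe_mul, Matrix.conjTranspose_mul]
  generalize ((Λ⁻¹ : SL2C) : Matrix (Fin 2) (Fin 2) ℂ) = N at *
  generalize (Λ : Matrix (Fin 2) (Fin 2) ℂ) = A at *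
  generalize (M : Matrix (Fin 2) (Fin 2) ℂ) = B at *
  have h3 : A.conjTranspose * N.conjTranspose = 1 := by
    rw [← Matrix.conjTranspose_mul, h2, Matrix.conjTranspose_one]
  have h4 : N.conjTranspose * A.conjTranspose = 1 := by
    rw [← Matrix.conjTranspose_mul, h1, Matrix.conjTranspose_one]
  constructor
  · intro h
    calc N * B * (B.conjTranspose * N.conjTranspose) = N * (B * B.conjTranspose) * N.conjTranspose := by
          simp only [Matrix.mul_assoc]
      _ = N * A * (A.conjTranspose * N.conjTranspose) := by rw [← h]; simp only [Matrix.mul_assoc]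
      _ = 1 := by rw [h2, h3, one_mul]
  · intro h
    calc A * A.conjTranspose = A * (N * B * (B.conjTranspose * N.conjTranspose)) * A.conjTranspose := by
          rw [h, mul_one]
      _ = (A * N) * (B * B.conjTranspose) * (N.conjTranspose * A.conjTranspose) := by
          simp only [Matrix.mul_assoc]
      _ = _ := by rw [h1, h4, one_mul, mul_one]

theorem continuous_hyperVec : Continuous hyperVec := by
  unfold hyperVec
  have := fun i j => continuous_entry i j
  have hc : Continuous fun Λ : SL2C => Λ 0 0 * conj (Λ 1 0) + Λ 0 1 * conj (Λ 1 1) :=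
    ((this 0 0).mul (Complex.continuous_conj.comp (this 1 0))).add
      ((this 0 1).mul (Complex.continuous_conj.comp (this 1 1)))
  refine (PiLp.continuous_toLp 2 _).comp (continuous_pi fun i => ?_)
  fin_cases i
  · exact Complex.continuous_re.comp hc
  · exact Complex.continuous_im.comp hc
  · exact (((((this 0 0).norm.pow 2).add ((this 0 1).norm.pow 2)).sub ((this 1 0).norm.pow 2)).sub
      ((this 1 1).norm.pow 2)).div_const 2

/-- Positivity of the upper left entry is what makes the Cholesky section defined on the whole
hyperboloid. -/
theorem sqrt_one_add_norm_sq_add_pos (k : R3) : 0 < √(1 + ‖k‖ ^ 2) + k 2 := by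
  have h : |k 2| < √(1 + ‖k‖ ^ 2) := by
    apply Real.lt_sqrt_of_sq_lt
    rw [norm_sq_R3, sq_abs]
    nlinarith [sq_nonneg (k 0), sq_nonneg (k 1)]
  linarith [(abs_lt.1 h).1]

/-- A continuous section of `hyperVec`. -/
noncomputable def hyperLift (k : R3) : SL2C :=
  cholesky (√(1 + ‖k‖ ^ 2) + k 2) (k 0 + Complex.I * k 1)

theorem hyperVec_hyperLift (k : R3) : hyperVec (hyperLift k) = k := by
  apply hyperboloidMatrix_injective
  rw [hyperboloidMatrix_hyperVec, hyperLift,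
    cholesky_mul_conjTranspose (r := √(1 + ‖k‖ ^ 2) - k 2) (sqrt_one_add_norm_sq_add_pos k)]
  · rw [hyperboloidMatrix]
    simp [sub_eq_add_neg]
  · have e : ‖(k 0 : ℂ) + Complex.I * k 1‖ ^ 2 = k 0 ^ 2 + k 1 ^ 2 := by
      rw [Complex.sq_norm, Complex.normSq_apply]; simp; ring
    have e2 := Real.mul_self_sqrt (show 0 ≤ 1 + ‖k‖ ^ 2 by positivity)
    have e3 := norm_sq_R3 k
    rw [e]; linear_combination e2 + e3

theorem continuous_hyperLift : Continuous hyperLift := by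
  have h := sqrt_one_add_norm_sq_add_pos
  have hc : Continuous fun k : R3 => √(1 + ‖k‖ ^ 2) + k 2 := by fun_prop
  unfold hyperLift cholesky
  refine continuous_tri.comp (Continuous.prodMk ?_ ?_)
  · exact (hc.log fun k => (h k).ne').neg
  · refine Continuous.div (Complex.continuous_conj.comp (by fun_prop))
      (Complex.continuous_ofReal.comp hc.sqrt) fun k => ?_
    exact_mod_cast (Real.sqrt_pos.2 (h k)).ne'

theorem isQuotientMap_hyperVec : IsQuotientMap hyperVec :=
  IsQuotientMap.of_inverse continuous_hyperLift continuous_hyperVec hyperVec_hyperLift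

theorem hyperLift_inv_mul_mem (Λ : SL2C) : (hyperLift (hyperVec Λ))⁻¹ * Λ ∈ SU2 :=
  hyperVec_eq_iff.1 (hyperVec_hyperLift _)

theorem hyperVec_mul_of_mem (Λ : SL2C) {κ : SL2C} (hκ : κ ∈ SU2) :
    hyperVec (Λ * κ) = hyperVec Λ :=
  (hyperVec_eq_iff.2 (by simpa using hκ)).symm

/-- The polar-type decomposition `SL(2,ℂ) ≃ ℝ³ × SU(2)`. -/
noncomputable def polarHomeomorph : SL2C ≃ₜ R3 × SU2 where
  toFun Λ := (hyperVec Λ, ⟨(hyperLift (hyperVec Λ))⁻¹ * Λ, hyperLift_inv_mul_mem Λ⟩)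
  invFun p := hyperLift p.1 * p.2
  left_inv Λ := by simp
  right_inv p := by
    have : hyperVec (hyperLift p.1 * p.2) = p.1 := by
      rw [hyperVec_mul_of_mem _ p.2.2, hyperVec_hyperLift]
    ext1
    · exact this
    · apply Subtype.ext
      simp [this]
  continuous_toFun := continuous_hyperVec.prodMk
    ((((continuous_hyperLift.comp continuous_hyperVec).inv).mul continuous_id).subtype_mk _)
  continuous_invFun := (continuous_hyperLift.comp continuous_fst).mul
    (continuous_subtype_val.comp continuous_snd)

/-- Right multiplication by a subgroup of `SU(2)` leaves the `ℝ³` factor alone, so a model of `SU(2)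
/ H` gives one of `SL(2,ℂ) / H`. -/
theorem polarHomeomorph_prodMap_eq_iff {Y : Type*} {f : SU2 → Y} {H : Subgroup SL2C} (hH : H ≤ SU2)
    (hf : ∀ κ κ', f κ = f κ' ↔ (κ : SL2C)⁻¹ * κ' ∈ H) (Λ M : SL2C) :
    Prod.map id f (polarHomeomorph Λ) = Prod.map id f (polarHomeomorph M) ↔ Λ⁻¹ * M ∈ H := by
  have key : hyperVec Λ = hyperVec M → ((hyperLift (hyperVec Λ))⁻¹ * Λ)⁻¹ *
      ((hyperLift (hyperVec M))⁻¹ * M) = Λ⁻¹ * M := by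
    intro h; rw [h]; group
  change (hyperVec Λ, f _) = (hyperVec M, f _) ↔ _
  rw [Prod.mk.injEq, hf]
  constructor
  · rintro ⟨h1, h2⟩
    rwa [← key h1]
  · intro h
    have h1 := hyperVec_eq_iff.2 (hH h)
    exact ⟨h1, by rwa [← key h1] at h⟩

/-- The Hopf map, `κ ↦ κ σ₃ κ†` up to the sign of the first two components. -/
noncomputable def hopf (κ : SU2) : S2 :=
  ⟨!₂[2 * ((κ : SL2C) 0 0 * (κ : SL2C) 0 1).re, 2 * ((κ : SL2C) 0 0 * (κ : SL2C) 0 1).im,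
    ‖(κ : SL2C) 0 0‖ ^ 2 - ‖(κ : SL2C) 0 1‖ ^ 2], by
    have h := SU2_norm_sq κ.2
    rw [mem_sphere_zero_iff_norm, ← sq_eq_sq₀ (norm_nonneg _) zero_le_one, norm_sq_R3]
    simp only [Complex.sq_norm, Complex.normSq_apply] at h ⊢
    simp [Complex.mul_re, Complex.mul_im]
    generalize ((κ : SL2C) 0 0).re = a at *
    generalize ((κ : SL2C) 0 0).im = a' at *
    generalize ((κ : SL2C) 0 1).re = b at *
    generalize ((κ : SL2C) 0 1).im = b' at *
    linear_combination (a * a + a' * a' + (b * b + b' * b') + 1) * h⟩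

theorem continuous_hopf : Continuous hopf := by
  have := fun i j => (continuous_entry i j).comp (continuous_subtype_val (p := (· ∈ SU2)))
  have hc := (this 0 0).mul (this 0 1)
  refine Continuous.subtype_mk ((PiLp.continuous_toLp 2 _).comp (continuous_pi fun i => ?_)) _
  fin_cases i
  · exact continuous_const.mul (Complex.continuous_re.comp hc)
  · exact continuous_const.mul (Complex.continuous_im.comp hc)
  · exact ((this 0 0).norm.pow 2).sub ((this 0 1).norm.pow 2)

theorem hopf_eq_of {κ : SU2} {n : S2} (h : 2 * ((κ : SL2C) 0 0 * (κ : SL2C) 0 1) =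
    (n : R3) 0 + (n : R3) 1 * Complex.I) (h2 : ‖(κ : SL2C) 0 0‖ ^ 2 - ‖(κ : SL2C) 0 1‖ ^ 2 = (n : R3) 2) :
    hopf κ = n := by
  have r := congrArg Complex.re h
  have i := congrArg Complex.im h
  have e : ∀ x : ℂ, 2 * x = ((2 : ℝ) : ℂ) * x := fun x => by norm_num
  rw [e, Complex.re_ofReal_mul, Complex.add_re, Complex.ofReal_re, Complex.re_ofReal_mul,
    Complex.I_re, mul_zero, add_zero] at r
  rw [e, Complex.im_ofReal_mul, Complex.add_im, Complex.ofReal_im, Complex.im_ofReal_mul,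
    Complex.I_im, mul_one, zero_add] at i
  apply Subtype.ext
  ext j
  fin_cases j
  exacts [r, i, h2]

/-- Away from the south pole the first entry can be taken real and positive, `√((1 + n₃)/2)`, and it
determines the second. At the south pole it vanishes, so that point is treated separately. -/
theorem hopf_surjective : Function.Surjective hopf := by
  intro n
  have hn : (n : R3) 0 ^ 2 + (n : R3) 1 ^ 2 + (n : R3) 2 ^ 2 = 1 := by
    rw [← norm_sq_R3, mem_sphere_zero_iff_norm.1 n.2, one_pow]
  set x := (n : R3) 0 with hx
  set y := (n : R3) 1 with hy
  set z := (n : R3) 2 with hz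
  by_cases h : z = -1
  · refine ⟨⟨suMk 0 1 (by simp), suMk_mem _ _ _⟩, hopf_eq_of ?_ ?_⟩
    · have hx0 : x = 0 := by nlinarith
      have hy0 : y = 0 := by nlinarith
      rw [← hx, ← hy, hx0, hy0]
      simp [suMk]
    · rw [← hz, h]
      simp [suMk]
  · have hz1 : 0 < 1 + z := by
      have : -1 ≤ z := by nlinarith
      have := lt_of_le_of_ne this (Ne.symm h)
      linarith
    set a := √((1 + z) / 2) with ha
    have ha0 : 0 < a := Real.sqrt_pos.2 (by linarith)
    have ha2 : a ^ 2 = (1 + z) / 2 := Real.sq_sqrt (by linarith)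
    have hac : (a : ℂ) ≠ 0 := by exact_mod_cast ha0.ne'
    have hb : ‖((x : ℂ) + y * Complex.I) / (2 * a)‖ ^ 2 = (1 - z) / 2 := by
      rw [norm_div, div_pow, norm_mul, mul_pow, Complex.norm_real, Real.norm_eq_abs, sq_abs, ha2,
        Complex.sq_norm, Complex.normSq_apply]
      simp
      field_simp
      linear_combination hn
    have ha' : ‖(a : ℂ)‖ ^ 2 = (1 + z) / 2 := by
      rw [Complex.norm_real, Real.norm_eq_abs, sq_abs, ha2]
    refine ⟨⟨suMk a (((x : ℂ) + y * Complex.I) / (2 * a)) ?_, suMk_mem _ _ _⟩, hopf_eq_of ?_ ?_⟩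
    · rw [ha', hb]; ring
    · change 2 * ((a : ℂ) * (((x : ℂ) + y * Complex.I) / (2 * a))) = (x : ℂ) + y * Complex.I
      field_simp
    · change ‖(a : ℂ)‖ ^ 2 - ‖((x : ℂ) + y * Complex.I) / (2 * a)‖ ^ 2 = _
      rw [ha', hb]; ring

theorem hopf_eq_iff {κ κ' : SU2} : hopf κ = hopf κ' ↔ (κ : SL2C)⁻¹ * κ' ∈ Gam := by
  have hn := SU2_norm_sq κ.2
  have hn' := SU2_norm_sq κ'.2
  constructor
  · intro h
    have h0 : 2 * ((κ : SL2C) 0 0 * (κ : SL2C) 0 1).re = 2 * ((κ' : SL2C) 0 0 * (κ' : SL2C) 0 1).re :=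
      congrArg (fun n : S2 => (n : R3) 0) h
    have h1 : 2 * ((κ : SL2C) 0 0 * (κ : SL2C) 0 1).im = 2 * ((κ' : SL2C) 0 0 * (κ' : SL2C) 0 1).im :=
      congrArg (fun n : S2 => (n : R3) 1) h
    have h2 : ‖(κ : SL2C) 0 0‖ ^ 2 - ‖(κ : SL2C) 0 1‖ ^ 2 =
      ‖(κ' : SL2C) 0 0‖ ^ 2 - ‖(κ' : SL2C) 0 1‖ ^ 2 := congrArg (fun n : S2 => (n : R3) 2) h
    have hab : (κ : SL2C) 0 0 * (κ : SL2C) 0 1 = (κ' : SL2C) 0 0 * (κ' : SL2C) 0 1 :=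
      Complex.ext (by linarith) (by linarith)
    have hsq : ‖(κ : SL2C) 0 0‖ ^ 2 = ‖(κ' : SL2C) 0 0‖ ^ 2 := by linarith
    have hsqc : (κ : SL2C) 0 0 * conj ((κ : SL2C) 0 0) = (κ' : SL2C) 0 0 * conj ((κ' : SL2C) 0 0) := by
      rw [Complex.mul_conj', Complex.mul_conj']; exact_mod_cast hsq
    apply eq_rotZ_of_apply_eq_zero (SU2.mul_mem (SU2.inv_mem κ.2) κ'.2)
    rw [mul_apply', inv_apply_zero_zero, inv_apply_zero_one, (mem_SU2_iff.1 κ.2).1,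
      (mem_SU2_iff.1 κ'.2).1]
    by_cases ha : (κ : SL2C) 0 0 = 0
    · have ha' : (κ' : SL2C) 0 0 = 0 := by simpa [ha] using hsq.symm
      simp [ha, ha']
    · have ha' : (κ' : SL2C) 0 0 ≠ 0 := by
        intro h; apply ha; simpa [h] using hsq
      -- The upper right entry of `κ⁻¹ κ'` becomes a combination of the invariants `ab` and `|a|²`
      -- only after multiplication by the two nonzero upper left entries.
      refine (mul_eq_zero.1 (?_ : (κ : SL2C) 0 0 * (κ' : SL2C) 0 0 * _ = 0)).resolve_left
        (mul_ne_zero ha ha')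
      linear_combination (κ' : SL2C) 0 0 * (κ' : SL2C) 0 1 * hsqc -
        (κ' : SL2C) 0 0 * conj ((κ' : SL2C) 0 0) * hab
  · rintro ⟨x, hx⟩
    have e : (κ' : SL2C) = κ * rotZ x := by rw [hx]; group
    have e0 : (κ' : SL2C) 0 0 = (κ : SL2C) 0 0 * Complex.exp (-(Complex.I * x / 2)) := by
      rw [e, mul_apply', rotZ_apply_zero_zero, rotZ_apply_one_zero, mul_zero, add_zero]
    have e1 : (κ' : SL2C) 0 1 = (κ : SL2C) 0 1 * Complex.exp (Complex.I * x / 2) := by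
      rw [e, mul_apply', rotZ_apply_zero_one, rotZ_apply_one_one, mul_zero, zero_add]
    have e2 : (κ' : SL2C) 0 0 * (κ' : SL2C) 0 1 = (κ : SL2C) 0 0 * (κ : SL2C) 0 1 := by
      rw [e0, e1, mul_mul_mul_comm, ← Complex.exp_add, neg_add_cancel, Complex.exp_zero, mul_one]
    have n0 : ‖(κ' : SL2C) 0 0‖ = ‖(κ : SL2C) 0 0‖ := by
      rw [e0, norm_mul, Complex.norm_exp]; simp
    have n1 : ‖(κ' : SL2C) 0 1‖ = ‖(κ : SL2C) 0 1‖ := by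
      rw [e1, norm_mul, Complex.norm_exp]; simp
    apply Subtype.ext
    simp only [hopf, e2, n0, n1]

instance : CompactSpace SU2 := isCompact_iff_compactSpace.1 isCompact_SU2

/-- A product with the identity need not preserve quotient maps. Compactness of `SU(2)` makes the
Hopf map proper, and properness survives products. -/
theorem nonempty_homeomorph_of_littleGroup_eq_Gam (hw : w ≤ -1) {φ : WFun w s} (hφ : φ ≠ 0)
    (h : littleGroup φ = Gam) : Nonempty (Orbit φ ≃ₜ R3 × S2) := by
  have hp : IsProperMap (Prod.map (id : R3 → R3) hopf) :=
    isProperMap_id.prodMap continuous_hopf.isProperMap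
  have hq : IsQuotientMap (Prod.map (id : R3 → R3) hopf) :=
    hp.isClosedMap.isQuotientMap hp.continuous (Function.surjective_id.prodMap hopf_surjective)
  obtain ⟨e, -⟩ := exists_homeomorph_of_isQuotientMap hw hφ
    (hq.comp polarHomeomorph.isQuotientMap) fun Λ M => by
      rw [h]; exact polarHomeomorph_prodMap_eq_iff Gam_le_SU2 (fun _ _ => hopf_eq_iff) Λ M
  exact ⟨e⟩

/-! ### `SU(2)` as the three-sphere, and projective space. -/

theorem norm_sq_R4 (k : EuclideanSpace ℝ (Fin 4)) :
    ‖k‖ ^ 2 = k 0 ^ 2 + k 1 ^ 2 + k 2 ^ 2 + k 3 ^ 2 := by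
  rw [EuclideanSpace.norm_sq_eq, Fin.sum_univ_four]
  simp only [Real.norm_eq_abs, sq_abs]

/-- `SU(2)` is the three-sphere. -/
noncomputable def suHomeomorph : SU2 ≃ₜ S3 where
  toFun κ := ⟨!₂[((κ : SL2C) 0 0).re, ((κ : SL2C) 0 0).im, ((κ : SL2C) 0 1).re,
    ((κ : SL2C) 0 1).im], by
      have h := SU2_norm_sq κ.2
      rw [mem_sphere_zero_iff_norm, ← sq_eq_sq₀ (norm_nonneg _) zero_le_one, norm_sq_R4]
      simp only [Complex.sq_norm, Complex.normSq_apply] at h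
      simp
      linear_combination h⟩
  invFun n := ⟨suMk ⟨n.1 0, n.1 1⟩ ⟨n.1 2, n.1 3⟩ (by
      have := norm_sq_R4 n.1
      rw [mem_sphere_zero_iff_norm.1 n.2] at this
      rw [Complex.sq_norm, Complex.sq_norm, Complex.normSq_mk, Complex.normSq_mk]
      linear_combination -this), suMk_mem _ _ _⟩
  left_inv κ := by
    apply Subtype.ext
    obtain ⟨h1, h2⟩ := mem_SU2_iff.1 κ.2
    apply sl_ext
    · rfl
    · rfl
    · exact h2.symm
    · exact h1.symm
  right_inv n := by
    apply Subtype.ext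
    ext i
    fin_cases i <;> rfl
  continuous_toFun := by
    have := fun i j => (continuous_entry i j).comp (continuous_subtype_val (p := (· ∈ SU2)))
    refine Continuous.subtype_mk ((PiLp.continuous_toLp 2 _).comp (continuous_pi fun i => ?_)) _
    fin_cases i
    · exact Complex.continuous_re.comp (this 0 0)
    · exact Complex.continuous_im.comp (this 0 0)
    · exact Complex.continuous_re.comp (this 0 1)
    · exact Complex.continuous_im.comp (this 0 1)
  continuous_invFun := by
    have hc : ∀ i, Continuous fun n : S3 => n.1 i := fun i => by fun_prop
    have h1 : ∀ i j, Continuous fun n : S3 => (⟨n.1 i, n.1 j⟩ : ℂ) := fun i j =>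
      Complex.equivRealProdCLM.symm.continuous.comp ((hc i).prodMk (hc j))
    refine Continuous.subtype_mk (continuous_sl_iff.2 ?_) _
    simp only [Fin.forall_fin_two]
    exact ⟨⟨h1 0 1, h1 2 3⟩, (Complex.continuous_conj.comp (h1 2 3)).neg,
      Complex.continuous_conj.comp (h1 0 1)⟩

theorem suHomeomorph_neg (κ : SL2C) (h : κ ∈ SU2) (h' : -κ ∈ SU2) :
    suHomeomorph ⟨-κ, h'⟩ = -suHomeomorph ⟨κ, h⟩ := by
  apply Subtype.ext
  ext i
  fin_cases i <;> simp [suHomeomorph]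

theorem isOpenQuotientMap_mk_antipodal :
    IsOpenQuotientMap (Quotient.mk antipodal : S3 → RP3) := by
  refine ⟨Quotient.mk_surjective, continuous_quotient_mk', fun U hU => ?_⟩
  refine isQuotientMap_quotient_mk'.isOpen_preimage.1 ?_
  have : (Quotient.mk antipodal : S3 → RP3) ⁻¹' (Quotient.mk antipodal '' U) =
      U ∪ (fun x => -x) ⁻¹' U := by
    ext x
    constructor
    · rintro ⟨y, hy, hxy⟩
      rcases Quotient.exact hxy with rfl | rfl
      · exact Or.inl hy
      · exact Or.inr hy
    · rintro (hx | hx)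
      · exact ⟨x, hx, rfl⟩
      · exact ⟨-x, hx, Quotient.sound (Or.inr rfl)⟩
  change IsOpen ((Quotient.mk antipodal : S3 → RP3) ⁻¹' (Quotient.mk antipodal '' U))
  rw [this]
  exact hU.union (hU.preimage continuous_neg)

theorem mk_suHomeomorph_eq_iff {κ κ' : SU2} :
    (Quotient.mk antipodal (suHomeomorph κ) : RP3) = Quotient.mk antipodal (suHomeomorph κ') ↔
      (κ : SL2C)⁻¹ * κ' ∈ Z2 := by
  have h' : -(κ' : SL2C) ∈ SU2 := by
    rw [← mul_neg_one]
    refine SU2.mul_mem κ'.2 ?_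
    rw [← rotZ_two_pi]
    exact rotZ_mem_SU2 _
  rw [Quotient.eq]
  change suHomeomorph κ = suHomeomorph κ' ∨ suHomeomorph κ = -suHomeomorph κ' ↔
    (κ : SL2C)⁻¹ * κ' = 1 ∨ (κ : SL2C)⁻¹ * κ' = -1
  have e : -suHomeomorph κ' = suHomeomorph ⟨-κ', h'⟩ := (suHomeomorph_neg _ κ'.2 h').symm
  rw [e, suHomeomorph.injective.eq_iff, suHomeomorph.injective.eq_iff, inv_mul_eq_iff_eq_mul,
    inv_mul_eq_iff_eq_mul, mul_one, mul_neg_one, Subtype.ext_iff, Subtype.ext_iff]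
  refine or_congr eq_comm ⟨fun h => ?_, fun h => ?_⟩
  · rw [h, neg_neg]
  · exact (neg_eq_iff_eq_neg.2 h).symm

theorem Z2_le_SU2 : Z2 ≤ SU2 := by
  rintro x (rfl | rfl)
  · exact SU2.one_mem
  · rw [← rotZ_two_pi]
    exact rotZ_mem_SU2 _

/-- Here openness of the antipodal quotient is the property stable under products. -/
theorem nonempty_homeomorph_of_littleGroup_eq_Z2 (hw : w ≤ -1) {φ : WFun w s} (hφ : φ ≠ 0)
    (h : littleGroup φ = Z2) : Nonempty (Orbit φ ≃ₜ R3 × RP3) := by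
  have hq : IsOpenQuotientMap (Prod.map (id : R3 → R3)
      ((Quotient.mk antipodal : S3 → RP3) ∘ suHomeomorph)) :=
    IsOpenQuotientMap.id.prodMap
      (isOpenQuotientMap_mk_antipodal.comp suHomeomorph.isOpenQuotientMap)
  obtain ⟨e, -⟩ := exists_homeomorph_of_isQuotientMap hw hφ
    (hq.isQuotientMap.comp polarHomeomorph.isQuotientMap) fun Λ M => by
      rw [h]; exact polarHomeomorph_prodMap_eq_iff Z2_le_SU2 (fun _ _ => mk_suHomeomorph_eq_iff) Λ M
  exact ⟨e⟩

theorem exists_homeomorph_of_littleGroup_eq_SU2 (hw : w ≤ -1) {φ : WFun w s} (hφ : φ ≠ 0)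
    (h : littleGroup φ = SU2) :
    ∃ e : Orbit φ ≃ₜ R3, ∀ Λ, e (orbitPoint φ Λ) = hyperVec Λ :=
  exists_homeomorph_of_isQuotientMap hw hφ isQuotientMap_hyperVec fun Λ M => by
    rw [h, hyperVec_eq_iff]

end WeightedSphere

namespace WeightedSphere

/-! ### Coordinates on the orbits -/

variable {w : ℝ} {s : ℤ}

theorem orbitPoint_mul_of_mem {φ : WFun w s} {g : SL2C} (hg : g ∈ littleGroup φ) (Λ : SL2C) :
    orbitPoint φ (Λ * g) = orbitPoint φ Λ :=
  (orbitPoint_eq_iff.2 (by simpa using hg)).symm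

theorem orbitPoint_neg (φ : WFun w s) (Λ : SL2C) : orbitPoint φ (-Λ) = orbitPoint φ Λ := by
  rw [← mul_neg_one]
  exact orbitPoint_mul_of_mem (Z2_le_littleGroup φ (Or.inr rfl)) Λ

/-- Rotations about the axis normalize the triangular matrices, turning only `ζ`. A rotation can
thus be moved to the far right and absorbed by `Γ`. -/
theorem rotZ_mul_tri (x t : ℝ) (ζ : ℂ) :
    rotZ x * tri t ζ = tri t (Complex.exp (Complex.I * x) * ζ) * rotZ x := by
  have e : Complex.exp (Complex.I * x) * Complex.exp (-(Complex.I * x / 2)) =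
      Complex.exp (Complex.I * x / 2) := by
    rw [← Complex.exp_add]; congr 1; ring
  apply sl_ext <;> simp only [mul_apply', rotZ_apply_zero_zero, rotZ_apply_zero_one,
    rotZ_apply_one_zero, rotZ_apply_one_one, tri_apply_zero_zero, tri_apply_zero_one,
    tri_apply_one_zero, tri_apply_one_one]
  · ring
  · ring
  · linear_combination -ζ * e
  · ring

theorem gamCoord_eq (t u v φ θ : ℝ) : gamCoord (t, u, v, φ, θ) =
    rotZ φ * rotY θ * tri t ((u + v * Complex.I) * Real.exp (-(t / 2))) := by
  rw [gamCoord, mul_assoc, nullRot_mul_boostZ]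

theorem lorentzCoord_eq (t u v φ ψ θ : ℝ) : lorentzCoord (t, u, v, φ, ψ, θ) =
    rotZ φ * rotY θ * rotZ ψ * tri t (Real.exp (t / 2) * (u + v * Complex.I)) := by
  rw [lorentzCoord, mul_assoc, boostZ_mul_nullRot]

/-- The period of `rotZ` is `4π`, but half of it only costs a sign, and `-1` lies in every little
group. -/
theorem exists_rotZ_mem_Ico (x : ℝ) :
    ∃ y ∈ Set.Ico 0 (2 * Real.pi), rotZ x = rotZ y ∨ rotZ x = -rotZ y := by
  have key : ∀ (n : ℕ) (y : ℝ), rotZ (y + n * (2 * Real.pi)) = rotZ y ∨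
      rotZ (y + n * (2 * Real.pi)) = -rotZ y := by
    intro n y
    induction n with
    | zero => simp
    | succ n ih =>
      rw [show y + (n + 1 : ℕ) * (2 * Real.pi) = y + n * (2 * Real.pi) + 2 * Real.pi by
        push_cast; ring, rotZ_add_two_pi]
      rcases ih with h | h
      · exact Or.inr (by rw [h])
      · exact Or.inl (by rw [h, neg_neg])
  refine ⟨toIcoMod Real.two_pi_pos 0 x, by simpa using toIcoMod_mem_Ico Real.two_pi_pos 0 x, ?_⟩
  have h := toIcoMod_add_toIcoDiv_zsmul Real.two_pi_pos 0 x
  rw [zsmul_eq_mul] at h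
  generalize toIcoMod Real.two_pi_pos 0 x = y at *
  generalize toIcoDiv Real.two_pi_pos 0 x = m at *
  obtain ⟨n, rfl | rfl⟩ := m.eq_nat_or_neg
  · rw [← h]; exact key n y
  · rcases key n x with h' | h' <;>
    · have : x + n * (2 * Real.pi) = y := by rw [← h]; push_cast; ring
      rw [this] at h'
      rw [h']; simp

theorem image_gamCoord {φ : WFun w s} (h : Gam ≤ littleGroup φ) :
    (fun y => orbitPoint φ (gamCoord y)) '' gamRange = Set.univ := by
  refine Set.eq_univ_of_forall fun x => ?_
  obtain ⟨Λ, rfl⟩ := orbitPoint_surjective φ x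
  obtain ⟨κ, hκ, t, ζ, rfl⟩ := exists_SU2_mul_tri Λ
  obtain ⟨a, b, hab⟩ := exists_euler hκ
  have hθ := two_mul_arccos_norm_mem κ
  generalize 2 * Real.arccos ‖κ 0 0‖ = θ at *
  obtain ⟨u, v, huv⟩ := tri_eq_nullRot_mul_boostZ t (Complex.exp (Complex.I * b) * ζ)
  obtain ⟨a', ha', hrot⟩ := exists_rotZ_mem_Ico a
  refine ⟨(t, u, v, a', θ), ⟨ha', hθ⟩, ?_⟩
  have e : κ * tri t ζ = rotZ a * rotY θ * nullRot u v * boostZ t * rotZ b := by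
    rw [hab, mul_assoc, rotZ_mul_tri, huv]; group
  rw [e, orbitPoint_mul_of_mem (h (rotZ_mem_Gam b))]
  rcases hrot with hr | hr
  · rw [hr]; rfl
  · rw [hr, neg_mul, neg_mul, neg_mul, orbitPoint_neg]; rfl

theorem image_lorentzCoord (φ : WFun w s) :
    (fun x => orbitPoint φ (lorentzCoord x)) '' lorentzRange = Set.univ := by
  refine Set.eq_univ_of_forall fun x => ?_
  obtain ⟨Λ, rfl⟩ := orbitPoint_surjective φ x
  obtain ⟨κ, hκ, t, ζ, rfl⟩ := exists_SU2_mul_tri Λ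
  obtain ⟨a, b, hab⟩ := exists_euler hκ
  have hθ := two_mul_arccos_norm_mem κ
  generalize 2 * Real.arccos ‖κ 0 0‖ = θ at *
  obtain ⟨u, v, huv⟩ := tri_eq_boostZ_mul_nullRot t ζ
  obtain ⟨a', ha', hra⟩ := exists_rotZ_mem_Ico a
  obtain ⟨b', hb', hrb⟩ := exists_rotZ_mem_Ico b
  refine ⟨(t, u, v, a', b', θ), ⟨ha', hb', hθ⟩, ?_⟩
  rw [hab, huv]
  simp only [lorentzCoord]
  rcases hra with hr | hr <;> rcases hrb with hr' | hr' <;> rw [hr, hr'] <;>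
    simp only [neg_mul, mul_neg, neg_neg, orbitPoint_neg, mul_assoc]

theorem norm_exp_ofReal_mul_I' (x : ℂ) (hx : x.im = 0) : ‖Complex.exp (x * Complex.I)‖ = 1 := by
  rw [Complex.norm_exp]; simp [hx]

theorem eq_of_exp_eq {x y : ℝ} (hx : x ∈ Set.Ico 0 (2 * Real.pi)) (hy : y ∈ Set.Ico 0 (2 * Real.pi))
    (h : Complex.exp (Complex.I * x) = Complex.exp (Complex.I * y)) : x = y := by
  obtain ⟨n, hn⟩ := Complex.exp_eq_exp_iff_exists_int.1 h
  have e : x = y + n * (2 * Real.pi) := by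
    have : ((x : ℝ) : ℂ) = ((y + n * (2 * Real.pi) : ℝ) : ℂ) := by
      apply mul_left_cancel₀ Complex.I_ne_zero
      rw [hn]; push_cast; ring
    exact_mod_cast this
  have hp := Real.two_pi_pos
  have h1 : (n : ℝ) < 1 := by
    by_contra hc
    push Not at hc
    nlinarith [hx.2, hy.1]
  have h2 : -1 < (n : ℝ) := by
    by_contra hc
    push Not at hc
    nlinarith [hx.1, hy.2]
  have h3 : n = 0 := by
    have h1' : n < 1 := by exact_mod_cast h1
    have h2' : -1 < n := by exact_mod_cast h2
    omega
  simpa [h3] using e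

/-- The moduli of the first column give `θ`, and both are nonzero off the poles. The phases give `(φ
± ψ)/2` up to the common sign `ε`, which cancels in the product and the quotient of the two phases.
-/
theorem euler_unique {φ θ ψ φ' θ' ψ' : ℝ} (hθ : θ ∈ Set.Ioo 0 Real.pi)
    (hθ' : θ' ∈ Set.Ioo 0 Real.pi) {ε : ℂ} (hε : ε * ε = 1)
    (h0 : (rotZ φ * rotY θ * rotZ ψ) 0 0 = ε * (rotZ φ' * rotY θ' * rotZ ψ') 0 0)
    (h1 : (rotZ φ * rotY θ * rotZ ψ) 1 0 = ε * (rotZ φ' * rotY θ' * rotZ ψ') 1 0) :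
    θ = θ' ∧ Complex.exp (Complex.I * φ) = Complex.exp (Complex.I * φ') ∧
      Complex.exp (Complex.I * ψ) = Complex.exp (Complex.I * ψ') := by
  rw [euler_apply_zero_zero, euler_apply_zero_zero] at h0
  rw [euler_apply_one_zero, euler_apply_one_zero] at h1
  have hεn : ‖ε‖ = 1 := by
    have := congrArg norm hε
    rw [norm_mul, norm_one] at this
    nlinarith [norm_nonneg ε]
  have hcos : ∀ x ∈ Set.Ioo 0 Real.pi, 0 < Real.cos (x / 2) := fun x hx =>
    Real.cos_pos_of_mem_Ioo ⟨by linarith [hx.1, Real.pi_pos], by linarith [hx.2]⟩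
  have hsin : ∀ x ∈ Set.Ioo 0 Real.pi, 0 < Real.sin (x / 2) := fun x hx =>
    Real.sin_pos_of_pos_of_lt_pi (by linarith [hx.1]) (by linarith [hx.2, Real.pi_pos])
  have hc : Real.cos (θ / 2) = Real.cos (θ' / 2) := by
    have := congrArg norm h0
    rw [norm_mul, norm_mul, norm_mul, hεn, norm_exp_ofReal_mul_I' _ (by simp),
      norm_exp_ofReal_mul_I' _ (by simp), Complex.norm_real, Complex.norm_real, Real.norm_eq_abs,
      Real.norm_eq_abs, abs_of_pos (hcos θ hθ), abs_of_pos (hcos θ' hθ')] at this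
    linarith
  have hθθ : θ = θ' := by
    have := Real.injOn_cos ⟨by linarith [hθ.1], by linarith [hθ.2, Real.pi_pos]⟩
      ⟨by linarith [hθ'.1], by linarith [hθ'.2, Real.pi_pos]⟩ hc
    linarith
  subst hθθ
  have hc0 : (Real.cos (θ / 2) : ℂ) ≠ 0 := by exact_mod_cast (hcos θ hθ).ne'
  have hs0 : (Real.sin (θ / 2) : ℂ) ≠ 0 := by exact_mod_cast (hsin θ hθ).ne'
  have f0 : Complex.exp (-(φ + ψ) / 2 * Complex.I) =
      ε * Complex.exp (-(φ' + ψ') / 2 * Complex.I) := by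
    apply mul_left_cancel₀ hc0; linear_combination h0
  have f1 : Complex.exp ((φ - ψ) / 2 * Complex.I) =
      ε * Complex.exp ((φ' - ψ') / 2 * Complex.I) := by
    apply mul_left_cancel₀ hs0; linear_combination h1
  have f0' : Complex.exp ((φ + ψ) / 2 * Complex.I) = ε * Complex.exp ((φ' + ψ') / 2 * Complex.I) := by
    have a1 : ∀ x : ℂ, Complex.exp (x / 2 * Complex.I) * Complex.exp (-x / 2 * Complex.I) = 1 := by
      intro x; rw [← Complex.exp_add, ← Complex.exp_zero]; congr 1; ring
    have b1 := a1 (φ + ψ)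
    have b2 := a1 (φ' + ψ')
    rw [f0] at b1
    have hne : Complex.exp (-(φ' + ψ') / 2 * Complex.I) ≠ 0 := Complex.exp_ne_zero _
    apply mul_right_cancel₀ hne
    linear_combination ε * b1 - ε * b2 -
      Complex.exp ((φ + ψ) / 2 * Complex.I) * Complex.exp (-(φ' + ψ') / 2 * Complex.I) * hε
  refine ⟨rfl, ?_, ?_⟩
  · have e : ∀ x y : ℂ, Complex.exp (Complex.I * x) =
        Complex.exp ((x + y) / 2 * Complex.I) * Complex.exp ((x - y) / 2 * Complex.I) := by
      intro x y; rw [← Complex.exp_add]; congr 1; ring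
    rw [e φ ψ, e φ' ψ', f0', f1]
    linear_combination Complex.exp ((φ' + ψ') / 2 * Complex.I) *
      Complex.exp ((φ' - ψ') / 2 * Complex.I) * hε
  · have e : ∀ x y : ℂ, Complex.exp ((x - y) / 2 * Complex.I) * Complex.exp (Complex.I * y) =
        Complex.exp ((x + y) / 2 * Complex.I) := by
      intro x y; rw [← Complex.exp_add]; congr 1; ring
    have e1 := e φ ψ
    have e2 := e φ' ψ'
    have hne : Complex.exp ((φ - ψ) / 2 * Complex.I) ≠ 0 := Complex.exp_ne_zero _
    apply mul_left_cancel₀ hne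
    rw [e1, f0', f1]
    linear_combination -ε * e2

/-- Two parameters of one point differ by a rotation on the right. Moving it to the left of the
triangular factor makes it a third Euler angle. Uniqueness identifies it with angle `0` modulo `2π`,
so that `ζ` is not turned. -/
theorem injOn_gamCoord {φ : WFun w s} (h : littleGroup φ = Gam) :
    Set.InjOn (fun y => orbitPoint φ (gamCoord y)) gamRegularRange := by
  rintro ⟨t, u, v, a, θ⟩ hy ⟨t', u', v', a', θ'⟩ hy' he
  simp only [orbitPoint_eq_iff, h] at he
  obtain ⟨x, hx⟩ := he
  have e : gamCoord (t', u', v', a', θ') = gamCoord (t, u, v, a, θ) * rotZ x := by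
    rw [hx]; group
  rw [gamCoord_eq, gamCoord_eq] at e
  set ζ := (u + v * Complex.I) * Real.exp (-(t / 2)) with hζ
  have e1 : tri t ζ * rotZ x = rotZ x * tri t (Complex.exp (Complex.I * (-x : ℝ)) * ζ) := by
    rw [rotZ_mul_tri, ← mul_assoc (Complex.exp _), ← Complex.exp_add]
    simp
  rw [mul_assoc _ (tri t ζ), e1, ← mul_assoc] at e
  obtain ⟨hκ, rfl, hz⟩ := SU2_mul_tri_injective
    (SU2.mul_mem (rotZ_mem_SU2 _) (rotY_mem_SU2 _)) (euler_mem_SU2 _ _ _) e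
  have hκ' : rotZ a' * rotY θ' * rotZ 0 = rotZ a * rotY θ * rotZ x := by
    rw [rotZ_zero, mul_one, hκ]
  obtain ⟨rfl, h1, h2⟩ := euler_unique (ε := 1) hy'.2 hy.2 (mul_one 1)
    (by rw [one_mul, hκ']) (by rw [one_mul, hκ'])
  have ha : a' = a := eq_of_exp_eq hy'.1 hy.1 h1
  have hx1 : Complex.exp (Complex.I * (-x : ℝ)) = 1 := by
    rw [Complex.ofReal_neg, mul_neg, Complex.exp_neg, ← h2]; simp
  rw [hx1, one_mul, hζ] at hz
  have hexp : (Real.exp (-(t' / 2)) : ℂ) ≠ 0 := by exact_mod_cast (Real.exp_pos _).ne'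
  have huv := mul_right_cancel₀ hexp hz
  have hu : u' = u := by simpa using congrArg Complex.re huv
  have hv : v' = v := by simpa using congrArg Complex.im huv
  rw [ha, hu, hv]

theorem injOn_lorentzCoord {φ : WFun w s} (h : littleGroup φ = Z2) :
    Set.InjOn (fun x => orbitPoint φ (lorentzCoord x)) lorentzRegularRange := by
  rintro ⟨t, u, v, a, b, θ⟩ hy ⟨t', u', v', a', b', θ'⟩ hy' he
  simp only [orbitPoint_eq_iff, h] at he
  have key : ∃ ε : SL2C, (ε = 1 ∨ ε = -1) ∧
      lorentzCoord (t', u', v', a', b', θ') = ε * lorentzCoord (t, u, v, a, b, θ) := by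
    rcases he with he | he
    · exact ⟨1, Or.inl rfl, by rw [one_mul, inv_mul_eq_one.1 he]⟩
    · refine ⟨-1, Or.inr rfl, ?_⟩
      rw [inv_mul_eq_iff_eq_mul.1 he]; simp
  obtain ⟨ε, hε, e⟩ := key
  rw [lorentzCoord_eq, lorentzCoord_eq, ← mul_assoc] at e
  have hεmem : ε ∈ SU2 := Z2_le_SU2 hε
  obtain ⟨hκ, rfl, hz⟩ := SU2_mul_tri_injective (euler_mem_SU2 _ _ _)
    (SU2.mul_mem hεmem (euler_mem_SU2 _ _ _)) e
  have key2 : ∃ δ : ℂ, δ * δ = 1 ∧ ∀ (M : SL2C) i j, (ε * M) i j = δ * M i j := by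
    rcases hε with rfl | rfl
    · exact ⟨1, by simp, by simp⟩
    · exact ⟨-1, by simp, by simp⟩
  obtain ⟨δ, hδ, hM⟩ := key2
  obtain ⟨rfl, h1, h2⟩ := euler_unique hy'.2.2 hy.2.2 hδ (by rw [hκ, hM]) (by rw [hκ, hM])
  have ha : a' = a := eq_of_exp_eq hy'.1 hy.1 h1
  have hb : b' = b := eq_of_exp_eq hy'.2.1 hy.2.1 h2
  have hexp : (Real.exp (t' / 2) : ℂ) ≠ 0 := by exact_mod_cast (Real.exp_pos _).ne'
  have huv := mul_left_cancel₀ hexp hz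
  have hu : u' = u := by simpa using congrArg Complex.re huv
  have hv : v' = v := by simpa using congrArg Complex.im huv
  rw [ha, hb, hu, hv]

end WeightedSphere

namespace WeightedSphere

/-! ### The invariant measure on the hyperboloid -/

variable {w : ℝ} {s : ℤ}

theorem measurePreserving_complex_prod_real :
    MeasurePreserving (fun p : ℂ × ℝ => (!₂[p.1.re, p.1.im, p.2] : R3)) := by
  have h1 : MeasurePreserving (Prod.map Complex.measurableEquivPi (id : ℝ → ℝ)) :=
    Complex.volume_preserving_equiv_pi.prod (MeasurePreserving.id volume)
  have h2 : MeasurePreserving (Prod.swap : (Fin 2 → ℝ) × ℝ → ℝ × (Fin 2 → ℝ)) :=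
    Measure.measurePreserving_swap
  have h3 := (volume_preserving_piFinSuccAbove (fun _ : Fin 3 => ℝ) 2).symm
  have h4 := PiLp.volume_preserving_toLp (Fin 3)
  have h := h4.comp (h3.comp (h2.comp h1))
  convert h using 1
  funext p
  ext i
  fin_cases i <;> rfl

theorem lintegral_R3 {f : R3 → ℝ≥0∞} (hf : Measurable f) :
    ∫⁻ k, f k = ∫⁻ q : ℂ, ∫⁻ z : ℝ, f !₂[q.re, q.im, z] := by
  rw [← measurePreserving_complex_prod_real.lintegral_comp hf]
  exact lintegral_prod _ (hf.comp measurePreserving_complex_prod_real.measurable).aemeasurable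

/-- Horospherical coordinates on the hyperboloid: `k₁ + i k₂ = q` and `k₀ + k₃ = e^τ`. -/
noncomputable def horo (q : ℂ) (τ : ℝ) : R3 :=
  !₂[q.re, q.im, (Real.exp τ - (1 + ‖q‖ ^ 2) * Real.exp (-τ)) / 2]

theorem sqrt_one_add_horo (q : ℂ) (τ : ℝ) :
    √(1 + ‖horo q τ‖ ^ 2) = (Real.exp τ + (1 + ‖q‖ ^ 2) * Real.exp (-τ)) / 2 := by
  rw [Real.sqrt_eq_iff_mul_self_eq (by positivity) (by positivity), norm_sq_R3, Complex.sq_norm,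
    Complex.normSq_apply]
  have e : Real.exp τ * Real.exp (-τ) = 1 := by rw [← Real.exp_add]; simp
  simp only [horo, Complex.sq_norm, Complex.normSq_apply]
  simp
  linear_combination -(1 + (q.re * q.re + q.im * q.im)) * e

theorem bijective_horo_height (m : ℝ) (hm : 0 < m) :
    Function.Bijective fun τ : ℝ => (Real.exp τ - m * Real.exp (-τ)) / 2 := by
  constructor
  · apply StrictMono.injective
    intro x y h
    have h1 := Real.exp_lt_exp.2 h
    have h2 := Real.exp_lt_exp.2 (neg_lt_neg h)
    have := mul_lt_mul_of_pos_left h2 hm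
    simp only
    linarith
  · intro z
    have hs : |z| < √(z ^ 2 + m) := by
      rw [← Real.sqrt_sq_eq_abs]
      exact Real.sqrt_lt_sqrt (sq_nonneg _) (by linarith)
    have hp : 0 < z + √(z ^ 2 + m) := by linarith [(abs_lt.1 hs).1]
    refine ⟨Real.log (z + √(z ^ 2 + m)), ?_⟩
    simp only
    rw [Real.exp_neg, Real.exp_log hp]
    have hsq := Real.mul_self_sqrt (show 0 ≤ z ^ 2 + m by positivity)
    field_simp
    linear_combination hsq

/-- The height is a diffeomorphism of the line, and its derivative in `τ` is `k₀` when `m = 1 +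
|q|²`. -/
theorem lintegral_horo_height (m : ℝ) (hm : 0 < m) (g : ℝ → ℝ≥0∞) :
    ∫⁻ z, g z = ∫⁻ τ : ℝ, ENNReal.ofReal ((Real.exp τ + m * Real.exp (-τ)) / 2) *
      g ((Real.exp τ - m * Real.exp (-τ)) / 2) := by
  have hb := bijective_horo_height m hm
  have hd : ∀ τ ∈ Set.univ, HasDerivWithinAt (fun τ : ℝ => (Real.exp τ - m * Real.exp (-τ)) / 2)
      ((Real.exp τ + m * Real.exp (-τ)) / 2) Set.univ τ := by
    intro τ _
    have h1 := Real.hasDerivAt_exp τ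
    have h2 := ((hasDerivAt_neg τ).exp).const_mul m
    have h3 := (h1.sub h2).div_const 2
    refine HasDerivAt.hasDerivWithinAt (h3.congr_deriv ?_)
    ring
  have h := lintegral_image_eq_lintegral_abs_deriv_mul MeasurableSet.univ hd hb.1.injOn g
  rw [Set.image_univ, hb.2.range_eq, setLIntegral_univ, setLIntegral_univ] at h
  rw [h]
  refine lintegral_congr fun τ => ?_
  rw [abs_of_pos (by positivity)]

/-- At fixed `q` the Jacobian `dk₃ / dτ = k₀` cancels the density `1 / k₀`, leaving Lebesgue measure
`dq dτ`. -/
theorem lintegral_hyperboloidMeasure {f : R3 → ℝ≥0∞} (hf : Measurable f) :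
    ∫⁻ k, f k ∂hyperboloidMeasure = ∫⁻ q : ℂ, ∫⁻ τ : ℝ, f (horo q τ) := by
  have hdm : Measurable fun k : R3 => ENNReal.ofReal (1 / √(1 + ‖k‖ ^ 2)) := by fun_prop
  rw [hyperboloidMeasure, lintegral_withDensity_eq_lintegral_mul _ hdm hf,
    lintegral_R3 (hdm.mul hf)]
  refine lintegral_congr fun q => ?_
  rw [lintegral_horo_height (1 + ‖q‖ ^ 2) (by positivity)]
  refine lintegral_congr fun τ => ?_
  rw [Pi.mul_apply, ← mul_assoc]
  change _ * ENNReal.ofReal (1 / √(1 + ‖horo q τ‖ ^ 2)) * f (horo q τ) = _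
  rw [sqrt_one_add_horo, ← ENNReal.ofReal_mul (by positivity), mul_one_div_cancel (by positivity),
    ENNReal.ofReal_one, one_mul]

/-- The lower triangular matrix that takes the origin of the hyperboloid to `horo q τ`. -/
noncomputable def horoLift (q : ℂ) (τ : ℝ) : SL2C := tri (-τ) (conj q * Real.exp (-(τ / 2)))

theorem hyperVec_horoLift (q : ℂ) (τ : ℝ) : hyperVec (horoLift q τ) = horo q τ := by
  have e0 : Real.exp (-(-τ / 2)) * Real.exp (-(τ / 2)) = 1 := by
    rw [← Real.exp_add]; simp [neg_div]
  have e1 : Real.exp (-(-τ / 2)) ^ 2 = Real.exp τ := by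
    rw [← Real.exp_nat_mul]; congr 1; push_cast; ring
  have e2 : Real.exp (-(τ / 2)) ^ 2 = Real.exp (-τ) := by
    rw [← Real.exp_nat_mul]; congr 1; push_cast; ring
  have hq : horoLift q τ 0 0 * conj (horoLift q τ 1 0) + horoLift q τ 0 1 * conj (horoLift q τ 1 1)
      = q := by
    rw [horoLift, tri_apply_zero_zero, tri_apply_one_zero, tri_apply_zero_one]
    simp only [map_mul, Complex.conj_conj, Complex.conj_ofReal, zero_mul, add_zero]
    have : ((Real.exp (-(-τ / 2)) : ℝ) : ℂ) * (Real.exp (-(τ / 2)) : ℝ) = 1 := by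
      exact_mod_cast e0
    linear_combination q * this
  have h3 : (‖horoLift q τ 0 0‖ ^ 2 + ‖horoLift q τ 0 1‖ ^ 2 - ‖horoLift q τ 1 0‖ ^ 2 -
      ‖horoLift q τ 1 1‖ ^ 2) / 2 = (Real.exp τ - (1 + ‖q‖ ^ 2) * Real.exp (-τ)) / 2 := by
    rw [horoLift, tri_apply_zero_zero, tri_apply_one_zero, tri_apply_zero_one, tri_apply_one_one,
      norm_mul, RCLike.norm_conj, mul_pow, Complex.norm_real, Complex.norm_real, Complex.norm_real,
      norm_zero, Real.norm_eq_abs, Real.norm_eq_abs, Real.norm_eq_abs, sq_abs, sq_abs, sq_abs,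
      neg_div, neg_neg, e2, show Real.exp (τ / 2) ^ 2 = Real.exp τ by rw [← e1, neg_div, neg_neg]]
    ring
  rw [hyperVec, hq, h3, horo]

theorem continuous_horoLift : Continuous fun p : ℂ × ℝ => horoLift p.1 p.2 := by
  refine continuous_tri.comp (Continuous.prodMk (by fun_prop) ?_)
  refine (Complex.continuous_conj.comp continuous_fst).mul ?_
  fun_prop

theorem continuous_smul_orbit (φ : WFun w s) (M : SL2C) : Continuous fun x : Orbit φ => M • x :=
  continuous_induced_rng.2 (by
    change Continuous fun x : Orbit φ => M • (x : WFun w s)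
    exact (continuous_const_smul M).comp continuous_subtype_val)

/-- Triangular matrices act in horospherical coordinates by a translation of `τ` and a `τ`-dependent
translation of `q`. -/
theorem tri_mul_horoLift (t : ℝ) (c q : ℂ) (τ : ℝ) :
    tri t c * horoLift q τ = horoLift (q + conj c * Real.exp (τ - t / 2)) (τ - t) := by
  rw [horoLift, tri_mul, horoLift]
  congr 1
  · ring
  · have e1 : ((Real.exp (τ - t / 2) : ℝ) : ℂ) * (Real.exp (-((τ - t) / 2)) : ℝ) =
        (Real.exp (-(-τ / 2)) : ℝ) := by
      rw [← Complex.ofReal_mul, ← Real.exp_add]; congr 2; ring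
    have e2 : ((Real.exp (t / 2) : ℝ) : ℂ) * (Real.exp (-(τ / 2)) : ℝ) =
        (Real.exp (-((τ - t) / 2)) : ℝ) := by
      rw [← Complex.ofReal_mul, ← Real.exp_add]; congr 2; ring
    rw [map_add, map_mul, Complex.conj_conj, Complex.conj_ofReal]
    linear_combination conj q * e2 - c * e1

theorem rotZ_mul_horoLift (x : ℝ) (q : ℂ) (τ : ℝ) :
    rotZ x * horoLift q τ = horoLift (Circle.exp (-x) * q) τ * rotZ x := by
  rw [horoLift, rotZ_mul_tri, horoLift]
  have : conj ((Circle.exp (-x) : Circle) : ℂ) = Complex.exp (Complex.I * x) := by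
    rw [Circle.coe_exp, ← Complex.exp_conj]
    congr 1
    simp [mul_comm]
  rw [map_mul, this, mul_assoc]

/-- The rotation by `π` that exchanges the two fixed points of the boosts. -/
noncomputable def weyl : SL2C := suMk 0 1 (by simp)

theorem weyl_apply_zero_zero : weyl 0 0 = 0 := rfl
theorem weyl_apply_zero_one : weyl 0 1 = 1 := rfl
theorem weyl_apply_one_zero : weyl 1 0 = -1 := by simp [weyl, suMk]
theorem weyl_apply_one_one : weyl 1 1 = 0 := by simp [weyl, suMk]

/-- The rotation exchanges `k₀ + k₃ = e^τ` with `k₀ - k₃`, and their product is `1 + |q|²`. The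
matrices themselves agree only up to `SU(2)` on the right. -/
theorem hyperVec_weyl_mul_horoLift (q : ℂ) (τ : ℝ) :
    hyperVec (weyl * horoLift q τ) =
      hyperVec (horoLift (-conj q) (Real.log (1 + ‖q‖ ^ 2) - τ)) := by
  have h := hyperVec_horoLift q τ
  have h0 : (horoLift q τ 0 0 * conj (horoLift q τ 1 0) + horoLift q τ 0 1 * conj (horoLift q τ 1 1)).re
      = q.re := congrArg (fun k : R3 => k 0) h
  have h1 : (horoLift q τ 0 0 * conj (horoLift q τ 1 0) + horoLift q τ 0 1 * conj (horoLift q τ 1 1)).im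
      = q.im := congrArg (fun k : R3 => k 1) h
  have h2 : (‖horoLift q τ 0 0‖ ^ 2 + ‖horoLift q τ 0 1‖ ^ 2 - ‖horoLift q τ 1 0‖ ^ 2 -
      ‖horoLift q τ 1 1‖ ^ 2) / 2 = (Real.exp τ - (1 + ‖q‖ ^ 2) * Real.exp (-τ)) / 2 :=
    congrArg (fun k : R3 => k 2) h
  have hm : 0 < 1 + ‖q‖ ^ 2 := by positivity
  rw [hyperVec_horoLift, hyperVec, horo]
  simp only [mul_apply', weyl_apply_zero_zero, weyl_apply_zero_one, weyl_apply_one_zero,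
    weyl_apply_one_one, zero_mul, one_mul, zero_add, add_zero, neg_mul, map_neg, mul_neg, norm_neg,
    RCLike.norm_conj]
  have hexp : Real.exp (Real.log (1 + ‖q‖ ^ 2) - τ) = (1 + ‖q‖ ^ 2) * Real.exp (-τ) := by
    rw [sub_eq_add_neg, Real.exp_add, Real.exp_log hm]
  have hexp' : (1 + ‖q‖ ^ 2) * Real.exp (-(Real.log (1 + ‖q‖ ^ 2) - τ)) = Real.exp τ := by
    rw [neg_sub, Real.exp_sub, Real.exp_log hm]; field_simp
  generalize horoLift q τ 0 0 = a at *
  generalize horoLift q τ 0 1 = b at *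
  generalize horoLift q τ 1 0 = c at *
  generalize horoLift q τ 1 1 = d at *
  rw [hexp, hexp']
  have r0 : (-(c * conj a) + -(d * conj b)).re = (-conj q).re := by
    simp [Complex.mul_re] at h0 ⊢; linarith
  have r1 : (-(c * conj a) + -(d * conj b)).im = (-conj q).im := by
    simp [Complex.mul_im] at h1 ⊢; linarith
  have r2 : (‖c‖ ^ 2 + ‖d‖ ^ 2 - ‖a‖ ^ 2 - ‖b‖ ^ 2) / 2 =
      ((1 + ‖q‖ ^ 2) * Real.exp (-τ) - Real.exp τ) / 2 := by linarith
  rw [r0, r1, r2]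

theorem exists_tri_mul_rotZ {Λ : SL2C} (h : Λ 0 1 = 0) : ∃ t ζ x, Λ = tri t ζ * rotZ x := by
  obtain ⟨κ, hκ, t, ζ, rfl⟩ := exists_tri_mul_SU2 Λ
  rw [mul_apply', tri_apply_zero_zero, tri_apply_zero_one, zero_mul, add_zero] at h
  have h0 : κ 0 1 = 0 := (mul_eq_zero.1 h).resolve_left (by exact_mod_cast (Real.exp_pos _).ne')
  obtain ⟨x, hx⟩ := eq_rotZ_of_apply_eq_zero hκ h0
  exact ⟨t, ζ, x, by rw [hx]⟩

/-- The Bruhat decomposition. -/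
theorem bruhat (Λ : SL2C) : (∃ t ζ x, Λ = tri t ζ * rotZ x) ∨
    ∃ c t ζ x, Λ = tri 0 c * (weyl * (tri t ζ * rotZ x)) := by
  by_cases h : Λ 0 1 = 0
  · exact Or.inl (exists_tri_mul_rotZ h)
  · right
    -- The row operation with multiplier `Λ₁₁ / Λ₀₁` clears the lower right entry, and `weyl⁻¹`
    -- moves this zero to the upper right.
    have h0 : (weyl⁻¹ * ((tri 0 (Λ 1 1 / Λ 0 1))⁻¹ * Λ)) 0 1 = 0 := by
      rw [tri_inv]
      simp only [mul_apply', inv_apply_zero_zero, inv_apply_zero_one, weyl_apply_zero_one,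
        weyl_apply_one_one, tri_apply_one_zero, tri_apply_one_one]
      simp
      field_simp
      ring
    obtain ⟨t, ζ, x, hx⟩ := exists_tri_mul_rotZ h0
    exact ⟨_, t, ζ, x, by rw [← hx, mul_inv_cancel_left, mul_inv_cancel_left]⟩

/-- By the Bruhat decomposition three kinds of elements suffice: triangular matrices translate,
axial rotations turn `q`, and `weyl` reflects `τ` at fixed `q` and reflects `q`. Each preserves `dq
dτ`. -/
theorem lintegral_horoLift_smul {φ : WFun w s} (h : SU2 ≤ littleGroup φ) (M : SL2C)
    {F : Orbit φ → ℝ≥0∞} (hF : Measurable F) :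
    ∫⁻ q : ℂ, ∫⁻ τ : ℝ, F (M • orbitPoint φ (horoLift q τ)) =
      ∫⁻ q : ℂ, ∫⁻ τ : ℝ, F (orbitPoint φ (horoLift q τ)) := by
  have hm : ∀ {F : Orbit φ → ℝ≥0∞}, Measurable F →
      Measurable fun p : ℂ × ℝ => F (orbitPoint φ (horoLift p.1 p.2)) := fun hF =>
    hF.comp ((continuous_orbitPoint φ).comp continuous_horoLift).measurable
  have htri : ∀ t c {F : Orbit φ → ℝ≥0∞}, Measurable F →
      ∫⁻ q : ℂ, ∫⁻ τ : ℝ, F (tri t c • orbitPoint φ (horoLift q τ)) =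
        ∫⁻ q : ℂ, ∫⁻ τ : ℝ, F (orbitPoint φ (horoLift q τ)) := by
    intro t c F hF
    have hG := hm hF
    set G : ℂ × ℝ → ℝ≥0∞ := fun p => F (orbitPoint φ (horoLift p.1 p.2)) with hGdef
    have e : ∀ q τ, F (tri t c • orbitPoint φ (horoLift q τ)) =
        G (q + conj c * Real.exp (τ - t / 2), τ - t) := fun q τ => by
      rw [smul_orbitPoint, tri_mul_horoLift]
    simp only [e]
    change _ = ∫⁻ q : ℂ, ∫⁻ τ : ℝ, G (q, τ)
    -- The shift of `q` depends on `τ`, so the inner integral must be the one over `q`.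
    rw [lintegral_lintegral_swap (by fun_prop)]
    calc ∫⁻ τ : ℝ, ∫⁻ q : ℂ, G (q + conj c * Real.exp (τ - t / 2), τ - t) =
          ∫⁻ τ : ℝ, ∫⁻ q : ℂ, G (q, τ - t) := lintegral_congr fun τ =>
            lintegral_add_right_eq_self (fun q => G (q, τ - t)) _
      _ = ∫⁻ τ : ℝ, ∫⁻ q : ℂ, G (q, τ) :=
            lintegral_sub_right_eq_self (fun τ => ∫⁻ q : ℂ, G (q, τ)) t
      _ = _ := lintegral_lintegral_swap (by fun_prop)
  have hrot : ∀ x {F : Orbit φ → ℝ≥0∞}, Measurable F →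
      ∫⁻ q : ℂ, ∫⁻ τ : ℝ, F (rotZ x • orbitPoint φ (horoLift q τ)) =
        ∫⁻ q : ℂ, ∫⁻ τ : ℝ, F (orbitPoint φ (horoLift q τ)) := by
    intro x F hF
    have hG := hm hF
    have e : ∀ q τ, F (rotZ x • orbitPoint φ (horoLift q τ)) =
        F (orbitPoint φ (horoLift (rotation (Circle.exp (-x)) q) τ)) := fun q τ => by
      rw [smul_orbitPoint, rotZ_mul_horoLift, orbitPoint_mul_of_mem (h (rotZ_mem_SU2 x)),
        rotation_apply]
    simp only [e]
    exact (rotation (Circle.exp (-x))).measurePreserving.lintegral_comp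
      (f := fun q => ∫⁻ τ : ℝ, F (orbitPoint φ (horoLift q τ))) hG.lintegral_prod_right'
  have hweyl : ∀ {F : Orbit φ → ℝ≥0∞}, Measurable F →
      ∫⁻ q : ℂ, ∫⁻ τ : ℝ, F (weyl • orbitPoint φ (horoLift q τ)) =
        ∫⁻ q : ℂ, ∫⁻ τ : ℝ, F (orbitPoint φ (horoLift q τ)) := by
    intro F hF
    have hG := hm hF
    have e : ∀ q τ, F (weyl • orbitPoint φ (horoLift q τ)) =
        F (orbitPoint φ (horoLift (-conj q) (Real.log (1 + ‖q‖ ^ 2) - τ))) := fun q τ => by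
      rw [smul_orbitPoint, orbitPoint_eq_iff.2 (h (hyperVec_eq_iff.1
        (hyperVec_weyl_mul_horoLift q τ)))]
    simp only [e]
    calc ∫⁻ q : ℂ, ∫⁻ τ : ℝ, F (orbitPoint φ (horoLift (-conj q) (Real.log (1 + ‖q‖ ^ 2) - τ))) =
          ∫⁻ q : ℂ, ∫⁻ τ : ℝ, F (orbitPoint φ (horoLift (-conj q) τ)) :=
            lintegral_congr fun q => lintegral_sub_left_eq_self
              (fun τ => F (orbitPoint φ (horoLift (-conj q) τ))) _
      _ = ∫⁻ q : ℂ, ∫⁻ τ : ℝ, F (orbitPoint φ (horoLift q τ)) :=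
            (Complex.conjLIE.trans (LinearIsometryEquiv.neg ℝ)).measurePreserving.lintegral_comp
              (f := fun q => ∫⁻ τ : ℝ, F (orbitPoint φ (horoLift q τ))) hG.lintegral_prod_right'
  have hcomp : ∀ (M : SL2C) {F : Orbit φ → ℝ≥0∞}, Measurable F →
      Measurable fun x => F (M • x) := fun M _ hF => hF.comp (continuous_smul_orbit φ M).measurable
  rcases bruhat M with ⟨t, ζ, x, rfl⟩ | ⟨c, t, ζ, x, rfl⟩
  · simp only [mul_smul]
    rw [hrot x (hcomp (tri t ζ) hF), htri t ζ hF]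
  · simp only [mul_smul]
    rw [hrot x (hcomp (tri t ζ) (hcomp weyl (hcomp (tri 0 c) hF))),
      htri t ζ (hcomp weyl (hcomp (tri 0 c) hF)), hweyl (hcomp (tri 0 c) hF), htri 0 c hF]

theorem smulInvariantMeasure_of_lintegral {X : Type*} [MeasurableSpace X] [SMul SL2C X]
    {μ : Measure X} (hs : ∀ M : SL2C, Measurable fun x : X => M • x)
    (h : ∀ (M : SL2C) (F : X → ℝ≥0∞), Measurable F → ∫⁻ x, F (M • x) ∂μ = ∫⁻ x, F x ∂μ) :
    SMulInvariantMeasure SL2C X μ := by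
  refine ⟨fun M S hS => ?_⟩
  have := h M (S.indicator 1) (measurable_one.indicator hS)
  rw [lintegral_indicator_one hS] at this
  rw [← this, ← lintegral_indicator_one (hs M hS)]
  rfl

theorem isLorentzInvariantMeasure_hyperboloid {φ : WFun w s} (h : littleGroup φ = SU2)
    (e : Orbit φ ≃ₜ R3) (he : ∀ Λ, e (orbitPoint φ Λ) = hyperVec Λ) :
    IsLorentzInvariantMeasure (hyperboloidMeasure.map e.symm) := by
  have hes : Measurable e.symm := e.symm.continuous.measurable
  have hsymm : ∀ q τ, e.symm (horo q τ) = orbitPoint φ (horoLift q τ) := fun q τ => by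
    rw [e.symm_apply_eq, he, hyperVec_horoLift]
  have hintg : ∀ {F : Orbit φ → ℝ≥0∞}, Measurable F →
      ∫⁻ x, F x ∂(hyperboloidMeasure.map e.symm) =
        ∫⁻ q : ℂ, ∫⁻ τ : ℝ, F (orbitPoint φ (horoLift q τ)) := by
    intro F hF
    rw [lintegral_map hF hes]
    refine (lintegral_hyperboloidMeasure (hF.comp hes)).trans ?_
    simp only [Function.comp_apply, hsymm]
  refine ⟨fun h0 => ?_, fun K hK => ?_, smulInvariantMeasure_of_lintegral
    (fun M => (continuous_smul_orbit φ M).measurable) fun M F hF => ?_⟩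
  · have := hintg (F := fun _ => 1) measurable_const
    rw [h0] at this
    simp at this
  · rw [Measure.map_apply hes hK.isClosed.measurableSet, ← e.image_eq_preimage_symm]
    have hK' := hK.image e.continuous
    refine lt_of_le_of_lt ?_ (hK'.measure_lt_top (μ := volume))
    rw [hyperboloidMeasure, withDensity_apply _ hK'.isClosed.measurableSet, ← setLIntegral_one]
    refine lintegral_mono fun k => ?_
    rw [← ENNReal.ofReal_one]
    refine ENNReal.ofReal_le_ofReal ?_
    rw [div_le_one (by positivity)]
    exact Real.one_le_sqrt.2 (by nlinarith [sq_nonneg ‖k‖])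
  · refine (hintg (hF.comp (continuous_smul_orbit φ M).measurable)).trans ?_
    rw [hintg hF]
    exact lintegral_horoLift_smul h.ge M hF

end WeightedSphere

namespace WeightedSphere

/-! ### Polar coordinates in `ℂ²` -/

theorem lintegral_complex_polar {f : ℂ → ℝ≥0∞} (hf : Measurable f) :
    ∫⁻ z, f z = ∫⁻ r in Set.Ioi (0 : ℝ), ∫⁻ α in Set.Ioo (-Real.pi) Real.pi,
      ENNReal.ofReal r * f (r * Complex.exp (α * Complex.I)) := by
  rw [← Complex.lintegral_comp_polarCoord_symm]
  have e : ∀ p : ℝ × ℝ, Complex.polarCoord.symm p = p.1 * Complex.exp (p.2 * Complex.I) := by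
    intro p
    rw [Complex.polarCoord_symm_apply, Complex.exp_mul_I, Complex.ofReal_cos, Complex.ofReal_sin]
  have hT : polarCoord.target = Set.Ioi (0 : ℝ) ×ˢ Set.Ioo (-Real.pi) Real.pi := rfl
  simp only [e, smul_eq_mul, hT]
  rw [Measure.volume_eq_prod, ← Measure.prod_restrict, lintegral_prod _ (by fun_prop)]

theorem lintegral_Ioo_comp_half (a b : ℝ) (f : ℝ → ℝ≥0∞) :
    ∫⁻ x in Set.Ioo a b, f (x / 2) = 2 * ∫⁻ x in Set.Ioo (a / 2) (b / 2), f x := by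
  have himg : (fun x : ℝ => 2 * x) '' Set.Ioo (a / 2) (b / 2) = Set.Ioo a b := by
    rw [Set.image_mul_left_Ioo two_pos]
    congr 1 <;> ring
  have h := lintegral_image_eq_lintegral_abs_deriv_mul (s := Set.Ioo (a / 2) (b / 2))
    (f := fun x : ℝ => 2 * x) (f' := fun _ => 2) measurableSet_Ioo
    (fun x _ => by simpa using ((hasDerivAt_id x).const_mul (2 : ℝ)).hasDerivWithinAt)
    (fun x _ y _ h => by simpa using h) fun x => f (x / 2)
  rw [himg] at h
  rw [h, ← lintegral_const_mul' _ _ (by norm_num)]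
  refine lintegral_congr fun x => ?_
  rw [mul_div_cancel_left₀ _ two_ne_zero]
  norm_num

theorem setLIntegral_Ioc_add_pi {h : ℝ → ℝ≥0∞} (hp : ∀ x, h (x + Real.pi) = h x) (a b : ℝ) :
    ∫⁻ x in Set.Ioc a (a + Real.pi), h x = ∫⁻ x in Set.Ioc b (b + Real.pi), h x := by
  refine (isAddFundamentalDomain_Ioc Real.pi_pos a).setLIntegral_eq
    (isAddFundamentalDomain_Ioc Real.pi_pos b) h ?_
  rintro ⟨g, hg⟩ x
  obtain ⟨n, rfl⟩ := AddSubgroup.mem_zmultiples_iff.1 hg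
  have hper : Function.Periodic h Real.pi := hp
  change h (n • Real.pi + x) = h x
  rw [add_comm]
  exact hper.zsmul n x

/-- The map `ψ ↦ (φ + ψ)/2` covers one period of length `π` with weight two, while `(-π, π)`
contains two periods. -/
theorem setLIntegral_half_angle {h : ℝ → ℝ≥0∞} (hp : ∀ x, h (x + Real.pi) = h x) (φ : ℝ) :
    ∫⁻ ψ in Set.Ico 0 (2 * Real.pi), h ((φ + ψ) / 2) =
      ∫⁻ β in Set.Ioo (-Real.pi) Real.pi, h β := by
  have h1 : ∫⁻ ψ in Set.Ico 0 (2 * Real.pi), h ((φ + ψ) / 2) =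
      2 * ∫⁻ x in Set.Ioc 0 (0 + Real.pi), h (x + φ / 2) := by
    rw [setLIntegral_congr Ioo_ae_eq_Ico.symm]
    have e : ∀ ψ : ℝ, h ((φ + ψ) / 2) = (fun x => h (x + φ / 2)) (ψ / 2) := by
      intro ψ; simp only; congr 1; ring
    simp only [e]
    rw [lintegral_Ioo_comp_half 0 (2 * Real.pi) (fun x => h (x + φ / 2)), zero_div,
      mul_div_cancel_left₀ _ two_ne_zero, zero_add, setLIntegral_congr Ioo_ae_eq_Ioc]
  have h2 : ∫⁻ x in Set.Ioc 0 (0 + Real.pi), h (x + φ / 2) = ∫⁻ x in Set.Ioc 0 (0 + Real.pi), h x := by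
    rw [setLIntegral_Ioc_add_pi hp 0 (φ / 2)]
    have := (measurePreserving_add_right volume (φ / 2)).setLIntegral_comp_preimage_emb
      (measurableEmbedding_addRight (φ / 2)) h (Set.Ioc (φ / 2) (φ / 2 + Real.pi))
    rw [← this]
    congr 2
    simp [zero_add, sub_self]
  have h3 : ∫⁻ β in Set.Ioo (-Real.pi) Real.pi, h β =
      (∫⁻ x in Set.Ioc (-Real.pi) (-Real.pi + Real.pi), h x) +
        ∫⁻ x in Set.Ioc 0 (0 + Real.pi), h x := by
    rw [neg_add_cancel, zero_add, setLIntegral_congr Ioo_ae_eq_Ioc,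
      ← Set.Ioc_union_Ioc_eq_Ioc (neg_nonpos.2 Real.pi_pos.le) Real.pi_pos.le]
    exact lintegral_union measurableSet_Ioc (Set.Ioc_disjoint_Ioc_of_le (le_refl (0 : ℝ)))
  rw [h1, h2, h3, setLIntegral_Ioc_add_pi hp (-Real.pi) 0, two_mul]

theorem setLIntegral_pi_sub (f : ℝ → ℝ≥0∞) :
    ∫⁻ α in Set.Ioo (-Real.pi) Real.pi, f α =
      ∫⁻ φ in Set.Ico 0 (2 * Real.pi), f (Real.pi - φ) := by
  rw [setLIntegral_congr (Ioo_ae_eq_Ico (a := 0) (b := 2 * Real.pi)).symm]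
  have := (Measure.measurePreserving_sub_left volume Real.pi).setLIntegral_comp_preimage_emb
    (measurableEmbedding_subLeft Real.pi) f (Set.Ioo (-Real.pi) Real.pi)
  rw [← this]
  congr 2
  ext x
  simp only [Set.mem_preimage, Set.mem_Ioo]
  constructor <;> rintro ⟨h1, h2⟩ <;> constructor <;> linarith

theorem lintegral_Ioi_exp_half (G : ℝ → ℝ≥0∞) :
    ∫⁻ R in Set.Ioi (0 : ℝ), G R =
      ∫⁻ t : ℝ, ENNReal.ofReal (Real.exp (t / 2) / 2) * G (Real.exp (t / 2)) := by
  have himg : (fun t : ℝ => Real.exp (t / 2)) '' Set.univ = Set.Ioi 0 := by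
    ext R
    simp only [Set.image_univ, Set.mem_range, Set.mem_Ioi]
    exact ⟨by rintro ⟨t, rfl⟩; positivity, fun h => ⟨2 * Real.log R, by
      rw [mul_div_cancel_left₀ _ two_ne_zero, Real.exp_log h]⟩⟩
  have h := lintegral_image_eq_lintegral_abs_deriv_mul (s := Set.univ)
    (f := fun t : ℝ => Real.exp (t / 2)) (f' := fun t => Real.exp (t / 2) / 2) MeasurableSet.univ
    (fun t _ => by
      have := ((hasDerivAt_id t).div_const 2).exp
      exact (this.congr_deriv (by simp; ring)).hasDerivWithinAt)
    (fun x _ y _ h => by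
      have := Real.exp_injective h
      linarith) G
  rw [himg, setLIntegral_univ] at h
  rw [h]
  refine lintegral_congr fun t => ?_
  rw [abs_of_pos (by positivity)]

theorem cos_pos_and_sin_pos_iff {χ : ℝ} (h : χ ∈ Set.Ioo (-Real.pi) Real.pi) :
    0 < Real.cos χ ∧ 0 < Real.sin χ ↔ χ ∈ Set.Ioo 0 (Real.pi / 2) := by
  have hpi := Real.pi_pos
  constructor
  · rintro ⟨hc, hs⟩
    refine ⟨?_, ?_⟩
    · by_contra hn
      have := Real.sin_nonpos_of_nonpos_of_neg_pi_le (not_lt.1 hn) h.1.le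
      linarith
    · by_contra hn
      have := Real.cos_nonpos_of_pi_div_two_le_of_le (not_lt.1 hn) (by linarith [h.2])
      linarith
  · rintro ⟨h1, h2⟩
    exact ⟨Real.cos_pos_of_mem_Ioo ⟨by linarith, h2⟩, Real.sin_pos_of_pos_of_lt_pi h1 h.2⟩

/-- Polar coordinates `R = e^{t/2}`, `χ = θ/2` in the open quadrant: `R dR dχ` equals `(e^t / 4) dt
dθ`. -/
theorem lintegral_quadrant {K : ℝ × ℝ → ℝ≥0∞} (hK : Measurable K) :
    ∫⁻ ρ in Set.Ioi (0 : ℝ), ∫⁻ r in Set.Ioi (0 : ℝ), K (ρ, r) =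
      ∫⁻ t : ℝ, ∫⁻ θ in Set.Icc 0 Real.pi, ENNReal.ofReal (Real.exp t / 4) *
        K (Real.exp (t / 2) * Real.cos (θ / 2), Real.exp (t / 2) * Real.sin (θ / 2)) := by
  set Q : Set (ℝ × ℝ) := Set.Ioi 0 ×ˢ Set.Ioi 0 with hQ
  have hQm : MeasurableSet Q := measurableSet_Ioi.prod measurableSet_Ioi
  have h1 : ∫⁻ ρ in Set.Ioi (0 : ℝ), ∫⁻ r in Set.Ioi (0 : ℝ), K (ρ, r) =
      ∫⁻ p, Q.indicator K p := by
    rw [lintegral_indicator hQm, Measure.volume_eq_prod, hQ, ← Measure.prod_restrict,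
      lintegral_prod _ hK.aemeasurable]
  have hT : polarCoord.target = Set.Ioi (0 : ℝ) ×ˢ Set.Ioo (-Real.pi) Real.pi := rfl
  have hQK : Measurable (Q.indicator K) := hK.indicator hQm
  have hsub : Set.Ioo 0 (Real.pi / 2) ⊆ Set.Ioo (-Real.pi) Real.pi :=
    Set.Ioo_subset_Ioo (by linarith [Real.pi_pos]) (by linarith [Real.pi_pos])
  rw [h1, ← lintegral_comp_polarCoord_symm, hT, Measure.volume_eq_prod, ← Measure.prod_restrict]
  simp only [polarCoord_symm_apply, smul_eq_mul]
  rw [lintegral_prod _ (by fun_prop)]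
  have h2 : ∀ R ∈ Set.Ioi (0 : ℝ), ∫⁻ χ in Set.Ioo (-Real.pi) Real.pi,
      ENNReal.ofReal R * Q.indicator K (R * Real.cos χ, R * Real.sin χ) =
      ∫⁻ χ in Set.Ioo 0 (Real.pi / 2), ENNReal.ofReal R * K (R * Real.cos χ, R * Real.sin χ) := by
    intro R hR
    rw [← Set.inter_eq_left.2 hsub, ← setLIntegral_indicator measurableSet_Ioo]
    refine setLIntegral_congr_fun measurableSet_Ioo fun χ hχ => ?_
    have hiff := cos_pos_and_sin_pos_iff hχ
    have hmem : (R * Real.cos χ, R * Real.sin χ) ∈ Q ↔ χ ∈ Set.Ioo 0 (Real.pi / 2) := by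
      rw [← hiff, hQ, Set.mem_prod, Set.mem_Ioi, Set.mem_Ioi, mul_pos_iff_of_pos_left hR,
        mul_pos_iff_of_pos_left hR]
    by_cases hc : χ ∈ Set.Ioo 0 (Real.pi / 2)
    · rw [Set.indicator_of_mem hc, Set.indicator_of_mem (hmem.2 hc)]
    · rw [Set.indicator_of_notMem hc, Set.indicator_of_notMem (mt hmem.1 hc), mul_zero]
  rw [setLIntegral_congr_fun measurableSet_Ioi h2, lintegral_Ioi_exp_half]
  refine lintegral_congr fun t => ?_
  have h3 := lintegral_Ioo_comp_half 0 Real.pi fun χ => ENNReal.ofReal (Real.exp t / 4) *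
    K (Real.exp (t / 2) * Real.cos χ, Real.exp (t / 2) * Real.sin χ)
  rw [zero_div] at h3
  rw [setLIntegral_congr Ioo_ae_eq_Icc.symm, h3, ← lintegral_const_mul' _ _ (by simp),
    ← lintegral_const_mul' _ _ (by simp)]
  refine lintegral_congr fun χ => ?_
  rw [← mul_assoc, ← mul_assoc, ← ENNReal.ofReal_mul (by positivity), ← ENNReal.ofReal_ofNat 2,
    ← ENNReal.ofReal_mul (by positivity)]
  congr 2
  have : Real.exp t = Real.exp (t / 2) * Real.exp (t / 2) := by rw [← Real.exp_add]; congr 1; ring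
  rw [this]; ring

theorem lintegral_rotate {X Y Z : Type*} [MeasurableSpace X] [MeasurableSpace Y]
    [MeasurableSpace Z] {μ : Measure X} {ν : Measure Y} {ρ : Measure Z} [SFinite μ] [SFinite ν]
    [SFinite ρ] {F : X × Y × Z → ℝ≥0∞} (hF : Measurable F) :
    ∫⁻ x, ∫⁻ y, ∫⁻ z, F (x, y, z) ∂ρ ∂ν ∂μ = ∫⁻ z, ∫⁻ x, ∫⁻ y, F (x, y, z) ∂ν ∂μ ∂ρ := by
  have h1 : ∀ x, ∫⁻ y, ∫⁻ z, F (x, y, z) ∂ρ ∂ν = ∫⁻ z, ∫⁻ y, F (x, y, z) ∂ν ∂ρ := fun x =>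
    lintegral_lintegral_swap (by fun_prop)
  simp only [h1]
  exact lintegral_lintegral_swap (by fun_prop)

/-- The second column of the matrix with coordinates `(t, φ, ψ, θ)`. -/
noncomputable def column (t φ ψ θ : ℝ) : ℂ × ℂ :=
  (-((Real.exp (t / 2) * Real.sin (θ / 2) : ℝ) * Complex.exp ((ψ - φ) / 2 * Complex.I)),
    (Real.exp (t / 2) * Real.cos (θ / 2) : ℝ) * Complex.exp ((φ + ψ) / 2 * Complex.I))

theorem continuous_column :
    Continuous fun p : ℝ × ℝ × ℝ × ℝ => column p.1 p.2.1 p.2.2.1 p.2.2.2 := by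
  unfold column; fun_prop

/-- The integral over the two phases of a function on `ℂ²`, at the moduli `p.2`, `p.1`. -/
noncomputable def angleIntegral (g : ℂ × ℂ → ℝ≥0∞) (p : ℝ × ℝ) : ℝ≥0∞ :=
  ∫⁻ φ in Set.Ico 0 (2 * Real.pi), ∫⁻ ψ in Set.Ico 0 (2 * Real.pi),
    g (-(p.2 * Complex.exp (((ψ : ℝ) - (φ : ℝ)) / 2 * Complex.I)),
      p.1 * Complex.exp (((φ : ℝ) + (ψ : ℝ)) / 2 * Complex.I))

theorem measurable_angleIntegral {g : ℂ × ℂ → ℝ≥0∞} (hg : Measurable g) :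
    Measurable (angleIntegral g) := by
  unfold angleIntegral; fun_prop

/-- Write the components of `v` in polar form, with the phase of the first measured relative to the
phase `β` of the second. Evenness of `g` makes the integrand `π`-periodic in `β`, which allows the
half angle `β = (φ + ψ)/2`. -/
theorem lintegral_eq_angleIntegral {g : ℂ × ℂ → ℝ≥0∞} (hg : Measurable g)
    (heven : ∀ v, g (-v) = g v) :
    ∫⁻ v, g v = ∫⁻ ρ in Set.Ioi (0 : ℝ), ∫⁻ r in Set.Ioi (0 : ℝ),
      ENNReal.ofReal (ρ * r) * angleIntegral g (ρ, r) := by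
  rw [Measure.volume_eq_prod, lintegral_prod_symm _ hg.aemeasurable,
    lintegral_complex_polar (by fun_prop)]
  refine setLIntegral_congr_fun measurableSet_Ioi fun ρ hρ => ?_
  have hr : ∀ β : ℝ, ∫⁻ z : ℂ, g (z, ρ * Complex.exp (β * Complex.I)) =
      ∫⁻ r in Set.Ioi (0 : ℝ), ∫⁻ φ in Set.Ico 0 (2 * Real.pi),
        ENNReal.ofReal r * g (Complex.exp (β * Complex.I) * (-(r * Complex.exp (-φ * Complex.I))),
          ρ * Complex.exp (β * Complex.I)) := by
    intro β
    have hrot := (rotation (Circle.exp β)).measurePreserving.lintegral_comp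
      (f := fun z : ℂ => g (z, ρ * Complex.exp (β * Complex.I))) (by fun_prop)
    simp only [rotation_apply, Circle.coe_exp] at hrot
    rw [← hrot, lintegral_complex_polar (by fun_prop)]
    refine lintegral_congr fun r => ?_
    rw [setLIntegral_pi_sub]
    refine lintegral_congr fun φ => ?_
    have : Complex.exp (((Real.pi - φ : ℝ) : ℂ) * Complex.I) = -Complex.exp (-φ * Complex.I) := by
      push_cast
      rw [sub_mul, sub_eq_add_neg, Complex.exp_add, Complex.exp_pi_mul_I, neg_one_mul, neg_mul]
    rw [this, mul_neg]
  simp only [hr]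
  have hm : Measurable fun q : ℝ × ℝ × ℝ => ENNReal.ofReal q.2.1 *
      g (Complex.exp (q.1 * Complex.I) * (-(q.2.1 * Complex.exp (-q.2.2 * Complex.I))),
          ρ * Complex.exp (q.1 * Complex.I)) := by fun_prop
  simp only [← lintegral_const_mul' (ENNReal.ofReal ρ) _ ENNReal.ofReal_ne_top]
  rw [lintegral_lintegral_swap (by fun_prop)]
  refine setLIntegral_congr_fun measurableSet_Ioi fun r hr => ?_
  rw [lintegral_lintegral_swap (by fun_prop), angleIntegral,
    ← lintegral_const_mul' _ _ ENNReal.ofReal_ne_top]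
  refine lintegral_congr fun φ => ?_
  have hper := setLIntegral_half_angle (h := fun β => g (Complex.exp (β * Complex.I) *
    (-(r * Complex.exp (-φ * Complex.I))), ρ * Complex.exp (β * Complex.I))) (fun β => by
      have : Complex.exp (((β + Real.pi : ℝ) : ℂ) * Complex.I) = -Complex.exp (β * Complex.I) := by
        push_cast
        rw [add_mul, Complex.exp_add, Complex.exp_pi_mul_I, mul_neg_one]
      rw [this, ← heven]
      congr 1
      simp) φ
  simp only [lintegral_const_mul' _ _ ENNReal.ofReal_ne_top]
  rw [← hper, ← mul_assoc, ← ENNReal.ofReal_mul (le_of_lt hρ)]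
  congr 1
  refine lintegral_congr fun ψ => ?_
  congr 2
  · rw [mul_neg, mul_left_comm, ← Complex.exp_add]
    congr 3
    push_cast; ring
  · push_cast; rfl

theorem lintegral_column_fixed {g : ℂ × ℂ → ℝ≥0∞} (hg : Measurable g) (t : ℝ) :
    ∫⁻ φ in Set.Ico 0 (2 * Real.pi), ∫⁻ ψ in Set.Ico 0 (2 * Real.pi),
      ∫⁻ θ in Set.Icc 0 Real.pi, ENNReal.ofReal (Real.exp (2 * t) * Real.sin θ) *
        g (column t φ ψ θ) = ∫⁻ θ in Set.Icc 0 Real.pi,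
          ENNReal.ofReal (Real.exp (2 * t) * Real.sin θ) * angleIntegral g
            (Real.exp (t / 2) * Real.cos (θ / 2), Real.exp (t / 2) * Real.sin (θ / 2)) := by
  have hm : Measurable fun q : ℝ × ℝ × ℝ × ℝ => g (column q.1 q.2.1 q.2.2.1 q.2.2.2) :=
    hg.comp continuous_column.measurable
  have hc : Measurable fun q : ℝ × ℝ × ℝ => g (column t q.1 q.2.1 q.2.2) :=
    hm.comp (measurable_const.prodMk measurable_id)
  have hmt : Measurable fun q : ℝ × ℝ × ℝ => ENNReal.ofReal (Real.exp (2 * t) * Real.sin q.2.2) *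
      g (column t q.1 q.2.1 q.2.2) := Measurable.mul (by fun_prop) hc
  refine (lintegral_rotate hmt).trans (lintegral_congr fun θ => ?_)
  rw [angleIntegral, ← lintegral_const_mul' _ _ ENNReal.ofReal_ne_top]
  refine lintegral_congr fun φ => ?_
  rw [← lintegral_const_mul' _ _ ENNReal.ofReal_ne_top]
  refine lintegral_congr fun ψ => ?_
  simp only [column]

/-- The moduli contribute `ρ r`, which is `e^t sin θ / 2`, and the quadrant Jacobian is `e^t / 4`.
This accounts for the density `e^{2t} sin θ` and the factor `8`. -/
theorem lintegral_column {g : ℂ × ℂ → ℝ≥0∞} (hg : Measurable g) (heven : ∀ v, g (-v) = g v) :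
    ∫⁻ t : ℝ, ∫⁻ φ in Set.Ico 0 (2 * Real.pi), ∫⁻ ψ in Set.Ico 0 (2 * Real.pi),
      ∫⁻ θ in Set.Icc 0 Real.pi, ENNReal.ofReal (Real.exp (2 * t) * Real.sin θ) *
        g (column t φ ψ θ) = 8 * ∫⁻ v, g v := by
  have hK := measurable_angleIntegral hg
  simp only [lintegral_column_fixed hg]
  rw [lintegral_eq_angleIntegral hg heven,
    lintegral_quadrant (K := fun p => ENNReal.ofReal (p.1 * p.2) * angleIntegral g p) (by fun_prop),
    ← lintegral_const_mul' _ _ (by norm_num)]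
  refine lintegral_congr fun t => ?_
  rw [← lintegral_const_mul' _ _ (by norm_num)]
  refine lintegral_congr fun θ => ?_
  rw [← mul_assoc, ← mul_assoc, mul_assoc 8, ← ENNReal.ofReal_mul (by positivity),
    ← ENNReal.ofReal_ofNat 8, ← ENNReal.ofReal_mul (by positivity)]
  congr 2
  have e1 : Real.exp (2 * t) = Real.exp t * (Real.exp (t / 2) * Real.exp (t / 2)) := by
    rw [← Real.exp_add, ← Real.exp_add]; congr 1; ring
  have e2 : Real.sin θ = 2 * Real.sin (θ / 2) * Real.cos (θ / 2) := by
    rw [← Real.sin_two_mul]; congr 1; ring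
  rw [e1, e2]; ring

end WeightedSphere

namespace WeightedSphere

/-! ### The invariant measure on `SL(2,ℂ)` -/

variable {w : ℝ} {s : ℤ}

theorem lintegral_re_im {f : ℝ × ℝ → ℝ≥0∞} (hf : Measurable f) :
    ∫⁻ ζ : ℂ, f (ζ.re, ζ.im) = ∫⁻ u : ℝ, ∫⁻ v : ℝ, f (u, v) :=
  (Complex.volume_preserving_equiv_real_prod.lintegral_comp hf).trans
    (lintegral_prod _ hf.aemeasurable)

theorem lintegral_prod_prod_complex {Q : Type*} [MeasurableSpace Q] {μ : Measure Q} [SFinite μ]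
    {G : ℝ × ℝ × Q → ℝ≥0∞} (hG : Measurable G) :
    ∫⁻ y, G y ∂((volume : Measure ℝ).prod ((volume : Measure ℝ).prod μ)) =
      ∫⁻ q, (∫⁻ ζ : ℂ, G (ζ.re, ζ.im, q)) ∂μ := by
  rw [lintegral_prod _ hG.aemeasurable]
  have h1 : ∀ u : ℝ, ∫⁻ y, G (u, y) ∂((volume : Measure ℝ).prod μ) =
      ∫⁻ v : ℝ, ∫⁻ q, G (u, v, q) ∂μ := fun u => lintegral_prod _ (by fun_prop)
  simp only [h1]
  refine (lintegral_rotate hG).trans (lintegral_congr fun q => ?_)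
  exact (lintegral_re_im (f := fun p => G (p.1, p.2, q)) (by fun_prop)).symm

theorem lintegral_lorentzCoordMeasure {F : ℝ × ℝ × ℝ × ℝ × ℝ × ℝ → ℝ≥0∞} (hF : Measurable F) :
    ∫⁻ x, F x ∂lorentzCoordMeasure =
      ∫⁻ t : ℝ, ∫⁻ φ in Set.Ico 0 (2 * Real.pi), ∫⁻ ψ in Set.Ico 0 (2 * Real.pi),
        ∫⁻ θ in Set.Icc 0 Real.pi, ENNReal.ofReal (Real.exp (2 * t) * Real.sin θ) *
          ∫⁻ ζ : ℂ, F (t, ζ.re, ζ.im, φ, ψ, θ) := by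
  set A : Measure ℝ := volume.restrict (Set.Ico 0 (2 * Real.pi)) with hA
  set B : Measure ℝ := volume.restrict (Set.Icc 0 Real.pi) with hB
  have hr : (volume : Measure (ℝ × ℝ × ℝ × ℝ × ℝ × ℝ)).restrict lorentzRange =
      (volume : Measure ℝ).prod ((volume : Measure ℝ).prod ((volume : Measure ℝ).prod
        (A.prod (A.prod B)))) := by
    have e : lorentzRange = Set.univ ×ˢ (Set.univ ×ˢ (Set.univ ×ˢ
        (Set.Ico 0 (2 * Real.pi) ×ˢ (Set.Ico 0 (2 * Real.pi) ×ˢ Set.Icc 0 Real.pi)))) := by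
      ext x
      simp [lorentzRange]
    rw [e, Measure.volume_eq_prod, Measure.volume_eq_prod, Measure.volume_eq_prod,
      Measure.volume_eq_prod, Measure.volume_eq_prod, ← Measure.prod_restrict,
      ← Measure.prod_restrict, ← Measure.prod_restrict, ← Measure.prod_restrict,
      ← Measure.prod_restrict, Measure.restrict_univ]
  have hdm : Measurable fun x : ℝ × ℝ × ℝ × ℝ × ℝ × ℝ =>
      ENNReal.ofReal (Real.exp (2 * x.1) * Real.sin x.2.2.2.2.2) := by fun_prop
  have hm := hdm.mul hF
  rw [lorentzCoordMeasure, lintegral_withDensity_eq_lintegral_mul _ hdm hF, hr,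
    lintegral_prod _ hm.aemeasurable]
  refine lintegral_congr fun t => ?_
  have hmt : Measurable fun y : ℝ × ℝ × ℝ × ℝ × ℝ => ENNReal.ofReal (Real.exp (2 * t) *
      Real.sin y.2.2.2.2) * F (t, y) := hm.comp (measurable_const.prodMk measurable_id)
  refine (lintegral_prod_prod_complex hmt).trans ?_
  rw [lintegral_prod _ (by fun_prop)]
  refine lintegral_congr fun φ => ?_
  rw [lintegral_prod _ (by fun_prop)]
  refine lintegral_congr fun ψ => lintegral_congr fun θ => ?_
  exact lintegral_const_mul' (ENNReal.ofReal (Real.exp (2 * t) * Real.sin θ))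
    (fun ζ : ℂ => F (t, ζ.re, ζ.im, φ, ψ, θ)) ENNReal.ofReal_ne_top

theorem lintegral_gamCoordMeasure {F : ℝ × ℝ × ℝ × ℝ × ℝ → ℝ≥0∞} (hF : Measurable F) :
    ∫⁻ y, F y ∂gamCoordMeasure =
      ∫⁻ t : ℝ, ∫⁻ φ in Set.Ico 0 (2 * Real.pi), ∫⁻ θ in Set.Icc 0 Real.pi,
        ENNReal.ofReal (Real.sin θ) * ∫⁻ ζ : ℂ, F (t, ζ.re, ζ.im, φ, θ) := by
  set A : Measure ℝ := volume.restrict (Set.Ico 0 (2 * Real.pi)) with hA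
  set B : Measure ℝ := volume.restrict (Set.Icc 0 Real.pi) with hB
  have hr : (volume : Measure (ℝ × ℝ × ℝ × ℝ × ℝ)).restrict gamRange =
      (volume : Measure ℝ).prod ((volume : Measure ℝ).prod ((volume : Measure ℝ).prod
        (A.prod B))) := by
    have e : gamRange = Set.univ ×ˢ (Set.univ ×ˢ (Set.univ ×ˢ
        (Set.Ico 0 (2 * Real.pi) ×ˢ Set.Icc 0 Real.pi))) := by
      ext x
      simp [gamRange]
    rw [e, Measure.volume_eq_prod, Measure.volume_eq_prod, Measure.volume_eq_prod,
      Measure.volume_eq_prod, ← Measure.prod_restrict, ← Measure.prod_restrict,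
      ← Measure.prod_restrict, ← Measure.prod_restrict, Measure.restrict_univ]
  have hdm : Measurable fun y : ℝ × ℝ × ℝ × ℝ × ℝ => ENNReal.ofReal (Real.sin y.2.2.2.2) := by
    fun_prop
  have hm := hdm.mul hF
  rw [gamCoordMeasure, lintegral_withDensity_eq_lintegral_mul _ hdm hF, hr,
    lintegral_prod _ hm.aemeasurable]
  refine lintegral_congr fun t => ?_
  have hmt : Measurable fun y : ℝ × ℝ × ℝ × ℝ => ENNReal.ofReal (Real.sin y.2.2.2) * F (t, y) := by
    fun_prop
  refine (lintegral_prod_prod_complex hmt).trans ?_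
  rw [lintegral_prod _ (by fun_prop)]
  refine lintegral_congr fun φ => lintegral_congr fun θ => ?_
  exact lintegral_const_mul' (ENNReal.ofReal (Real.sin θ))
    (fun ζ : ℂ => F (t, ζ.re, ζ.im, φ, θ)) ENNReal.ofReal_ne_top

/-! ### The second column as a coordinate on `SL(2,ℂ)`. -/

theorem norm_sq_add_pos {v : ℂ × ℂ} (h : v ≠ 0) : 0 < ‖v.1‖ ^ 2 + ‖v.2‖ ^ 2 := by
  by_contra hn
  have h1 : ‖v.1‖ ^ 2 = 0 := by nlinarith [sq_nonneg ‖v.1‖, sq_nonneg ‖v.2‖]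
  have h2 : ‖v.2‖ ^ 2 = 0 := by nlinarith [sq_nonneg ‖v.1‖, sq_nonneg ‖v.2‖]
  exact h (Prod.ext (by simpa using h1) (by simpa using h2))

/-- The matrix whose second column is `v` and whose first column is `ζ v` plus the vector
orthogonal to `v` that makes the determinant equal to one. -/
noncomputable def colMk (v : ℂ × ℂ) (h : v ≠ 0) (ζ : ℂ) : SL2C :=
  ⟨!![conj v.2 / ((‖v.1‖ ^ 2 + ‖v.2‖ ^ 2 : ℝ) : ℂ) + ζ * v.1, v.1;
    -conj v.1 / ((‖v.1‖ ^ 2 + ‖v.2‖ ^ 2 : ℝ) : ℂ) + ζ * v.2, v.2], by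
    have hn : ((‖v.1‖ ^ 2 + ‖v.2‖ ^ 2 : ℝ) : ℂ) ≠ 0 := by
      exact_mod_cast (norm_sq_add_pos h).ne'
    have e : v.1 * conj v.1 + v.2 * conj v.2 = ((‖v.1‖ ^ 2 + ‖v.2‖ ^ 2 : ℝ) : ℂ) := by
      rw [Complex.mul_conj', Complex.mul_conj']; push_cast; rfl
    rw [Matrix.det_fin_two_of]
    generalize ((‖v.1‖ ^ 2 + ‖v.2‖ ^ 2 : ℝ) : ℂ) = N at *
    field_simp
    linear_combination e⟩

open Classical in
/-- `colMk`, extended by `1` to `v = 0`. -/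
noncomputable def colLift (p : (ℂ × ℂ) × ℂ) : SL2C :=
  if h : p.1 ≠ 0 then colMk p.1 h p.2 else 1

theorem colLift_of_ne {v : ℂ × ℂ} (h : v ≠ 0) (ζ : ℂ) : colLift (v, ζ) = colMk v h ζ :=
  dif_pos h

theorem colLift_apply_zero_zero {v : ℂ × ℂ} (h : v ≠ 0) (ζ : ℂ) : colLift (v, ζ) 0 0 =
    conj v.2 / ((‖v.1‖ ^ 2 + ‖v.2‖ ^ 2 : ℝ) : ℂ) + ζ * v.1 := by
  rw [colLift_of_ne h]; rfl

theorem colLift_apply_zero_one {v : ℂ × ℂ} (h : v ≠ 0) (ζ : ℂ) : colLift (v, ζ) 0 1 = v.1 := by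
  rw [colLift_of_ne h]; rfl

theorem colLift_apply_one_zero {v : ℂ × ℂ} (h : v ≠ 0) (ζ : ℂ) : colLift (v, ζ) 1 0 =
    -conj v.1 / ((‖v.1‖ ^ 2 + ‖v.2‖ ^ 2 : ℝ) : ℂ) + ζ * v.2 := by
  rw [colLift_of_ne h]; rfl

theorem colLift_apply_one_one {v : ℂ × ℂ} (h : v ≠ 0) (ζ : ℂ) : colLift (v, ζ) 1 1 = v.2 := by
  rw [colLift_of_ne h]; rfl

/-- A matrix is determined by its second column up to adding a multiple of that column to the
first one. -/
theorem exists_eq_colLift (Λ : SL2C) :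
    ∃ c : ℂ, ∀ ζ : ℂ, Λ * tri 0 ζ = colLift ((Λ 0 1, Λ 1 1), ζ + c) := by
  have hd := det_eq Λ
  have hv : (Λ 0 1, Λ 1 1) ≠ (0 : ℂ × ℂ) := by
    intro h
    rw [Prod.mk_eq_zero] at h
    simp [h.1, h.2] at hd
  have hn : ((‖Λ 0 1‖ ^ 2 + ‖Λ 1 1‖ ^ 2 : ℝ) : ℂ) ≠ 0 := by
    exact_mod_cast (norm_sq_add_pos hv).ne'
  have e : Λ 0 1 * conj (Λ 0 1) + Λ 1 1 * conj (Λ 1 1) = ((‖Λ 0 1‖ ^ 2 + ‖Λ 1 1‖ ^ 2 : ℝ) : ℂ) := by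
    rw [Complex.mul_conj', Complex.mul_conj']; push_cast; rfl
  refine ⟨(Λ 0 0 * conj (Λ 0 1) + Λ 1 0 * conj (Λ 1 1)) / ((‖Λ 0 1‖ ^ 2 + ‖Λ 1 1‖ ^ 2 : ℝ) : ℂ),
    fun ζ => ?_⟩
  apply sl_ext
  · rw [colLift_apply_zero_zero hv, mul_apply', tri_apply_zero_zero, tri_apply_one_zero]
    generalize ((‖Λ 0 1‖ ^ 2 + ‖Λ 1 1‖ ^ 2 : ℝ) : ℂ) = N at *
    rw [zero_div, neg_zero, Real.exp_zero, Complex.ofReal_one]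
    field_simp
    linear_combination conj (Λ 1 1) * hd - Λ 0 0 * e
  · rw [colLift_apply_zero_one hv, mul_apply', tri_apply_zero_one, tri_apply_one_one]
    simp
  · rw [colLift_apply_one_zero hv, mul_apply', tri_apply_zero_zero, tri_apply_one_zero]
    generalize ((‖Λ 0 1‖ ^ 2 + ‖Λ 1 1‖ ^ 2 : ℝ) : ℂ) = N at *
    rw [zero_div, neg_zero, Real.exp_zero, Complex.ofReal_one]
    field_simp
    linear_combination -conj (Λ 0 1) * hd - Λ 1 0 * e
  · rw [colLift_apply_one_one hv, mul_apply', tri_apply_zero_one, tri_apply_one_one]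
    simp

theorem colLift_add {v : ℂ × ℂ} (h : v ≠ 0) (ζ ζ' : ℂ) :
    colLift (v, ζ + ζ') = colLift (v, ζ) * tri 0 ζ' := by
  apply sl_ext
  · rw [mul_apply', tri_apply_zero_zero, tri_apply_one_zero, colLift_apply_zero_zero h,
      colLift_apply_zero_zero h, colLift_apply_zero_one h]
    simp; ring
  · rw [mul_apply', tri_apply_zero_one, tri_apply_one_one, colLift_apply_zero_one h,
      colLift_apply_zero_one h]
    simp
  · rw [mul_apply', tri_apply_zero_zero, tri_apply_one_zero, colLift_apply_one_zero h,
      colLift_apply_one_zero h, colLift_apply_one_one h]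
    simp; ring
  · rw [mul_apply', tri_apply_zero_one, tri_apply_one_one, colLift_apply_one_one h,
      colLift_apply_one_one h]
    simp

/-- Left multiplication acts linearly on the second column. The first column is then known up to a
multiple `c` of it, where `c` depends on `M` and `v` but not on `ζ`. -/
theorem exists_mul_colLift (M : SL2C) {v : ℂ × ℂ} (h : v ≠ 0) :
    ∃ c : ℂ, ∀ ζ : ℂ, M * colLift (v, ζ) =
      colLift ((M 0 0 * v.1 + M 0 1 * v.2, M 1 0 * v.1 + M 1 1 * v.2), ζ + c) := by
  obtain ⟨c, hc⟩ := exists_eq_colLift (M * colLift (v, 0))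
  refine ⟨c, fun ζ => ?_⟩
  have := hc ζ
  rwa [mul_assoc, ← colLift_add h, zero_add, mul_apply', mul_apply', colLift_apply_zero_one h,
    colLift_apply_one_one h] at this

theorem colLift_neg {v : ℂ × ℂ} (h : v ≠ 0) (ζ : ℂ) : colLift (-v, ζ) = -colLift (v, ζ) := by
  have h' : -v ≠ 0 := neg_ne_zero.2 h
  apply sl_ext
  · rw [Matrix.SpecialLinearGroup.coe_neg, Matrix.neg_apply, colLift_apply_zero_zero h,
      colLift_apply_zero_zero h']
    simp; ring
  · rw [Matrix.SpecialLinearGroup.coe_neg, Matrix.neg_apply, colLift_apply_zero_one h,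
      colLift_apply_zero_one h']
    rfl
  · rw [Matrix.SpecialLinearGroup.coe_neg, Matrix.neg_apply, colLift_apply_one_zero h,
      colLift_apply_one_zero h']
    simp; ring
  · rw [Matrix.SpecialLinearGroup.coe_neg, Matrix.neg_apply, colLift_apply_one_one h,
      colLift_apply_one_one h']
    rfl

/-- The factor `e^{t/2}` in the lower left entry is that of the column `v`, so `ζ` becomes the
coefficient of `v` itself. Since `|v|² = e^t`, the term `e^{-t/2}` times the first column of `κ` is
the orthogonal vector in `colMk`. -/
theorem SU2_mul_tri_eq_colLift {κ : SL2C} (hκ : κ ∈ SU2) (t : ℝ) (ζ : ℂ) :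
    κ * tri t (Real.exp (t / 2) * ζ) =
      colLift ((κ 0 1 * Real.exp (t / 2), κ 1 1 * Real.exp (t / 2)), ζ) := by
  obtain ⟨h11, h10⟩ := mem_SU2_iff.1 hκ
  have hn := SU2_norm_sq hκ
  have hex : (Real.exp (t / 2) : ℂ) ≠ 0 := by exact_mod_cast (Real.exp_pos _).ne'
  have hnorm : ‖κ 0 1 * Real.exp (t / 2)‖ ^ 2 + ‖κ 1 1 * Real.exp (t / 2)‖ ^ 2 =
      Real.exp (t / 2) * Real.exp (t / 2) := by
    rw [norm_mul, norm_mul, h11, RCLike.norm_conj, Complex.norm_real, Real.norm_eq_abs,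
      abs_of_pos (Real.exp_pos _)]
    linear_combination Real.exp (t / 2) ^ 2 * hn
  have hv : (κ 0 1 * Real.exp (t / 2), κ 1 1 * Real.exp (t / 2)) ≠ (0 : ℂ × ℂ) := by
    intro h
    rw [Prod.mk_eq_zero] at h
    rw [h.1, h.2] at hnorm
    have := mul_pos (Real.exp_pos (t / 2)) (Real.exp_pos (t / 2))
    simp at hnorm
  have hinv : ((Real.exp (-(t / 2)) : ℝ) : ℂ) = (Real.exp (t / 2) : ℂ)⁻¹ := by
    rw [Real.exp_neg]; push_cast; rfl
  apply sl_ext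
  · rw [colLift_apply_zero_zero hv, mul_apply', tri_apply_zero_zero, tri_apply_one_zero, hnorm, h11,
      hinv]
    simp only [map_mul, Complex.conj_conj, Complex.conj_ofReal, Complex.ofReal_mul]
    field_simp
  · rw [colLift_apply_zero_one hv, mul_apply', tri_apply_zero_one, tri_apply_one_one]
    simp
  · rw [colLift_apply_one_zero hv, mul_apply', tri_apply_zero_zero, tri_apply_one_zero, hnorm, h10,
      hinv]
    simp only [map_mul, Complex.conj_ofReal, Complex.ofReal_mul]
    field_simp
  · rw [colLift_apply_one_one hv, mul_apply', tri_apply_zero_one, tri_apply_one_one]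
    simp

theorem lorentzCoord_eq_colLift (t φ ψ θ : ℝ) (ζ : ℂ) :
    lorentzCoord (t, ζ.re, ζ.im, φ, ψ, θ) = colLift (column t φ ψ θ, ζ) := by
  rw [lorentzCoord_eq, Complex.re_add_im, SU2_mul_tri_eq_colLift (euler_mem_SU2 _ _ _)]
  congr 2
  have h := euler_mem_SU2 φ θ ψ
  obtain ⟨h11, h10⟩ := mem_SU2_iff.1 h
  have h01 : (rotZ φ * rotY θ * rotZ ψ) 0 1 = -conj ((rotZ φ * rotY θ * rotZ ψ) 1 0) := by
    rw [h10, map_neg, Complex.conj_conj, neg_neg]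
  rw [h11, h01, euler_apply_zero_zero, euler_apply_one_zero, column]
  have hconj : ∀ x : ℝ, conj (Complex.exp (x * Complex.I)) = Complex.exp (-x * Complex.I) := by
    intro x
    rw [← Complex.exp_conj, map_mul, Complex.conj_ofReal, Complex.conj_I, mul_neg, neg_mul]
  have c1 : conj (Complex.exp (((φ : ℂ) - ψ) / 2 * Complex.I)) =
      Complex.exp ((ψ - φ) / 2 * Complex.I) := by
    have := hconj ((φ - ψ) / 2)
    push_cast at this
    rw [this]; congr 1; ring
  have c2 : conj (Complex.exp (-((φ : ℂ) + ψ) / 2 * Complex.I)) =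
      Complex.exp ((φ + ψ) / 2 * Complex.I) := by
    have := hconj (-(φ + ψ) / 2)
    push_cast at this
    rw [this]; congr 1; ring
  rw [map_mul, map_mul, Complex.conj_ofReal, Complex.conj_ofReal, c1, c2]
  ext1
  · push_cast; ring
  · push_cast; ring

theorem continuousOn_colLift : ContinuousOn colLift {p | p.1 ≠ 0} := by
  rw [continuousOn_iff_continuous_domRestrict, continuous_sl_iff]
  have hc : Continuous fun p : {p : (ℂ × ℂ) × ℂ | p.1 ≠ 0} => (p : (ℂ × ℂ) × ℂ) :=
    continuous_subtype_val
  have h1 : Continuous fun p : {p : (ℂ × ℂ) × ℂ | p.1 ≠ 0} => (p : (ℂ × ℂ) × ℂ).1.1 := by fun_prop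
  have h2 : Continuous fun p : {p : (ℂ × ℂ) × ℂ | p.1 ≠ 0} => (p : (ℂ × ℂ) × ℂ).1.2 := by fun_prop
  have h3 : Continuous fun p : {p : (ℂ × ℂ) × ℂ | p.1 ≠ 0} => (p : (ℂ × ℂ) × ℂ).2 := by fun_prop
  have hN : Continuous fun p : {p : (ℂ × ℂ) × ℂ | p.1 ≠ 0} =>
      ((‖(p : (ℂ × ℂ) × ℂ).1.1‖ ^ 2 + ‖(p : (ℂ × ℂ) × ℂ).1.2‖ ^ 2 : ℝ) : ℂ) :=
    Complex.continuous_ofReal.comp ((h1.norm.pow 2).add (h2.norm.pow 2))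
  have hN0 : ∀ p : {p : (ℂ × ℂ) × ℂ | p.1 ≠ 0},
      ((‖(p : (ℂ × ℂ) × ℂ).1.1‖ ^ 2 + ‖(p : (ℂ × ℂ) × ℂ).1.2‖ ^ 2 : ℝ) : ℂ) ≠ 0 := fun p => by
    exact_mod_cast (norm_sq_add_pos p.2).ne'
  simp only [Fin.forall_fin_two]
  refine ⟨⟨?_, ?_⟩, ?_, ?_⟩
  · exact (((Complex.continuous_conj.comp h2).div hN hN0).add (h3.mul h1)).congr fun p =>
      (colLift_apply_zero_zero p.2 _).symm
  · exact h1.congr fun p => (colLift_apply_zero_one p.2 _).symm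
  · exact (((Complex.continuous_conj.comp h1).neg.div hN hN0).add (h3.mul h2)).congr fun p =>
      (colLift_apply_one_zero p.2 _).symm
  · exact h2.congr fun p => (colLift_apply_one_one p.2 _).symm

theorem measurable_orbitPoint_colLift (φ : WFun w s) :
    Measurable fun p => orbitPoint φ (colLift p) := by
  classical
  have hS : MeasurableSet {p : (ℂ × ℂ) × ℂ | p.1 ≠ 0} :=
    (measurableSet_singleton (0 : ℂ × ℂ)).compl.preimage measurable_fst
  have h := ContinuousOn.measurable_piecewise (g := fun _ => orbitPoint φ 1)
    ((continuous_orbitPoint φ).comp_continuousOn continuousOn_colLift) continuousOn_const hS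
  convert h using 1
  funext p
  by_cases hp : p.1 ≠ 0
  · rw [Set.piecewise_eq_of_mem _ _ _ hp]; rfl
  · rw [Set.piecewise_eq_of_notMem _ _ _ hp, colLift, dif_neg hp]

theorem ae_ne_zero_prod : ∀ᵐ v : ℂ × ℂ, v ≠ 0 := by
  rw [Measure.volume_eq_prod]
  exact (Set.countable_singleton (0 : ℂ × ℂ)).ae_notMem _

end WeightedSphere

namespace WeightedSphere

/-! ### Invariant measures on the orbits -/

variable {w : ℝ} {s : ℤ}

theorem continuous_lorentzCoord : Continuous lorentzCoord := by
  have h : lorentzCoord = fun x => rotZ x.2.2.2.1 * rotY x.2.2.2.2.2 * rotZ x.2.2.2.2.1 *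
      boostZ x.1 * nullRot x.2.1 x.2.2.1 := rfl
  have h1 : Continuous fun x : ℝ × ℝ × ℝ × ℝ × ℝ × ℝ => rotZ x.2.2.2.1 :=
    continuous_rotZ.comp (by fun_prop)
  have h2 : Continuous fun x : ℝ × ℝ × ℝ × ℝ × ℝ × ℝ => rotY x.2.2.2.2.2 :=
    continuous_rotY.comp (by fun_prop)
  have h3 : Continuous fun x : ℝ × ℝ × ℝ × ℝ × ℝ × ℝ => rotZ x.2.2.2.2.1 :=
    continuous_rotZ.comp (by fun_prop)
  have h4 : Continuous fun x : ℝ × ℝ × ℝ × ℝ × ℝ × ℝ => boostZ x.1 :=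
    continuous_boostZ.comp (by fun_prop)
  have h5 : Continuous fun x : ℝ × ℝ × ℝ × ℝ × ℝ × ℝ => nullRot x.2.1 x.2.2.1 :=
    continuous_nullRot.comp (f := fun x : ℝ × ℝ × ℝ × ℝ × ℝ × ℝ => (x.2.1, x.2.2.1)) (by fun_prop)
  rw [h]
  exact (((h1.mul h2).mul h3).mul h4).mul h5

theorem continuous_gamCoord : Continuous gamCoord := by
  have h : gamCoord = fun y => rotZ y.2.2.2.1 * rotY y.2.2.2.2 * nullRot y.2.1 y.2.2.1 *
      boostZ y.1 := rfl
  have h1 : Continuous fun x : ℝ × ℝ × ℝ × ℝ × ℝ => rotZ x.2.2.2.1 :=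
    continuous_rotZ.comp (by fun_prop)
  have h2 : Continuous fun x : ℝ × ℝ × ℝ × ℝ × ℝ => rotY x.2.2.2.2 :=
    continuous_rotY.comp (by fun_prop)
  have h4 : Continuous fun x : ℝ × ℝ × ℝ × ℝ × ℝ => boostZ x.1 :=
    continuous_boostZ.comp (by fun_prop)
  have h5 : Continuous fun x : ℝ × ℝ × ℝ × ℝ × ℝ => nullRot x.2.1 x.2.2.1 :=
    continuous_nullRot.comp (f := fun x : ℝ × ℝ × ℝ × ℝ × ℝ => (x.2.1, x.2.2.1)) (by fun_prop)
  rw [h]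
  exact ((h1.mul h2).mul h5).mul h4

/-- The invariant measure of the orbit in the coordinates `(t, u, v, φ, ψ, θ)`. -/
noncomputable def orbitMeasure (φ : WFun w s) : Measure (Orbit φ) :=
  lorentzCoordMeasure.map fun x => orbitPoint φ (lorentzCoord x)

theorem lintegral_orbitMeasure_coord {φ : WFun w s} {F : Orbit φ → ℝ≥0∞} (hF : Measurable F) :
    ∫⁻ x, F x ∂orbitMeasure φ =
      ∫⁻ t : ℝ, ∫⁻ a in Set.Ico 0 (2 * Real.pi), ∫⁻ b in Set.Ico 0 (2 * Real.pi),
        ∫⁻ θ in Set.Icc 0 Real.pi, ENNReal.ofReal (Real.exp (2 * t) * Real.sin θ) *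
          ∫⁻ ζ : ℂ, F (orbitPoint φ (lorentzCoord (t, ζ.re, ζ.im, a, b, θ))) := by
  have hm : Measurable fun x => orbitPoint φ (lorentzCoord x) :=
    ((continuous_orbitPoint φ).comp continuous_lorentzCoord).measurable
  rw [orbitMeasure, lintegral_map hF hm]
  exact lintegral_lorentzCoordMeasure (hF.comp hm)

/-- The orbit measure is eight times Lebesgue measure in `(v, ζ)`. The evenness needed in
`lintegral_column` holds because `-1` acts trivially. -/
theorem lintegral_orbitMeasure {φ : WFun w s} {F : Orbit φ → ℝ≥0∞} (hF : Measurable F) :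
    ∫⁻ x, F x ∂orbitMeasure φ =
      8 * ∫⁻ v : ℂ × ℂ, ∫⁻ ζ : ℂ, F (orbitPoint φ (colLift (v, ζ))) := by
  have hm : Measurable fun p => F (orbitPoint φ (colLift p)) :=
    hF.comp (measurable_orbitPoint_colLift φ)
  rw [lintegral_orbitMeasure_coord hF]
  simp only [lorentzCoord_eq_colLift]
  refine lintegral_column (g := fun v => ∫⁻ ζ : ℂ, F (orbitPoint φ (colLift (v, ζ))))
    hm.lintegral_prod_right' fun v => ?_
  by_cases hv : v = 0
  · rw [hv, neg_zero]
  · simp only [colLift_neg hv, orbitPoint_neg]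

instance : (volume : Measure (ℂ × ℂ)).IsAddHaarMeasure := by
  rw [Measure.volume_eq_prod]
  infer_instance

/-- The real determinant of a complex linear map is the squared modulus of its complex determinant,
here one. -/
theorem measurePreserving_mulVec (M : SL2C) : MeasurePreserving
    fun v : ℂ × ℂ => (M 0 0 * v.1 + M 0 1 * v.2, M 1 0 * v.1 + M 1 1 * v.2) := by
  set f := Matrix.toLin (Module.Basis.finTwoProd ℂ) (Module.Basis.finTwoProd ℂ)
    !![M 0 0, M 0 1; M 1 0, M 1 1] with hf
  have hfun : (fun v : ℂ × ℂ => (M 0 0 * v.1 + M 0 1 * v.2, M 1 0 * v.1 + M 1 1 * v.2)) =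
      (f.restrictScalars ℝ : ℂ × ℂ → ℂ × ℂ) := by
    funext v
    rw [LinearMap.coe_restrictScalars, hf, Matrix.toLin_finTwoProd_apply]
  have hdet : LinearMap.det (f.restrictScalars ℝ) = 1 := by
    rw [LinearMap.det_restrictScalars, hf, LinearMap.det_toLin, Matrix.det_fin_two_of, det_eq,
      map_one]
  have hmap := Measure.map_linearMap_addHaar_eq_smul_addHaar (volume : Measure (ℂ × ℂ))
    (f := f.restrictScalars ℝ) (by rw [hdet]; exact one_ne_zero)
  rw [hdet] at hmap
  refine ⟨by fun_prop, ?_⟩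
  rw [hfun, hmap]
  simp

/-- The `v`-dependent translation disappears in the inner integral over `ζ`, and the unimodular map
in the outer one over `v`. -/
theorem lintegral_orbitMeasure_smul {φ : WFun w s} (M : SL2C) {F : Orbit φ → ℝ≥0∞}
    (hF : Measurable F) : ∫⁻ x, F (M • x) ∂orbitMeasure φ = ∫⁻ x, F x ∂orbitMeasure φ := by
  have hm : Measurable fun p => F (orbitPoint φ (colLift p)) :=
    hF.comp (measurable_orbitPoint_colLift φ)
  refine (lintegral_orbitMeasure (hF.comp (continuous_smul_orbit φ M).measurable)).trans ?_
  rw [lintegral_orbitMeasure hF]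
  congr 1
  rw [← (measurePreserving_mulVec M).lintegral_comp
    (f := fun v => ∫⁻ ζ : ℂ, F (orbitPoint φ (colLift (v, ζ)))) hm.lintegral_prod_right']
  refine lintegral_congr_ae ?_
  filter_upwards [ae_ne_zero_prod] with v hv
  obtain ⟨c, hc⟩ := exists_mul_colLift M hv
  simp only [Function.comp_apply, smul_orbitPoint, hc]
  exact lintegral_add_right_eq_self (fun ζ => F (orbitPoint φ (colLift
    ((M 0 0 * v.1 + M 0 1 * v.2, M 1 0 * v.1 + M 1 1 * v.2), ζ)))) c

/-- The coordinates `(v, ζ)` of a matrix. -/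
noncomputable def colCoord (Λ : SL2C) : (ℂ × ℂ) × ℂ :=
  ((Λ 0 1, Λ 1 1), (Λ 0 0 * conj (Λ 0 1) + Λ 1 0 * conj (Λ 1 1)) /
    ((‖Λ 0 1‖ ^ 2 + ‖Λ 1 1‖ ^ 2 : ℝ) : ℂ))

theorem continuous_colCoord : Continuous colCoord := by
  have h := fun i j => continuous_entry i j
  refine ((h 0 1).prodMk (h 1 1)).prodMk (Continuous.div ?_ ?_ fun Λ => ?_)
  · exact ((h 0 0).mul (Complex.continuous_conj.comp (h 0 1))).add
      ((h 1 0).mul (Complex.continuous_conj.comp (h 1 1)))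
  · exact Complex.continuous_ofReal.comp (((h 0 1).norm.pow 2).add ((h 1 1).norm.pow 2))
  · have := denom_pos Λ 0
    simp only [mul_zero, zero_add] at this
    exact_mod_cast this.ne'

theorem colCoord_colLift {v : ℂ × ℂ} (hv : v ≠ 0) (ζ : ℂ) : colCoord (colLift (v, ζ)) = (v, ζ) := by
  have hn : ((‖v.1‖ ^ 2 + ‖v.2‖ ^ 2 : ℝ) : ℂ) ≠ 0 := by
    exact_mod_cast (norm_sq_add_pos hv).ne'
  have e : v.1 * conj v.1 + v.2 * conj v.2 = ((‖v.1‖ ^ 2 + ‖v.2‖ ^ 2 : ℝ) : ℂ) := by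
    rw [Complex.mul_conj', Complex.mul_conj']; push_cast; rfl
  rw [colCoord, colLift_apply_zero_zero hv, colLift_apply_zero_one hv, colLift_apply_one_zero hv,
    colLift_apply_one_one hv]
  refine Prod.ext rfl ?_
  simp only
  generalize ((‖v.1‖ ^ 2 + ‖v.2‖ ^ 2 : ℝ) : ℂ) = N at *
  field_simp
  linear_combination ζ * N * e

theorem isCompact_preimage_orbitPoint (hw : w ≤ -1) {φ : WFun w s} (hφ : φ ≠ 0) {K : Set (Orbit φ)}
    (hK : IsCompact K) : IsCompact (orbitPoint φ ⁻¹' K) := by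
  have h := isCompact_preimage_smul hw hφ (hK.image continuous_subtype_val)
  convert h using 1
  ext Λ
  constructor
  · intro hΛ
    exact ⟨_, hΛ, rfl⟩
  · rintro ⟨x, hx, hxΛ⟩
    have : x = orbitPoint φ Λ := Subtype.ext hxΛ
    rwa [Set.mem_preimage, ← this]

/-- Finiteness on compact sets is where properness enters: the matrices over a compact part of the
orbit form a compact set, and their coordinates `(v, ζ)` a compact set of finite Lebesgue measure.
-/
theorem isLorentzInvariantMeasure_orbitMeasure (hw : w ≤ -1) {φ : WFun w s} (hφ : φ ≠ 0) :
    IsLorentzInvariantMeasure (orbitMeasure φ) := by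
  refine ⟨fun h0 => ?_, fun K hK => ?_, smulInvariantMeasure_of_lintegral
    (fun M => (continuous_smul_orbit φ M).measurable) fun M F hF =>
      lintegral_orbitMeasure_smul M hF⟩
  · have := lintegral_orbitMeasure (φ := φ) (F := fun _ => 1) measurable_const
    rw [h0] at this
    simp at this
  · have hKm : MeasurableSet K := hK.isClosed.measurableSet
    have hm := measurable_orbitPoint_colLift φ
    have h1 : orbitMeasure φ K = 8 * volume ((fun p => orbitPoint φ (colLift p)) ⁻¹' K) := by
      rw [← lintegral_indicator_one hKm,
        lintegral_orbitMeasure ((measurable_one (β := Orbit φ)).indicator hKm),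
        ← lintegral_indicator_one (hm hKm)]
      congr 1
      exact (lintegral_prod _ ((measurable_one.indicator (hm hKm)).aemeasurable)).symm
    have hc : IsCompact (colCoord '' (orbitPoint φ ⁻¹' K)) :=
      (isCompact_preimage_orbitPoint hw hφ hK).image continuous_colCoord
    have h2 : volume ((fun p => orbitPoint φ (colLift p)) ⁻¹' K) ≤
        volume (colCoord '' (orbitPoint φ ⁻¹' K)) := by
      refine measure_mono_ae ?_
      have hne : ∀ᵐ p : (ℂ × ℂ) × ℂ, p.1 ≠ 0 := by
        rw [Measure.volume_eq_prod]
        exact Measure.quasiMeasurePreserving_fst.ae ae_ne_zero_prod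
      filter_upwards [hne] with p hp hpK
      exact ⟨colLift p, hpK, colCoord_colLift hp p.2⟩
    rw [h1]
    exact ENNReal.mul_lt_top (by norm_num) (h2.trans_lt hc.measure_lt_top)

/-! ### Integrating out the angle `ψ` when `Γ` acts trivially. -/

theorem IsLorentzInvariantMeasure.of_smul {X : Type*} [TopologicalSpace X] [MeasurableSpace X]
    [SMul SL2C X] {μ : Measure X} {c : ℝ≥0∞} (hc : c ≠ 0) (hc' : c ≠ ∞)
    (h : IsLorentzInvariantMeasure (c • μ)) : IsLorentzInvariantMeasure μ := by
  refine ⟨fun h0 => h.ne_zero (by rw [h0, smul_zero]), fun K hK => ?_, ⟨fun M S hS => ?_⟩⟩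
  · have := h.finite_on_compacts K hK
    rw [Measure.smul_apply, smul_eq_mul] at this
    by_contra hn
    rw [not_lt, top_le_iff] at hn
    rw [hn, ENNReal.mul_top hc] at this
    exact lt_irrefl _ this
  · have := h.invariant.measure_preimage_smul M hS
    rw [Measure.smul_apply, Measure.smul_apply, smul_eq_mul, smul_eq_mul] at this
    exact (ENNReal.mul_right_inj hc hc').1 this

theorem lintegral_comp_exp_mul {H : ℂ → ℝ≥0∞} (hH : Measurable H) (t b : ℝ) :
    ∫⁻ ζ : ℂ, H (Complex.exp (Complex.I * b) * (Real.exp t * ζ)) =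
      ENNReal.ofReal (Real.exp (-(2 * t))) * ∫⁻ ζ, H ζ := by
  have h1 := (rotation (Circle.exp b)).measurePreserving.lintegral_comp hH
  simp only [rotation_apply, Circle.coe_exp] at h1
  have h2 := Measure.map_addHaar_smul (volume : Measure ℂ) (Real.exp_pos t).ne'
  have h3 : ∫⁻ ζ : ℂ, H (Complex.exp (b * Complex.I) * (Real.exp t • ζ)) =
      ∫⁻ ζ : ℂ, H (Complex.exp (b * Complex.I) * ζ)
        ∂(Measure.map (Real.exp t • ·) (volume : Measure ℂ)) :=
    (lintegral_map (f := fun ζ => H (Complex.exp (b * Complex.I) * ζ)) (by fun_prop)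
      (by fun_prop)).symm
  rw [h2, lintegral_smul_measure, h1, Complex.finrank_real_complex, smul_eq_mul,
    abs_of_pos (by positivity), ← Real.exp_nat_mul, ← Real.exp_neg] at h3
  rw [mul_comm Complex.I]
  simpa [Complex.real_smul] using h3

/-- The rotation by `b` turns the null rotation on its way to the right. The factor `e^t` comes from
the opposite order of boost and null rotation in the two coordinate systems. -/
theorem orbitPoint_lorentzCoord_of_Gam_le {φ : WFun w s} (h : Gam ≤ littleGroup φ) (t a b θ : ℝ)
    (ζ : ℂ) : orbitPoint φ (lorentzCoord (t, ζ.re, ζ.im, a, b, θ)) =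
      orbitPoint φ (gamCoord (t, (Complex.exp (Complex.I * b) * (Real.exp t * ζ)).re,
        (Complex.exp (Complex.I * b) * (Real.exp t * ζ)).im, a, θ)) := by
  rw [lorentzCoord_eq, gamCoord_eq, Complex.re_add_im, Complex.re_add_im, mul_assoc _ (rotZ b),
    rotZ_mul_tri, ← mul_assoc, orbitPoint_mul_of_mem (h (rotZ_mem_Gam b))]
  congr 3
  have e : ((Real.exp t : ℝ) : ℂ) * (Real.exp (-(t / 2)) : ℝ) = (Real.exp (t / 2) : ℝ) := by
    rw [← Complex.ofReal_mul, ← Real.exp_add]; congr 2; ring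
  linear_combination -Complex.exp (Complex.I * b) * ζ * e

/-- Substituting `ζ ↦ e^{ib} e^t ζ` has Jacobian `e^{2t}`, which cancels the density. The integrand
no longer depends on the angle `b`, whose integral gives `2π`. -/
theorem orbitMeasure_eq_smul {φ : WFun w s} (h : Gam ≤ littleGroup φ) :
    orbitMeasure φ = ENNReal.ofReal (2 * Real.pi) •
      gamCoordMeasure.map fun y => orbitPoint φ (gamCoord y) := by
  have hm : Measurable fun y => orbitPoint φ (gamCoord y) :=
    ((continuous_orbitPoint φ).comp continuous_gamCoord).measurable
  refine Measure.ext_of_lintegral _ fun F hF => ?_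
  have hFm : Measurable fun y => F (orbitPoint φ (gamCoord y)) := hF.comp hm
  rw [lintegral_orbitMeasure_coord hF, lintegral_smul_measure, lintegral_map hF hm,
    lintegral_gamCoordMeasure hFm, smul_eq_mul, ← lintegral_const_mul' _ _ ENNReal.ofReal_ne_top]
  refine lintegral_congr fun t => ?_
  rw [← lintegral_const_mul' _ _ ENNReal.ofReal_ne_top]
  refine lintegral_congr fun a => ?_
  have key : ∀ b θ : ℝ, ENNReal.ofReal (Real.exp (2 * t) * Real.sin θ) *
      ∫⁻ ζ : ℂ, F (orbitPoint φ (lorentzCoord (t, ζ.re, ζ.im, a, b, θ))) =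
      ENNReal.ofReal (Real.sin θ) *
        ∫⁻ ζ : ℂ, F (orbitPoint φ (gamCoord (t, ζ.re, ζ.im, a, θ))) := by
    intro b θ
    simp only [orbitPoint_lorentzCoord_of_Gam_le h]
    rw [lintegral_comp_exp_mul (H := fun ζ => F (orbitPoint φ (gamCoord (t, ζ.re, ζ.im, a, θ))))
      (hFm.comp (g := fun y => F (orbitPoint φ (gamCoord y)))
        (f := fun ζ : ℂ => (t, ζ.re, ζ.im, a, θ)) (by fun_prop)), ← mul_assoc]
    congr 1
    rw [mul_comm, ← ENNReal.ofReal_mul (by positivity), ← mul_assoc, ← Real.exp_add,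
      neg_add_cancel, Real.exp_zero, one_mul]
  simp only [key]
  rw [lintegral_const, Measure.restrict_apply_univ, Real.volume_Ico, sub_zero, mul_comm]

theorem isLorentzInvariantMeasure_gamCoord (hw : w ≤ -1) {φ : WFun w s} (hφ : φ ≠ 0)
    (h : Gam ≤ littleGroup φ) :
    IsLorentzInvariantMeasure (gamCoordMeasure.map fun y => orbitPoint φ (gamCoord y)) := by
  have := isLorentzInvariantMeasure_orbitMeasure hw hφ
  rw [orbitMeasure_eq_smul h] at this
  exact this.of_smul (ENNReal.ofReal_pos.2 Real.two_pi_pos).ne' ENNReal.ofReal_ne_top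

end WeightedSphere
theorem mainTheorem2 (w : ℝ) (hw : w ≤ -1) (s : ℤ) :
    -- the functions invariant under each of the four groups
    (∀ φ : WFun w s,
      (littleGroup φ = ⊤ ↔ φ = 0) ∧
      (SU2 ≤ littleGroup φ ↔ φ = 0 ∨ (s = 0 ∧ IsConst φ)) ∧
      (Gam ≤ littleGroup φ ↔ IsAxisymmetric φ) ∧
      Z2 ≤ littleGroup φ) ∧
    -- the identity component of the little group of an arbitrary function
    (∀ φ : WFun w s,
      (littleGroupIdComponent φ = ⊤ ↔ φ = 0) ∧
      (IsConjSubgroup (littleGroupIdComponent φ) SU2 ↔ φ ≠ 0 ∧ IsConstUpToLorentz φ) ∧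
      (IsConjSubgroup (littleGroupIdComponent φ) Gam ↔
        φ ≠ 0 ∧ ¬ IsConstUpToLorentz φ ∧ IsAxisymmetricUpToLorentz φ) ∧
      (littleGroupIdComponent φ = ⊥ ↔ ¬ IsAxisymmetricUpToLorentz φ)) ∧
    -- the little groups that are connected or equal to `{1, -1}`
    (∀ φ : WFun w s, (IsConnected (littleGroup φ : Set SL2C) ∨ littleGroup φ = Z2) →
      (littleGroup φ = ⊤ ∧ φ = 0) ∨
      (IsConjSubgroup (littleGroup φ) SU2 ∧ φ ≠ 0 ∧ IsConstUpToLorentz φ) ∨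
      (IsConjSubgroup (littleGroup φ) Gam ∧
        φ ≠ 0 ∧ ¬ IsConstUpToLorentz φ ∧ IsAxisymmetricUpToLorentz φ) ∨
      (littleGroup φ = Z2 ∧ ¬ IsAxisymmetricUpToLorentz φ)) ∧
    -- which of the four groups occur
    (((∃ φ : WFun w s, littleGroup φ = SU2) ↔ s = 0) ∧
      (∃ φ : WFun w s, littleGroup φ = Gam) ∧
      {φ : WFun w s | littleGroup φ = Z2} ∈ residual (WFun w s)) ∧
    -- the orbit of `φ` is the quotient of `SL(2,ℂ)` by the little group
    (∀ φ : WFun w s, IsHomeomorph (MulAction.orbitEquivQuotientStabilizer SL2C φ)) ∧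
    -- orbits with little group `SL(2,ℂ)`
    (∀ φ : WFun w s, littleGroup φ = ⊤ → MulAction.orbit SL2C φ = {0}) ∧
    -- orbits with little group `SU(2)`
    (∀ φ : WFun w s, littleGroup φ = SU2 →
      ∃ e : Orbit φ ≃ₜ R3,
        (∀ Λ : SL2C, hyperboloidMatrix (e (orbitPoint φ Λ)) =
          (Λ : Matrix (Fin 2) (Fin 2) ℂ) * (Λ : Matrix (Fin 2) (Fin 2) ℂ).conjTranspose) ∧
        IsLorentzInvariantMeasure (hyperboloidMeasure.map e.symm)) ∧
    -- orbits with little group `Γ`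
    (∀ φ : WFun w s, littleGroup φ = Gam →
      Nonempty (Orbit φ ≃ₜ R3 × S2) ∧
      (fun y => orbitPoint φ (gamCoord y)) '' gamRange = Set.univ ∧
      Set.InjOn (fun y => orbitPoint φ (gamCoord y)) gamRegularRange ∧
      IsLorentzInvariantMeasure (gamCoordMeasure.map fun y => orbitPoint φ (gamCoord y))) ∧
    -- orbits with little group `{1, -1}`
    (∀ φ : WFun w s, littleGroup φ = Z2 →
      Nonempty (Orbit φ ≃ₜ R3 × RP3) ∧
      (fun x => orbitPoint φ (lorentzCoord x)) '' lorentzRange = Set.univ ∧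
      Set.InjOn (fun x => orbitPoint φ (lorentzCoord x)) lorentzRegularRange ∧
      IsLorentzInvariantMeasure
        (lorentzCoordMeasure.map fun x => orbitPoint φ (lorentzCoord x))) ∧
    -- gravitational memory
    (s = -2 → ∀ φ : WFun w s, φ ≠ 0 →
      (IsConnected (littleGroup φ : Set SL2C) ∨ littleGroup φ = Z2) →
      IsConjSubgroup (littleGroup φ) Gam ∨ littleGroup φ = Z2) := by
  -- Properness needs `φ ≠ 0`, and every little group other than the whole group guarantees it.
  have hne : ∀ {φ : WFun w s}, littleGroup φ ≠ ⊤ → φ ≠ 0 := fun h h0 =>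
    h ((littleGroup_eq_top_iff hw _).2 h0)
  refine ⟨fun φ => ⟨littleGroup_eq_top_iff hw φ, SU2_le_littleGroup_iff φ,
      Gam_le_littleGroup_iff_isAxisymmetric φ, Z2_le_littleGroup φ⟩,
    fun φ => ⟨idComponent_eq_top_iff hw φ, idComponent_isConj_SU2_iff hw φ,
      idComponent_isConj_Gam_iff hw φ, idComponent_eq_bot_iff hw φ⟩,
    littleGroup_cases hw,
    ⟨exists_littleGroup_eq_SU2_iff hw, ⟨_, littleGroup_discFun hw⟩, residual_littleGroup_eq_Z2⟩,
    isHomeomorph_orbitEquivQuotientStabilizer hw, fun φ h => ?_, fun φ h => ?_, fun φ h => ?_,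
    fun φ h => ?_, fun hs φ hφ h => ?_⟩
  · rw [(littleGroup_eq_top_iff hw φ).1 h]
    exact orbit_zero
  · have hφ : φ ≠ 0 := hne (h ▸ SU2_ne_top)
    obtain ⟨e, he⟩ := exists_homeomorph_of_littleGroup_eq_SU2 hw hφ h
    exact ⟨e, fun Λ => by rw [he, hyperboloidMatrix_hyperVec],
      isLorentzInvariantMeasure_hyperboloid h e he⟩
  · have hφ : φ ≠ 0 := hne fun h' => SU2_ne_top (top_le_iff.1 (h' ▸ h.le.trans Gam_le_SU2))
    exact ⟨nonempty_homeomorph_of_littleGroup_eq_Gam hw hφ h, image_gamCoord h.ge,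
      injOn_gamCoord h, isLorentzInvariantMeasure_gamCoord hw hφ h.ge⟩
  · have hφ : φ ≠ 0 := hne fun h' => SU2_ne_top (top_le_iff.1 (h' ▸ h.le.trans Z2_le_SU2))
    exact ⟨nonempty_homeomorph_of_littleGroup_eq_Z2 hw hφ h, image_lorentzCoord φ,
      injOn_lorentzCoord h, isLorentzInvariantMeasure_orbitMeasure hw hφ⟩
  · rcases littleGroup_cases hw φ h with h' | h' | h' | h'
    · exact absurd h'.2 hφ
    · exact absurd (hs.symm.trans h'.2.2.1) (by norm_num)
    · exact Or.inl h'.1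
    · exact Or.inr h'.1
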